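/- Let $M$ be a smooth ($C^\infty$, Hausdorff, second countable) manifold of dimension $n$, let $T_2=g_{jk}\,dx^j dx^k$ be a pseudo-Riemannian metric on $M$ (a smooth nondegenerate symmetric 2-covariant tensor field of arbitrary signature), let $\nabla$ be its Levi-Civita connection, with Christoffel symbols $\Gamma^\ell_{jk}$, and let $\hbar>0$. Let $\mathcal A=C^\infty(M,\mathbb C)$ and let $P\colon\mathcal A\to\mathcal A$ be a linear differential operator: a $\mathbb C$-linear map such that, for some $r\ge 0$ and for every $x\in M$, $P$ maps $\mathfrak m_x^{r+1}$ into $\mathfrak m_x$, where $\mathfrak m_x\subset\mathcal A$ is the ideal of the functions vanishing at $x$. Quantization assigns to a smooth symmetric contravariant tensor field $\Phi=\Phi_N+\dots+\Phi_0$ on $M$ with complex coefficients ($\Phi_r$ homogeneous of order $r$) the operator $$\widehat\Phi(f)=\sum_r(-i\hbar)^r\langle\Phi_r,\nabla^r_{\mathrm{sym}}f\rangle ,\qquad f\in\mathcal A,$$ where $\nabla^r_{\mathrm{sym}}f$ is the symmetrization of the $r$-th iterated covariant differential of $f$. The dequantized of $P$ is the tensor field $\Phi$ with $\widehat\Phi=P$;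 the Hamiltonian of $P$ is the function $F(x,p)=\sum_r\Phi_r(x)(p,\dots,p)$ on $T^*M$; and the infinitesimal canonical transformation associated with $P$ is the field $D_P$ of (complex) tangent vectors on $T^*M$ determined by $D_P\lrcorner\,\omega_2+dF=0$, where $\omega_2=d\theta$ and $\theta$ is the Liouville form of $T^*M$. A field $D$ on $T^*M$ is called a second order differential equation if, for every $x\in M$ and $v\in T_xM$, the value of $D$ at the covector $T_2(v,\cdot)\in T^*_xM$ is mapped to $v$ by the differential of the projection $T^*M\to M$. Then $D_P$ is a second order differential equation if and only if there is a function $U\in\mathcal A$ such that $$P=-\frac{\hbar^2}{2}\Delta+U,$$ where $\Delta f=g^{jk}\left(\frac{\partial^2 f}{\partial x^k\partial x^j}-\Gamma^\ell_{jk}\frac{\partial f}{\partial x^\ell}\right)$ is the Laplacian of the metric. -/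

import Mathlib

open scoped Manifold ContDiff Topology TensorProduct

noncomputable section

namespace Dequantization

/-- `ℂ`, as a real manifold, is a smooth ring; so smooth complex-valued functions form a ring. -/
instance contMDiffRingComplex : ContMDiffRing 𝓘(ℝ, ℂ) ∞ ℂ where
  contMDiff_add := contMDiff_add 𝓘(ℝ, ℂ) ∞
  contMDiff_mul := (contDiff_mul (𝕜 := ℝ) (𝔸 := ℂ)).comp_contMDiff
    (contMDiff_fst.prodMk_space contMDiff_snd)

/-! ### Functions and linear differential operators -/

/-- The ring of complex-valued smooth functions on `M`. -/
abbrev SmoothFun (n : ℕ) (M : Type*) [TopologicalSpace M]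
    [ChartedSpace (EuclideanSpace ℝ (Fin n)) M] : Type _ :=
  C^∞⟮𝓡 n, M; 𝓘(ℝ, ℂ), ℂ⟯

section

variable {n : ℕ} {M : Type*} [TopologicalSpace M] [ChartedSpace (EuclideanSpace ℝ (Fin n)) M]

/-- The constant function with value `c`. -/
def constFun (c : ℂ) : SmoothFun n M := ⟨fun _ => c, contMDiff_const⟩

/-- The ideal `𝔪ₓ` of the smooth functions vanishing at `x`. -/
def vanishingIdeal (x : M) : Ideal (SmoothFun n M) where
  carrier := {f | f x = 0}
  add_mem' := by
    intro a b ha hb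
    simp only [Set.mem_ofPred_eq] at ha hb ⊢
    simp [ha, hb]
  zero_mem' := by simp
  smul_mem' := by
    intro c f hf
    simp only [Set.mem_ofPred_eq] at hf ⊢
    simp [hf]

/-- `P` is a linear differential operator of order at most `r`: it is `ℂ`-linear and maps
`𝔪ₓ ^ (r + 1)` into `𝔪ₓ` for every point `x`. -/
structure IsDiffOpOfOrder (r : ℕ) (P : SmoothFun n M → SmoothFun n M) : Prop where
  map_add : ∀ f h, P (f + h) = P f + P h
  map_const_mul : ∀ (c : ℂ) f, P ((constFun c : SmoothFun n M) * f) = (constFun c : SmoothFun n M) * P f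
  map_pow : ∀ (x : M), ∀ f ∈ vanishingIdeal x ^ (r + 1), P f ∈ vanishingIdeal x

/-- `P` is a linear differential operator (of some finite order). -/
def IsLinearDiffOp (P : SmoothFun n M → SmoothFun n M) : Prop :=
  ∃ r, IsDiffOpOfOrder r P

end

/-! ### Local coordinates -/

section

variable {n : ℕ} {M : Type*} [TopologicalSpace M] [ChartedSpace (EuclideanSpace ℝ (Fin n)) M]

/-- Partial derivative `∂h/∂xʲ` at `y` of a function on coordinate space. -/
def partialDeriv {F : Type*} [NormedAddCommGroup F] [NormedSpace ℝ F] (j : Fin n)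
    (h : EuclideanSpace ℝ (Fin n) → F) (y : EuclideanSpace ℝ (Fin n)) : F :=
  fderiv ℝ h y (EuclideanSpace.single j 1)

/-- The coordinate vector `∂/∂xʲ`, for the coordinates of the chart at `x₀`, at the point with
coordinates `y`. -/
def coordVector (x₀ : M) (j : Fin n) (y : EuclideanSpace ℝ (Fin n)) :
    TangentSpace (𝓡 n) ((extChartAt (𝓡 n) x₀).symm y) :=
  mfderiv 𝓘(ℝ, EuclideanSpace ℝ (Fin n)) (𝓡 n) (extChartAt (𝓡 n) x₀).symm y
    (EuclideanSpace.single j (1 : ℝ) : EuclideanSpace ℝ (Fin n))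

/-- The coordinate covector `dxʲ`, for the coordinates of the chart at `x₀`, at the point `x`. -/
def coordCovector (x₀ : M) (j : Fin n) (x : M) : TangentSpace (𝓡 n) x →L[ℝ] ℝ :=
  (EuclideanSpace.proj j : EuclideanSpace ℝ (Fin n) →L[ℝ] ℝ).comp
    (mfderiv (𝓡 n) 𝓘(ℝ, EuclideanSpace ℝ (Fin n)) (extChartAt (𝓡 n) x₀) x)

end

/-! ### Metric, Christoffel symbols, iterated covariant differentials, Laplacian -/

/-- A pseudo-Riemannian metric: a smooth field of nondegenerate symmetric bilinear forms, of
arbitrary signature, on the tangent spaces. -/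
structure PseudoRiemannianMetric (n : ℕ) (M : Type*) [TopologicalSpace M]
    [ChartedSpace (EuclideanSpace ℝ (Fin n)) M] [IsManifold (𝓡 n) ∞ M] where
  val : ∀ x : M, TangentSpace (𝓡 n) x →L[ℝ] TangentSpace (𝓡 n) x →L[ℝ] ℝ
  symm : ∀ x v w, val x v w = val x w v
  nondegenerate : ∀ x v, (∀ w, val x v w = 0) → v = 0
  contMDiff : ContMDiff (𝓡 n)
    ((𝓡 n).prod 𝓘(ℝ, EuclideanSpace ℝ (Fin n) →L[ℝ] EuclideanSpace ℝ (Fin n) →L[ℝ] ℝ)) ∞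
    (fun x => Bundle.TotalSpace.mk'
      (EuclideanSpace ℝ (Fin n) →L[ℝ] EuclideanSpace ℝ (Fin n) →L[ℝ] ℝ)
      (E := fun x : M => TangentSpace (𝓡 n) x →L[ℝ] TangentSpace (𝓡 n) x →L[ℝ] ℝ) x (val x))

section

variable {n : ℕ} {M : Type*} [TopologicalSpace M] [ChartedSpace (EuclideanSpace ℝ (Fin n)) M]
  [IsManifold (𝓡 n) ∞ M]

/-- The matrix `g_{ij}` of the metric in the chart at `x₀`, at the point with coordinates `y`.
Its inverse matrix is `g^{ij}`. -/
def metricMatrix (g : PseudoRiemannianMetric n M) (x₀ : M) (y : EuclideanSpace ℝ (Fin n)) :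
    Matrix (Fin n) (Fin n) ℝ :=
  Matrix.of fun i j =>
    g.val ((extChartAt (𝓡 n) x₀).symm y) (coordVector x₀ i y) (coordVector x₀ j y)

/-- The Christoffel symbols `Γˡ_{jk}` of the Levi-Civita connection in the chart at `x₀`. -/
def christoffel (g : PseudoRiemannianMetric n M) (x₀ : M) (l j k : Fin n)
    (y : EuclideanSpace ℝ (Fin n)) : ℝ :=
  (1 / 2) * ∑ m, (metricMatrix g x₀ y)⁻¹ l m *
    (partialDeriv j (fun z => metricMatrix g x₀ z m k) y
      + partialDeriv k (fun z => metricMatrix g x₀ z m j) y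
      - partialDeriv m (fun z => metricMatrix g x₀ z j k) y)

/-- The components, in the chart at `x₀`, of the `r`-th iterated covariant differential `∇ʳf`
for the Levi-Civita connection: `∇⁰f = f` and
`(∇ʳ⁺¹f)_{j₀ j₁ … jᵣ} = ∂_{j₀} (∇ʳf)_{j₁ … jᵣ} - ∑ᵢ ∑ₗ Γˡ_{j₀ jᵢ} (∇ʳf)_{j₁ … l … jᵣ}`,
with `l` in the `i`-th place. -/
def covDiff (g : PseudoRiemannianMetric n M) (f : SmoothFun n M) (x₀ : M) :
    (r : ℕ) → (Fin r → Fin n) → EuclideanSpace ℝ (Fin n) → ℂ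
  | 0, _, y => f ((extChartAt (𝓡 n) x₀).symm y)
  | r + 1, J, y =>
      partialDeriv (J 0) (covDiff g f x₀ r (Fin.tail J)) y
        - ∑ i : Fin r, ∑ l : Fin n, (christoffel g x₀ l (J 0) (Fin.tail J i) y : ℂ) *
            covDiff g f x₀ r (Function.update (Fin.tail J) i l) y

/-- The components at `x` (in the chart at `x`) of the symmetrized tensor `∇ʳ_sym f`. -/
def symCovDiff (g : PseudoRiemannianMetric n M) (f : SmoothFun n M) (r : ℕ) (x : M)
    (J : Fin r → Fin n) : ℂ :=
  (r.factorial : ℂ)⁻¹ * ∑ σ : Equiv.Perm (Fin r),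
    covDiff g f x r (J ∘ σ) (extChartAt (𝓡 n) x x)

/-- The Laplacian of the metric:
`Δf = ∑ g^{jk} (∂²f/∂xᵏ∂xʲ - ∑ₗ Γˡ_{jk} ∂f/∂xˡ)`, at `x`, in the chart at `x`. -/
def laplacian (g : PseudoRiemannianMetric n M) (f : SmoothFun n M) (x : M) : ℂ :=
  let y := extChartAt (𝓡 n) x x
  let h : EuclideanSpace ℝ (Fin n) → ℂ := fun z => f ((extChartAt (𝓡 n) x).symm z)
  ∑ j, ∑ k, (((metricMatrix g x y)⁻¹ j k : ℝ) : ℂ) *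
    (partialDeriv k (partialDeriv j h) y
      - ∑ l, (christoffel g x l j k y : ℂ) * partialDeriv l h y)

end

/-! ### Symmetric contravariant tensor fields and quantization -/

/-- A smooth symmetric contravariant tensor field of order `r`, with complex coefficients: at each
point `x`, a symmetric multilinear form on the cotangent space, such that the components in local
coordinates are smooth. -/
structure SymTensorField (n : ℕ) (M : Type*) [TopologicalSpace M]
    [ChartedSpace (EuclideanSpace ℝ (Fin n)) M] (r : ℕ) where
  val : ∀ x : M, MultilinearMap ℝ (fun _ : Fin r => TangentSpace (𝓡 n) x →L[ℝ] ℝ) ℂ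
  symm : ∀ x (σ : Equiv.Perm (Fin r)) (α : Fin r → (TangentSpace (𝓡 n) x →L[ℝ] ℝ)),
    val x (fun k => α (σ k)) = val x α
  smooth : ∀ (x₀ : M) (J : Fin r → Fin n),
    ContMDiffOn (𝓡 n) 𝓘(ℝ, ℂ) ∞
      (fun x => val x (fun k => coordCovector x₀ (J k) x))
      (chartAt (EuclideanSpace ℝ (Fin n)) x₀).source

/-- A symmetric contravariant tensor field, not necessarily homogeneous: its homogeneous
components, all but finitely many of which vanish. -/
structure TensorField (n : ℕ) (M : Type*) [TopologicalSpace M]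
    [ChartedSpace (EuclideanSpace ℝ (Fin n)) M] where
  comp : ∀ r : ℕ, SymTensorField n M r
  finite : ∃ N, ∀ r, N < r → ∀ x, (comp r).val x = 0

/-- The cotangent bundle `T*M`. -/
abbrev CotangentBundle (n : ℕ) (M : Type*) [TopologicalSpace M]
    [ChartedSpace (EuclideanSpace ℝ (Fin n)) M] : Type _ :=
  Bundle.TotalSpace (EuclideanSpace ℝ (Fin n) →L[ℝ] ℝ)
    (fun x : M => TangentSpace (𝓡 n) x →L[ℝ] ℝ)

section

variable {n : ℕ} {M : Type*} [TopologicalSpace M] [ChartedSpace (EuclideanSpace ℝ (Fin n)) M]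

/-- The zero tensor field. -/
def zeroTensorField : TensorField n M where
  comp _ :=
    { val := fun _ => 0
      symm := fun _ _ _ => rfl
      smooth := fun _ _ => contMDiffOn_const }
  finite := ⟨0, fun _ _ _ => rfl⟩

/-- The function on fibres `p ↦ ∑ᵣ Φᵣ(p, …, p)` corresponding to the tensor field `Φ`, as a
function on the cotangent bundle. -/
def TensorField.toFun (Φ : TensorField n M)
    (q : CotangentBundle n M) : ℂ :=
  ∑ᶠ r : ℕ, (Φ.comp r).val q.proj (fun _ => q.snd)

variable [IsManifold (𝓡 n) ∞ M]

/-- The value `(-iħ)ʳ ⟨Φ, ∇ʳ_sym f⟩` at `x` of the quantized of a homogeneous tensor field,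
the contraction being written in the coordinates of the chart at `x`. -/
def SymTensorField.quantized (g : PseudoRiemannianMetric n M) (ħ : ℝ) {r : ℕ}
    (Φ : SymTensorField n M r) (f : SmoothFun n M) (x : M) : ℂ :=
  (-Complex.I * ħ) ^ r *
    ∑ J : Fin r → Fin n, Φ.val x (fun k => coordCovector x (J k) x) * symCovDiff g f r x J

/-- The value at `x` of the quantized of a tensor field: the sum over its homogeneous components. -/
def TensorField.quantized (g : PseudoRiemannianMetric n M) (ħ : ℝ)
    (Φ : TensorField n M) (f : SmoothFun n M) (x : M) : ℂ :=
  ∑ᶠ r : ℕ, (Φ.comp r).quantized g ħ f x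

open Classical in
/-- The dequantized of the operator `P`: the tensor field whose quantized is `P`. -/
def dequantized (g : PseudoRiemannianMetric n M) (ħ : ℝ) (P : SmoothFun n M → SmoothFun n M) :
    TensorField n M :=
  if h : ∃ Φ : TensorField n M, ∀ f x, P f x = Φ.quantized g ħ f x then h.choose
  else zeroTensorField

end

/-! ### The cotangent bundle, its symplectic form, Hamiltonian fields -/

/-- The exterior differential of a 1-form `η` on a manifold modelled on a normed space:
`dη(u, v) = ∂_u η(v) - ∂_v η(u)`, computed at `q` in the chart at `q`. -/
def extDerivOneForm {E H N : Type*} [NormedAddCommGroup E] [NormedSpace ℝ E] [TopologicalSpace H]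
    (I : ModelWithCorners ℝ E H) [TopologicalSpace N] [ChartedSpace H N]
    (η : ∀ q : N, TangentSpace I q →L[ℝ] ℝ) (q : N) :
    TangentSpace I q →ₗ[ℝ] TangentSpace I q →ₗ[ℝ] ℝ :=
  let φ := extChartAt I q
  let η' : E → (E →L[ℝ] ℝ) := fun z => (η (φ.symm z)).comp (mfderiv 𝓘(ℝ, E) I φ.symm z)
  let B : E →L[ℝ] E →L[ℝ] ℝ := fderiv ℝ η' (φ q)
  let A : TangentSpace I q →L[ℝ] E := mfderiv I 𝓘(ℝ, E) φ q
  LinearMap.mk₂ ℝ (fun u v => B (A u) (A v) - B (A v) (A u))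
    (fun u u' v => by simp only [map_add, add_apply]; ring)
    (fun c u v => by simp only [map_smul, smul_apply, smul_eq_mul]; ring)
    (fun u v v' => by simp only [map_add, add_apply]; ring)
    (fun c u v => by simp only [map_smul, smul_apply, smul_eq_mul]; ring)

/-- The model with corners (without boundary) of the cotangent bundle. -/
abbrev cotangentModel (n : ℕ) :=
  (𝓡 n).prod 𝓘(ℝ, EuclideanSpace ℝ (Fin n) →L[ℝ] ℝ)

section

variable {n : ℕ} {M : Type*} [TopologicalSpace M] [ChartedSpace (EuclideanSpace ℝ (Fin n)) M]
  [IsManifold (𝓡 n) ∞ M]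


/-- The differential at `q` of the projection `T*M → M`. -/
def projDeriv (q : CotangentBundle n M) :
    TangentSpace (cotangentModel n) q →L[ℝ] TangentSpace (𝓡 n) q.proj :=
  mfderiv (cotangentModel n) (𝓡 n) (fun q' : CotangentBundle n M => q'.proj) q

/-- The Liouville form `θ` on `T*M`: `θ_α = π^* α`. -/
def liouvilleForm (q : CotangentBundle n M) : TangentSpace (cotangentModel n) q →L[ℝ] ℝ :=
  q.snd.comp (projDeriv q)

/-- The canonical symplectic form `ω₂ = dθ` on `T*M`. -/
def symplecticForm (q : CotangentBundle n M) :
    TangentSpace (cotangentModel n) q →ₗ[ℝ] TangentSpace (cotangentModel n) q →ₗ[ℝ] ℝ :=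
  extDerivOneForm (cotangentModel n) (liouvilleForm (n := n) (M := M)) q

/-- The value on a real tangent vector `w` of the interior product `X ⌟ ω₂` of a complex tangent
vector `X` of `T*M` at `q` with the symplectic form (extended `ℂ`-linearly). -/
def contractSymplectic (q : CotangentBundle n M) (X : ℂ ⊗[ℝ] TangentSpace (cotangentModel n) q)
    (w : TangentSpace (cotangentModel n) q) : ℂ :=
  LinearMap.liftBaseChange ℂ
    (Complex.ofRealCLM.toLinearMap ∘ₗ (symplecticForm q).flip w) X

/-- The differential of a complex function on `T*M` at `q`. -/
def cotangentDiff (F : CotangentBundle n M → ℂ) (q : CotangentBundle n M) :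
    TangentSpace (cotangentModel n) q →L[ℝ] ℂ :=
  mfderiv (cotangentModel n) 𝓘(ℝ, ℂ) F q

open Classical in
/-- The Hamiltonian field of a complex function `F` on `T*M`: the field `D` of complex tangent
vectors with `D ⌟ ω₂ + dF = 0`. -/
def hamiltonianField (F : CotangentBundle n M → ℂ) (q : CotangentBundle n M) :
    ℂ ⊗[ℝ] TangentSpace (cotangentModel n) q :=
  if h : ∃ X : ℂ ⊗[ℝ] TangentSpace (cotangentModel n) q,
      ∀ w, contractSymplectic q X w + cotangentDiff F q w = 0 then h.choose
  else 0

/-- The Hamiltonian of the operator `P`: the function on `T*M` corresponding to the dequantized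
tensor of `P`. -/
def hamiltonianOf (g : PseudoRiemannianMetric n M) (ħ : ℝ) (P : SmoothFun n M → SmoothFun n M) :
    CotangentBundle n M → ℂ :=
  (dequantized g ħ P).toFun

/-- The infinitesimal canonical transformation `D_P` associated with the operator `P`. -/
def associatedField (g : PseudoRiemannianMetric n M) (ħ : ℝ)
    (P : SmoothFun n M → SmoothFun n M) (q : CotangentBundle n M) :
    ℂ ⊗[ℝ] TangentSpace (cotangentModel n) q :=
  hamiltonianField (hamiltonianOf g ħ P) q

/-- A field `D` on `T*M` is a second order differential equation: under the isomorphism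
`TM ≃ T*M`, `v ↦ g(v, ·)`, its value at each tangent vector `v` projects onto `v`. -/
def IsSecondOrderEquation (g : PseudoRiemannianMetric n M)
    (D : ∀ q : CotangentBundle n M, ℂ ⊗[ℝ] TangentSpace (cotangentModel n) q) : Prop :=
  ∀ (x : M) (v : TangentSpace (𝓡 n) x),
    (projDeriv (⟨x, g.val x v⟩ : CotangentBundle n M)).toLinearMap.baseChange ℂ
      (D ⟨x, g.val x v⟩) = (1 : ℂ) ⊗ₜ[ℝ] v

end

end Dequantization

end

set_option linter.unusedSectionVars false

noncomputable section

namespace Dequantization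

section

variable {n : ℕ} {M : Type*} [TopologicalSpace M] [ChartedSpace (EuclideanSpace ℝ (Fin n)) M]
  [IsManifold (𝓡 n) ∞ M]

local notation "𝔼" => EuclideanSpace ℝ (Fin n)

/-! Three facts combine.

Symplectic side. In the chart of `T*M` at a point, the symplectic form is the constant form `dp_j ∧
dxʲ`. Pairing `D ⌟ ω₂ + dF = 0` with vertical vectors shows that the projection of `D` to `M` is the
fibre derivative `∂F/∂p`. Since `v ↦ g(v, ·)` is onto the cotangent space, `D` is a second order
equation exactly when `∂F/∂p_j = g^{jk} p_k` on each fibre, that is, when `F(x, p) = F(x, 0) + ½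
g^{jk} p_j p_k`. Scaling `p` separates the degrees of this polynomial and polarization recovers each
symmetric tensor. So the dequantized tensor must be `½ g^{jk} + U`, with `U` its component of order
zero, and its quantized is `-ħ²/2 Δ + U` by direct computation.

Injectivity of quantization. If `h x = 0`, then at `x` the covariant differentials of `h ^ N` of
order below `N` vanish, and the one of order `N` is `N!` times the `N`-th tensor power of `dh`.
Testing on such powers recovers the components of a tensor field from the top degree downwards
(`TensorField.val_eq_of_quantized_eq`). This gives the converse implication, and makes the choice in
`dequantized` harmless.

Existence of the dequantized (`IsDiffOpOfOrder.exists_quantized_eq`), by induction on the order `r`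
of `P`. By Hadamard's lemma, a product of `r` functions vanishing at `x` depends, modulo `𝔪ₓ ^ (r +
1)`, only on their differentials at `x`. Hence `P` has a principal symbol, which is a symmetric
tensor. Subtracting its quantized leaves an operator that vanishes at `x` on all `h ^ r` with `h ∈
𝔪ₓ`, hence on `𝔪ₓ ^ r` by polarization, so the order drops. Two smoothness statements are needed:
that of the symbol, and that of a quantized function, whose definition uses a different chart at
every point. The latter rests on the tensoriality of `∇ʳ f` (`covDiff_change`), hence on the
transformation law of the Christoffel symbols. -/

instance isManifold_one : IsManifold (𝓡 n) 1 M := IsManifold.of_le (n := ∞) (by simp)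

/-! ### Charts of the manifold and of its cotangent bundle -/

theorem range_modelEuclidean : Set.range (𝓡 n) = Set.univ := by simp

theorem mdifferentiableAt_extChartAt_symm {x₀ : M} {y : 𝔼} (hy : y ∈ (extChartAt (𝓡 n) x₀).target) :
    MDifferentiableAt 𝓘(ℝ, 𝔼) (𝓡 n) (extChartAt (𝓡 n) x₀).symm y := by
  have := mdifferentiableWithinAt_extChartAt_symm (I := 𝓡 n) hy
  rwa [range_modelEuclidean, mdifferentiableWithinAt_univ] at this

theorem mfderiv_extChartAt_comp_symm {x₀ : M} {y : 𝔼} (hy : y ∈ (extChartAt (𝓡 n) x₀).target) :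
    (mfderiv (𝓡 n) 𝓘(ℝ, 𝔼) (extChartAt (𝓡 n) x₀) ((extChartAt (𝓡 n) x₀).symm y)).comp
      (mfderiv 𝓘(ℝ, 𝔼) (𝓡 n) (extChartAt (𝓡 n) x₀).symm y) = ContinuousLinearMap.id ℝ 𝔼 := by
  have := mfderiv_extChartAt_comp_mfderivWithin_extChartAt_symm (I := 𝓡 n) hy
  rwa [range_modelEuclidean, mfderivWithin_univ] at this

theorem mfderiv_symm_comp_extChartAt {x₀ x : M} (hx : x ∈ (extChartAt (𝓡 n) x₀).source) :
    (mfderiv 𝓘(ℝ, 𝔼) (𝓡 n) (extChartAt (𝓡 n) x₀).symm (extChartAt (𝓡 n) x₀ x)).comp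
      (mfderiv (𝓡 n) 𝓘(ℝ, 𝔼) (extChartAt (𝓡 n) x₀) x) =
      ContinuousLinearMap.id ℝ (TangentSpace (𝓡 n) x) := by
  have := mfderivWithin_extChartAt_symm_comp_mfderiv_extChartAt' (I := 𝓡 n) hx
  rwa [range_modelEuclidean, mfderivWithin_univ] at this

/-- The cotangent bundle is the bundle of homomorphisms from `TM` to a trivial line bundle. The
trivialization of the latter is the identity and that of `TM` is the derivative of the chart, so the
coordinates `(y, p)` stand for the covector `p_j dxʲ`. -/
theorem cotangent_extChartAt_symm (q : CotangentBundle n M) {z : 𝔼 × (𝔼 →L[ℝ] ℝ)}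
    (hz : z.1 ∈ (extChartAt (𝓡 n) q.proj).target) :
    (extChartAt (cotangentModel n) q).symm z =
      (⟨(extChartAt (𝓡 n) q.proj).symm z.1, z.2.comp
        (mfderiv (𝓡 n) 𝓘(ℝ, 𝔼) (extChartAt (𝓡 n) q.proj) ((extChartAt (𝓡 n) q.proj).symm z.1))⟩ :
        CotangentBundle n M) := by
  rw [FiberBundle.extChartAt, ← TangentBundle.continuousLinearMapAt_trivializationAt]
  · have : (Bundle.Trivialization.symmL ℝ (trivializationAt ℝ (fun _ : M => ℝ) q.proj)
        ((extChartAt (𝓡 n) q.proj).symm z.1)) = ContinuousLinearMap.id ℝ ℝ := 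
      Bundle.Trivial.symmL_trivialization ℝ M _ _
    change (⟨(extChartAt (𝓡 n) q.proj).symm z.1,
      (Bundle.Trivialization.symmL ℝ (trivializationAt ℝ (fun _ : M => ℝ) q.proj)
        ((extChartAt (𝓡 n) q.proj).symm z.1)).comp (z.2.comp _)⟩ : CotangentBundle n M) = _
    rw [this]
    rfl
  · simpa using (extChartAt (𝓡 n) q.proj).map_target hz

theorem cotangent_extChartAt_self (q : CotangentBundle n M) :
    extChartAt (cotangentModel n) q q = (extChartAt (𝓡 n) q.proj q.proj, q.snd) := by
  have hq : q.proj ∈ (chartAt 𝔼 q.proj).source := mem_chart_source _ _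
  have h : (q.snd.comp (mfderiv 𝓘(ℝ, 𝔼) (𝓡 n) (extChartAt (𝓡 n) q.proj).symm (extChartAt (𝓡 n) q.proj q.proj)) : 𝔼 →L[ℝ] ℝ)  = q.snd := by
    have := mfderivWithin_range_extChartAt_symm (I := 𝓡 n) (x := q.proj)
    rw [range_modelEuclidean, mfderivWithin_univ] at this
    rw [this]
    rfl
  have : (Bundle.Trivialization.continuousLinearMapAt ℝ (trivializationAt ℝ (fun _ : M => ℝ) q.proj)
        q.proj) = ContinuousLinearMap.id ℝ ℝ := 
      Bundle.Trivial.continuousLinearMapAt_trivialization ℝ M _ _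
  have h2 := TangentBundle.symmL_trivializationAt (I := 𝓡 n) hq
  rw [range_modelEuclidean, mfderivWithin_univ] at h2
  rw [FiberBundle.extChartAt]
  change (_, (Bundle.Trivialization.continuousLinearMapAt ℝ (trivializationAt ℝ (fun _ : M => ℝ) q.proj)
        q.proj).comp (q.snd.comp (Bundle.Trivialization.symmL ℝ (trivializationAt 𝔼 (TangentSpace (𝓡 n)) q.proj) q.proj))) = _
  rw [this, h2, h]
  rfl

theorem mdifferentiable_cotangent_proj :
    MDifferentiable (cotangentModel n) (𝓡 n) (fun q : CotangentBundle n M => q.proj) :=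
  (Bundle.contMDiff_proj (n := 1) (IB := 𝓡 n) (fun x : M => TangentSpace (𝓡 n) x →L[ℝ] ℝ)).mdifferentiable (by simp)

theorem cotangent_target_mem_nhds (q : CotangentBundle n M) :
    ∀ᶠ z in 𝓝 (extChartAt (cotangentModel n) q q), z.1 ∈ (extChartAt (𝓡 n) q.proj).target := by
  rw [cotangent_extChartAt_self]
  exact continuous_fst.continuousAt.eventually (p := fun y => y ∈ (extChartAt (𝓡 n) q.proj).target)
    (extChartAt_target_mem_nhds (I := 𝓡 n) q.proj)

/-- Tangent vectors at `q` are read in the chart at `q`, where the projection is the first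
coordinate. -/
theorem projDeriv_apply (q : CotangentBundle n M) (u : 𝔼 × (𝔼 →L[ℝ] ℝ)) :
    projDeriv q u = u.1 := by
  rw [projDeriv, (mdifferentiable_cotangent_proj q).mfderiv]
  have h : (writtenInExtChartAt (cotangentModel n) (𝓡 n) q (fun q : CotangentBundle n M => q.proj)) =ᶠ[𝓝 (extChartAt (cotangentModel n) q q)] Prod.fst := by
    filter_upwards [cotangent_target_mem_nhds q] with z hz
    simp only [writtenInExtChartAt, Function.comp_apply, cotangent_extChartAt_symm q hz]
    exact (extChartAt (𝓡 n) q.proj).right_inv hz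
  rw [ModelWithCorners.range_eq_univ, fderivWithin_univ, h.fderiv_eq, fderiv_fst]
  rfl

/-- Rewriting along an equality of points of the bundle is blocked by the dependence of the tangent
space on the point; substitution is not. -/
theorem liouvilleForm_eq_of_eq {q : CotangentBundle n M} {b : M}
    {α : TangentSpace (𝓡 n) b →L[ℝ] ℝ} (h : q = ⟨b, α⟩) (u : 𝔼 × (𝔼 →L[ℝ] ℝ)) :
    liouvilleForm q u = α (projDeriv q u : 𝔼) := by
  subst h; rfl

/-- In the chart of the cotangent bundle at `q` the Liouville form is `p_j dxʲ`. -/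
theorem liouvilleForm_comp_mfderiv_symm (q : CotangentBundle n M) {z : 𝔼 × (𝔼 →L[ℝ] ℝ)}
    (hz : z.1 ∈ (extChartAt (𝓡 n) q.proj).target) :
    ((liouvilleForm ((extChartAt (cotangentModel n) q).symm z)).comp
      (mfderiv 𝓘(ℝ, 𝔼 × (𝔼 →L[ℝ] ℝ)) (cotangentModel n) (extChartAt (cotangentModel n) q).symm z) :
      𝔼 × (𝔼 →L[ℝ] ℝ) →L[ℝ] ℝ)
      = z.2.comp (ContinuousLinearMap.fst ℝ 𝔼 (𝔼 →L[ℝ] ℝ)) := by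
  have hz' : z ∈ (extChartAt (cotangentModel n) q).target := by
    rw [FiberBundle.extChartAt_target]
    refine ⟨⟨hz, ?_⟩, trivial⟩
    simpa using (extChartAt (𝓡 n) q.proj).map_target hz
  have hd : MDifferentiableAt 𝓘(ℝ, 𝔼 × (𝔼 →L[ℝ] ℝ)) (cotangentModel n)
      (extChartAt (cotangentModel n) q).symm z := by
    have := mdifferentiableWithinAt_extChartAt_symm (I := cotangentModel n) hz'
    rwa [ModelWithCorners.range_eq_univ, mdifferentiableWithinAt_univ] at this
  have hopen : ∀ᶠ w in 𝓝 z, w.1 ∈ (extChartAt (𝓡 n) q.proj).target :=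
    continuous_fst.continuousAt.eventually ((isOpen_extChartAt_target q.proj).mem_nhds hz)
  have hcomp : (fun q : CotangentBundle n M => q.proj) ∘ (extChartAt (cotangentModel n) q).symm
      =ᶠ[𝓝 z] (extChartAt (𝓡 n) q.proj).symm ∘ Prod.fst := by
    filter_upwards [hopen] with w hw
    simp only [Function.comp_apply, cotangent_extChartAt_symm q hw]
  have hfst : MDifferentiableAt 𝓘(ℝ, 𝔼 × (𝔼 →L[ℝ] ℝ)) 𝓘(ℝ, 𝔼) 
      (Prod.fst : 𝔼 × (𝔼 →L[ℝ] ℝ) → 𝔼) z := differentiableAt_fst.mdifferentiableAt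
  -- Differentiating `π ∘ Φ⁻¹ = φ⁻¹ ∘ fst`, for the charts `Φ` of `T*M` and `φ` of `M`, gives `dπ ∘
  -- dΦ⁻¹ = dφ⁻¹ ∘ fst`. The covector with coordinates `p` is `p ∘ dφ`, and `dφ ∘ dφ⁻¹` is the
  -- identity.
  have key := hcomp.mfderiv_eq (I := 𝓘(ℝ, 𝔼 × (𝔼 →L[ℝ] ℝ))) (I' := 𝓡 n)
  rw [mfderiv_comp z (mdifferentiable_cotangent_proj _) hd,
    mfderiv_comp z (mdifferentiableAt_extChartAt_symm hz) hfst, mfderiv_eq_fderiv, fderiv_fst] at key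
  refine ContinuousLinearMap.ext fun u => ?_
  have h1 := DFunLike.congr_fun (mfderiv_extChartAt_comp_symm hz) u.1
  have h2 := DFunLike.congr_fun key u
  simp only [ContinuousLinearMap.comp_apply] at h2 ⊢
  erw [liouvilleForm_eq_of_eq (cotangent_extChartAt_symm q hz), h2]
  exact congrArg z.2 h1

/-- In the chart of the cotangent bundle at `q` the symplectic form is `dp_j ∧ dxʲ`. -/
theorem symplecticForm_apply (q : CotangentBundle n M) (u v : 𝔼 × (𝔼 →L[ℝ] ℝ)) :
    symplecticForm q u v = u.2 v.1 - v.2 u.1 := by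
  have h : (fun z : 𝔼 × (𝔼 →L[ℝ] ℝ) => ((liouvilleForm ((extChartAt (cotangentModel n) q).symm z)).comp
      (mfderiv 𝓘(ℝ, 𝔼 × (𝔼 →L[ℝ] ℝ)) (cotangentModel n) (extChartAt (cotangentModel n) q).symm z) :
      𝔼 × (𝔼 →L[ℝ] ℝ) →L[ℝ] ℝ)) =ᶠ[𝓝 (extChartAt (cotangentModel n) q q)]
      (((ContinuousLinearMap.compL ℝ (𝔼 × (𝔼 →L[ℝ] ℝ)) 𝔼 ℝ).flip
        (ContinuousLinearMap.fst ℝ 𝔼 (𝔼 →L[ℝ] ℝ))).comp (ContinuousLinearMap.snd ℝ 𝔼 (𝔼 →L[ℝ] ℝ))) := by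
    filter_upwards [cotangent_target_mem_nhds q] with z hz
    exact liouvilleForm_comp_mfderiv_symm q hz
  -- Near the centre, the Liouville form in coordinates depends linearly on the point, so its
  -- derivative is that linear map. The derivative of the chart at its own centre is the identity.
  have h' := h.fderiv_eq (𝕜 := ℝ)
  rw [ContinuousLinearMap.fderiv] at h'
  have hA := mfderiv_extChartAt_self (I := cotangentModel n) (x := q)
  have key : ∀ (B : 𝔼 × (𝔼 →L[ℝ] ℝ) →L[ℝ] 𝔼 × (𝔼 →L[ℝ] ℝ) →L[ℝ] ℝ)
      (A : 𝔼 × (𝔼 →L[ℝ] ℝ) →L[ℝ] 𝔼 × (𝔼 →L[ℝ] ℝ)),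
      B = ((ContinuousLinearMap.compL ℝ (𝔼 × (𝔼 →L[ℝ] ℝ)) 𝔼 ℝ).flip
        (ContinuousLinearMap.fst ℝ 𝔼 (𝔼 →L[ℝ] ℝ))).comp (ContinuousLinearMap.snd ℝ 𝔼 (𝔼 →L[ℝ] ℝ)) →
      A = ContinuousLinearMap.id ℝ _ → B (A u) (A v) - B (A v) (A u) = u.2 v.1 - v.2 u.1 := by
    rintro B A rfl rfl
    rfl
  exact key _ _ h' hA

/-! ### Complex tangent vectors and the horizontal part of a Hamiltonian field -/

/-- The `ℂ`-linear extension of a real covector. -/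
def complexify (β : 𝔼 →L[ℝ] ℝ) : ℂ ⊗[ℝ] 𝔼 →ₗ[ℂ] ℂ :=
  LinearMap.liftBaseChange ℂ (Complex.ofRealCLM.toLinearMap ∘ₗ β.toLinearMap)

theorem complexify_tmul (β : 𝔼 →L[ℝ] ℝ) (c : ℂ) (v : 𝔼) : complexify β (c ⊗ₜ v) = c * β v := by
  simp [complexify]

/-- Complexified coordinate functionals are the coordinates for the real basis extended to `ℂ ⊗ 𝔼`.
-/
theorem eq_of_forall_complexify {X Y : ℂ ⊗[ℝ] 𝔼}
    (h : ∀ β : 𝔼 →L[ℝ] ℝ, complexify β X = complexify β Y) : X = Y := by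
  let b := (EuclideanSpace.basisFun (Fin n) ℝ).toBasis
  have hb : ∀ (j : Fin n) (Z : ℂ ⊗[ℝ] 𝔼),
      (b.baseChange ℂ).repr Z j = complexify (EuclideanSpace.proj j) Z := by
    intro j Z
    induction Z using TensorProduct.induction_on with
    | zero => simp
    | tmul c v => simp [complexify_tmul, b, Algebra.smul_def, mul_comm]
    | add u v hu hv => simp [hu, hv]
  refine (b.baseChange ℂ).ext_elem fun j => ?_
  rw [hb, hb, h]

theorem euclidean_eq_sum (v : 𝔼) : v = ∑ j, v j • EuclideanSpace.single j (1 : ℝ) := by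
  ext i
  simp [Pi.single_apply]

theorem covector_eq_sum (p : 𝔼 →L[ℝ] ℝ) :
    p = ∑ j, p (EuclideanSpace.single j 1) • (EuclideanSpace.proj j : 𝔼 →L[ℝ] ℝ) := by
  ext v
  conv_lhs => rw [euclidean_eq_sum v]
  simp [mul_comm]

/-- A vector is determined by the contractions of the canonical symplectic form of `𝔼 × 𝔼*`. -/
theorem complexify_fst_of_symplectic {Ω : 𝔼 × (𝔼 →L[ℝ] ℝ) →ₗ[ℝ] 𝔼 × (𝔼 →L[ℝ] ℝ) →ₗ[ℝ] ℝ}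
    (hΩ : ∀ u v, Ω u v = u.2 v.1 - v.2 u.1) {p : 𝔼 × (𝔼 →L[ℝ] ℝ) →ₗ[ℝ] 𝔼} (hp : ∀ u, p u = u.1)
    (X : ℂ ⊗[ℝ] (𝔼 × (𝔼 →L[ℝ] ℝ))) (β : 𝔼 →L[ℝ] ℝ) :
    complexify β (p.baseChange ℂ X) =
      -LinearMap.liftBaseChange ℂ (Complex.ofRealCLM.toLinearMap ∘ₗ Ω.flip (0, β)) X := by
  induction X using TensorProduct.induction_on with
  | zero => simp
  | tmul c v => simp [complexify_tmul, hp, hΩ]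
  | add u v hu hv => simp only [map_add, hu, hv, neg_add]

/-- Hamilton's equations solve the problem explicitly; this keeps `hamiltonianField` away from its
default value. -/
theorem exists_liftBaseChange_symplectic_add_eq_zero
    {Ω : 𝔼 × (𝔼 →L[ℝ] ℝ) →ₗ[ℝ] 𝔼 × (𝔼 →L[ℝ] ℝ) →ₗ[ℝ] ℝ}
    (hΩ : ∀ u v, Ω u v = u.2 v.1 - v.2 u.1) (L : 𝔼 × (𝔼 →L[ℝ] ℝ) →L[ℝ] ℂ) :
    ∃ X : ℂ ⊗[ℝ] (𝔼 × (𝔼 →L[ℝ] ℝ)), ∀ w,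
      LinearMap.liftBaseChange ℂ (Complex.ofRealCLM.toLinearMap ∘ₗ Ω.flip w) X + L w = 0 := by
  -- The vector `∑ (∂F/∂p_j) ∂/∂xʲ - (∂F/∂xʲ) ∂/∂p_j`, with `L` in the role of `dF`.
  refine ⟨∑ j, (L (0, EuclideanSpace.proj j) ⊗ₜ[ℝ] (EuclideanSpace.single j (1 : ℝ), 0))
    - ∑ j, (L (EuclideanSpace.single j 1, 0) ⊗ₜ[ℝ] (0, EuclideanSpace.proj j)), fun w => ?_⟩
  have hw : w = ∑ j : Fin n, (w.2 (EuclideanSpace.single j 1) •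
      ((0, EuclideanSpace.proj j) : 𝔼 × (𝔼 →L[ℝ] ℝ))
      + w.1 j • ((EuclideanSpace.single j (1 : ℝ), 0) : 𝔼 × (𝔼 →L[ℝ] ℝ))) := by
    refine Prod.ext ?_ ?_
    · simpa [Prod.fst_sum] using euclidean_eq_sum w.1
    · simpa [Prod.snd_sum] using covector_eq_sum w.2
  have hLw : L w = ∑ j : Fin n, ((w.2 (EuclideanSpace.single j 1) : ℂ) *
      L (0, EuclideanSpace.proj j) + (w.1 j : ℂ) * L (EuclideanSpace.single j (1 : ℝ), 0)) := by
    conv_lhs => rw [hw]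
    simp only [map_sum, map_add, map_smul, Complex.real_smul]
  rw [hLw, map_sub, map_sum, map_sum, ← Finset.sum_sub_distrib, ← Finset.sum_add_distrib]
  refine Finset.sum_eq_zero fun j _ => ?_
  simp [hΩ]
  ring

/-- The horizontal part of the Hamiltonian field of `F` is given by the derivative of `F` along
the fibres. -/
theorem projDeriv_hamiltonianField_eq_iff (F : CotangentBundle n M → ℂ) (q : CotangentBundle n M)
    (v : 𝔼) :
    (projDeriv q).toLinearMap.baseChange ℂ (hamiltonianField F q) =
        (1 : ℂ) ⊗ₜ[ℝ] (v : TangentSpace (𝓡 n) q.proj) ↔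
      ∀ β : 𝔼 →L[ℝ] ℝ, cotangentDiff F q ((0, β) : 𝔼 × (𝔼 →L[ℝ] ℝ)) = β v := by
  have hX : ∀ w, contractSymplectic q (hamiltonianField F q) w + cotangentDiff F q w = 0 := by
    have h : ∃ X : ℂ ⊗[ℝ] TangentSpace (cotangentModel n) q,
        ∀ w, contractSymplectic q X w + cotangentDiff F q w = 0 :=
      exists_liftBaseChange_symplectic_add_eq_zero (symplecticForm_apply q) (cotangentDiff F q)
    rw [hamiltonianField, dif_pos h]
    exact h.choose_spec
  -- Contracting the defining equation with the vertical vector `(0, β)` leaves only the horizontal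
  -- part of the field.
  have key : ∀ β : 𝔼 →L[ℝ] ℝ,
      complexify β ((projDeriv q).toLinearMap.baseChange ℂ (hamiltonianField F q)) =
        cotangentDiff F q ((0, β) : 𝔼 × (𝔼 →L[ℝ] ℝ)) := fun β => by
    refine (complexify_fst_of_symplectic (symplecticForm_apply q) (projDeriv_apply q) _ β).trans ?_
    exact neg_eq_of_add_eq_zero_right (hX ((0, β) : 𝔼 × (𝔼 →L[ℝ] ℝ)))
  constructor
  · intro h β
    rw [← key, h]
    exact (complexify_tmul β 1 v).trans (one_mul _)
  · intro h
    refine eq_of_forall_complexify fun β => ?_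
    rw [key, h]
    exact ((complexify_tmul β 1 v).trans (one_mul _)).symm

/-! ### Hamiltonians of tensor fields in coordinates and along the fibres -/

theorem contDiffOn_comp_extChartAt_symm {F : Type*} [NormedAddCommGroup F] [NormedSpace ℝ F]
    {x₀ : M} {h : M → F}
    (hh : ContMDiffOn (𝓡 n) 𝓘(ℝ, F) ∞ h (chartAt 𝔼 x₀).source) :
    ContDiffOn ℝ ∞ (fun y => h ((extChartAt (𝓡 n) x₀).symm y)) (extChartAt (𝓡 n) x₀).target := by
  rw [← contMDiffOn_iff_contDiffOn]
  refine hh.comp (contMDiffOn_extChartAt_symm x₀) fun y hy => ?_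
  simpa using (extChartAt (𝓡 n) x₀).map_target hy

/-- The chart at `q` has identity derivative at `q`, so no Jacobian appears. -/
theorem cotangentDiff_eq_fderiv {F : CotangentBundle n M → ℂ} {q : CotangentBundle n M}
    {G : 𝔼 × (𝔼 →L[ℝ] ℝ) → ℂ}
    (hG : DifferentiableAt ℝ G (extChartAt (cotangentModel n) q q))
    (hFG : (fun z => F ((extChartAt (cotangentModel n) q).symm z))
      =ᶠ[𝓝 (extChartAt (cotangentModel n) q q)] G) :
    (cotangentDiff F q : 𝔼 × (𝔼 →L[ℝ] ℝ) →L[ℝ] ℂ) =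
      fderiv ℝ G (extChartAt (cotangentModel n) q q) := by
  have hF : F =ᶠ[𝓝 q] G ∘ extChartAt (cotangentModel n) q := by
    filter_upwards [(continuousAt_extChartAt (I := cotangentModel n) q).eventually hFG,
      extChartAt_source_mem_nhds (I := cotangentModel n) q] with q' h1 h2
    rw [Function.comp_apply, ← h1, PartialEquiv.left_inv _ h2]
  have h1 := hF.mfderiv_eq (I := cotangentModel n) (I' := 𝓘(ℝ, ℂ))
  rw [mfderiv_comp q hG.mdifferentiableAt
    (mdifferentiableAt_extChartAt (mem_chart_source _ q)), mfderiv_extChartAt_self,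
    mfderiv_eq_fderiv] at h1
  exact h1

theorem comp_mfderiv_extChartAt_eq_sum (p : 𝔼 →L[ℝ] ℝ) (x₀ x : M) :
    (p.comp (mfderiv (𝓡 n) 𝓘(ℝ, 𝔼) (extChartAt (𝓡 n) x₀) x) : TangentSpace (𝓡 n) x →L[ℝ] ℝ) =
      ∑ j, p (EuclideanSpace.single j 1) • coordCovector x₀ j x := by
  refine ContinuousLinearMap.ext fun v => ?_
  have h : ∀ w : 𝔼, p w = ∑ j, p (EuclideanSpace.single j 1) * w j := fun w => by
    conv_lhs => rw [covector_eq_sum p]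
    simp
  rw [_root_.sum_apply]
  exact h _

theorem coordCovector_self (x : M) (j : Fin n) :
    (coordCovector x j x : 𝔼 →L[ℝ] ℝ) = EuclideanSpace.proj j := by
  refine ContinuousLinearMap.ext fun v => ?_
  rw [coordCovector, mfderiv_extChartAt_self]
  rfl

/-- Multilinear expansion of `p_j dxʲ`: the Hamiltonian is a polynomial in `p` whose coefficients
are the components of the tensor, smooth by assumption. -/
theorem SymTensorField.val_comp_mfderiv {r : ℕ} (Φ : SymTensorField n M r) (p : 𝔼 →L[ℝ] ℝ)
    (x₀ x : M) :
    Φ.val x (fun _ => p.comp (mfderiv (𝓡 n) 𝓘(ℝ, 𝔼) (extChartAt (𝓡 n) x₀) x)) =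
      ∑ J : Fin r → Fin n, ((∏ k, p (EuclideanSpace.single (J k) 1) : ℝ) : ℂ) *
        Φ.val x (fun k => coordCovector x₀ (J k) x) := by
  rw [comp_mfderiv_extChartAt_eq_sum, MultilinearMap.map_sum]
  refine Finset.sum_congr rfl fun J _ => ?_
  rw [MultilinearMap.map_smul_univ, Complex.real_smul]

theorem SymTensorField.val_eq_sum {r : ℕ} (Φ : SymTensorField n M r) (p : 𝔼 →L[ℝ] ℝ) (x : M) :
    Φ.val x (fun _ => p) =
      ∑ J : Fin r → Fin n, ((∏ k, p (EuclideanSpace.single (J k) 1) : ℝ) : ℂ) *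
        Φ.val x (fun k => coordCovector x (J k) x) := by
  rw [← Φ.val_comp_mfderiv p x x, mfderiv_extChartAt_self]
  rfl

theorem TensorField.toFun_eq_sum (Φ : TensorField n M) {N : ℕ}
    (hN : ∀ r, N < r → ∀ x, (Φ.comp r).val x = 0) (q : CotangentBundle n M) :
    Φ.toFun q = ∑ r ∈ Finset.range (N + 1), (Φ.comp r).val q.proj (fun _ => q.snd) := by
  refine finsum_eq_sum_of_support_subset _ fun r hr => ?_
  by_contra h
  refine hr ?_
  simp only [Finset.coe_range, Set.mem_Iio, not_lt] at h
  simp [hN r h]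

theorem differentiable_covector_monomial {r : ℕ} (J : Fin r → Fin n) :
    Differentiable ℝ (fun p : 𝔼 →L[ℝ] ℝ =>
      ((∏ k, p (EuclideanSpace.single (J k) 1) : ℝ) : ℂ)) := by
  have h : ContDiff ℝ 1 (fun p : 𝔼 →L[ℝ] ℝ => ∏ k, p (EuclideanSpace.single (J k) 1)) :=
    contDiff_prod fun k _ => by fun_prop
  exact Complex.ofRealCLM.differentiable.comp (h.differentiable (by simp))

/-- The Hamiltonian of a tensor field, in the chart of the cotangent bundle at a point. -/
theorem TensorField.exists_local_expression (Φ : TensorField n M) (q : CotangentBundle n M) :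
    ∃ G : 𝔼 × (𝔼 →L[ℝ] ℝ) → ℂ, DifferentiableAt ℝ G (extChartAt (cotangentModel n) q q) ∧
      ∀ z : 𝔼 × (𝔼 →L[ℝ] ℝ), z.1 ∈ (extChartAt (𝓡 n) q.proj).target →
        Φ.toFun ((extChartAt (cotangentModel n) q).symm z) = G z := by
  obtain ⟨N, hN⟩ := Φ.finite
  refine ⟨fun z => ∑ r ∈ Finset.range (N + 1), ∑ J : Fin r → Fin n,
    ((∏ k, z.2 (EuclideanSpace.single (J k) 1) : ℝ) : ℂ) *
      (Φ.comp r).val ((extChartAt (𝓡 n) q.proj).symm z.1)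
        (fun k => coordCovector q.proj (J k) ((extChartAt (𝓡 n) q.proj).symm z.1)), ?_, ?_⟩
  · rw [cotangent_extChartAt_self]
    obtain ⟨p₀, hp₀⟩ : ∃ p₀ : 𝔼 →L[ℝ] ℝ, p₀ = q.snd := ⟨_, rfl⟩
    rw [← hp₀]
    refine DifferentiableAt.fun_sum fun r _ => DifferentiableAt.fun_sum fun J _ => ?_
    refine DifferentiableAt.mul ?_ ?_
    · have hs : DifferentiableAt ℝ (Prod.snd : 𝔼 × (𝔼 →L[ℝ] ℝ) → _)
        (extChartAt (𝓡 n) q.proj q.proj, p₀) := differentiableAt_snd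
      exact (differentiable_covector_monomial J _).comp _ hs
    · have h := contDiffOn_comp_extChartAt_symm ((Φ.comp r).smooth q.proj J)
      have h' := (h.contDiffAt (extChartAt_target_mem_nhds q.proj)).differentiableAt (by simp)
      have hs : DifferentiableAt ℝ (Prod.fst : 𝔼 × (𝔼 →L[ℝ] ℝ) → _)
        (extChartAt (𝓡 n) q.proj q.proj, p₀) := differentiableAt_fst
      exact DifferentiableAt.comp (extChartAt (𝓡 n) q.proj q.proj, p₀) h' hs
  · intro z hz
    rw [cotangent_extChartAt_symm q hz, Φ.toFun_eq_sum hN]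
    exact Finset.sum_congr rfl fun r _ => (Φ.comp r).val_comp_mfderiv _ _ _

theorem TensorField.differentiable_fiber (Φ : TensorField n M) (x : M) :
    Differentiable ℝ (fun p : 𝔼 →L[ℝ] ℝ => Φ.toFun ⟨x, p⟩) := by
  obtain ⟨N, hN⟩ := Φ.finite
  simp only [Φ.toFun_eq_sum hN, SymTensorField.val_eq_sum]
  refine Differentiable.fun_sum fun r _ => Differentiable.fun_sum fun J _ => ?_
  exact (differentiable_covector_monomial J).mul (differentiable_const _)

/-- A vertical vector moves only `p`, and on the fibre over the centre of the chart the coordinates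
of a covector are the covector itself. Differentiability in all variables is needed, since `mfderiv`
would otherwise be zero by default. -/
theorem TensorField.cotangentDiff_toFun (Φ : TensorField n M) (q : CotangentBundle n M)
    (β : 𝔼 →L[ℝ] ℝ) :
    cotangentDiff Φ.toFun q ((0, β) : 𝔼 × (𝔼 →L[ℝ] ℝ)) =
      fderiv ℝ (fun p : 𝔼 →L[ℝ] ℝ => Φ.toFun ⟨q.proj, p⟩) q.snd β := by
  obtain ⟨G, hG, hFG⟩ := Φ.exists_local_expression q
  rw [cotangentDiff_eq_fderiv hG]
  swap
  · filter_upwards [cotangent_target_mem_nhds q] with z hz using hFG z hz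
  have h1 : (fun p : 𝔼 →L[ℝ] ℝ => Φ.toFun ⟨q.proj, p⟩) =
      fun p => G (extChartAt (𝓡 n) q.proj q.proj, p) := by
    funext p
    have ht := mem_extChartAt_target (I := 𝓡 n) q.proj
    rw [← hFG _ ht, cotangent_extChartAt_symm q ht]
    have hs := PartialEquiv.left_inv _ (mem_extChartAt_source (I := 𝓡 n) q.proj)
    have h2 : ∀ x : M, x = q.proj → (⟨q.proj, p⟩ : CotangentBundle n M) =
        ⟨x, p.comp (mfderiv (𝓡 n) 𝓘(ℝ, 𝔼) (extChartAt (𝓡 n) q.proj) x)⟩ := by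
      rintro x rfl
      rw [mfderiv_extChartAt_self]
      rfl
    rw [← h2 _ hs]
  rw [cotangent_extChartAt_self] at hG ⊢
  have h2 : ∀ p₀ : 𝔼 →L[ℝ] ℝ, DifferentiableAt ℝ G (extChartAt (𝓡 n) q.proj q.proj, p₀) →
      fderiv ℝ G (extChartAt (𝓡 n) q.proj q.proj, p₀) (0, β) =
        fderiv ℝ (fun p => G (extChartAt (𝓡 n) q.proj q.proj, p)) p₀ β := fun p₀ hG =>
    (DFunLike.congr_fun (hG.hasFDerivAt.comp p₀ (hasFDerivAt_prodMk_right _ _)).fderiv β).symm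
  rw [h1]
  exact h2 _ hG

/-! ### The cometric and the Hamiltonians of second order equations -/

/-- The metric at `x`, as a bilinear form on the model space. -/
def metricForm (g : PseudoRiemannianMetric n M) (x : M) : 𝔼 →L[ℝ] 𝔼 →L[ℝ] ℝ := g.val x

/-- The isomorphism `v ↦ g(v, ·)` of the tangent space with the cotangent space. -/
def flat (g : PseudoRiemannianMetric n M) (x : M) : 𝔼 ≃L[ℝ] (𝔼 →L[ℝ] ℝ) :=
  (LinearEquiv.ofInjectiveOfFinrankEq (metricForm g x).toLinearMap
    ((injective_iff_map_eq_zero _).2 fun v hv =>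
      g.nondegenerate x v fun w => DFunLike.congr_fun hv w)
    ((LinearMap.toContinuousLinearMap (𝕜 := ℝ) (E := 𝔼) (F' := ℝ)).finrank_eq.symm.trans
      Subspace.dual_finrank_eq).symm).toContinuousLinearEquiv

/-- The bilinear form `g^{jk} p_j q_k` on the cotangent space. -/
def cometric (g : PseudoRiemannianMetric n M) (x : M) :
    (𝔼 →L[ℝ] ℝ) →L[ℝ] (𝔼 →L[ℝ] ℝ) →L[ℝ] ℝ :=
  (ContinuousLinearMap.apply ℝ ℝ).comp ((flat g x).symm : (𝔼 →L[ℝ] ℝ) →L[ℝ] 𝔼)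

theorem cometric_apply (g : PseudoRiemannianMetric n M) (x : M) (p q : 𝔼 →L[ℝ] ℝ) :
    cometric g x p q = q ((flat g x).symm p) := rfl

theorem cometric_symm (g : PseudoRiemannianMetric n M) (x : M) (p q : 𝔼 →L[ℝ] ℝ) :
    cometric g x p q = cometric g x q p := by
  obtain ⟨v, rfl⟩ := (flat g x).surjective p
  obtain ⟨w, rfl⟩ := (flat g x).surjective q
  simp only [cometric_apply, ContinuousLinearEquiv.symm_apply_apply]
  exact g.symm x w v

/-- The symmetry of the cometric makes the two terms of the product rule equal, which absorbs the
factor `½`. -/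
theorem hasFDerivAt_cometric (g : PseudoRiemannianMetric n M) (x : M) (p : 𝔼 →L[ℝ] ℝ) :
    HasFDerivAt (fun p => ((1 / 2 * cometric g x p p : ℝ) : ℂ))
      (Complex.ofRealCLM.comp (cometric g x p)) p := by
  have h := ((cometric g x).hasFDerivAt_of_bilinear (hasFDerivAt_id p) (hasFDerivAt_id p)).const_mul
    (1 / 2 : ℝ)
  have h' := Complex.ofRealCLM.hasFDerivAt.comp p h
  convert! h' using 1
  ext v
  simp [cometric_symm g x v p]
  ring

/-- A Hamiltonian is that of a second order differential equation if and only if it is the sum of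
the kinetic energy `½ g^{jk} p_j p_k` and of a function on the base. -/
theorem isSecondOrderEquation_hamiltonianField_iff (g : PseudoRiemannianMetric n M)
    (Φ : TensorField n M) :
    IsSecondOrderEquation g (hamiltonianField Φ.toFun) ↔
      ∀ (x : M) (p : 𝔼 →L[ℝ] ℝ),
        Φ.toFun ⟨x, p⟩ = Φ.toFun ⟨x, (0 : 𝔼 →L[ℝ] ℝ)⟩ + ((1 / 2 * cometric g x p p : ℝ) : ℂ) := by
  refine forall_congr' fun x => ?_
  have hF := Φ.differentiable_fiber x
  -- As `v` runs over the tangent space, `g(v, ·)` runs over all covectors `p`, and `v` is recovered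
  -- as `cometric g x p`.
  have h1 : (∀ v : TangentSpace (𝓡 n) x,
      (projDeriv (⟨x, g.val x v⟩ : CotangentBundle n M)).toLinearMap.baseChange ℂ
        (hamiltonianField Φ.toFun ⟨x, g.val x v⟩) = (1 : ℂ) ⊗ₜ[ℝ] v) ↔
      ∀ p : 𝔼 →L[ℝ] ℝ, fderiv ℝ (fun p : 𝔼 →L[ℝ] ℝ => Φ.toFun ⟨x, p⟩) p =
        Complex.ofRealCLM.comp (cometric g x p) := by
    constructor
    · intro h p
      obtain ⟨v, rfl⟩ := (flat g x).surjective p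
      ext β
      have h2 := (projDeriv_hamiltonianField_eq_iff _ _ _).1 (h v) β
      rw [Φ.cotangentDiff_toFun] at h2
      refine Eq.trans h2 ?_
      simp [cometric_apply]
    · intro h v
      refine (projDeriv_hamiltonianField_eq_iff _ _ _).2 fun β => ?_
      rw [Φ.cotangentDiff_toFun]
      have h2 := DFunLike.congr_fun (h (flat g x v)) β
      refine Eq.trans h2 (congrArg Complex.ofReal ?_)
      exact congrArg β ((flat g x).symm_apply_apply v)
  refine h1.trans ⟨fun h p => ?_, fun h p => ?_⟩
  -- The Hamiltonian minus the kinetic energy has zero derivative on the fibre, hence is constant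
  -- there; its value is read at `p = 0`.
  · have h3 : ∀ p : 𝔼 →L[ℝ] ℝ, HasFDerivAt (fun p : 𝔼 →L[ℝ] ℝ => Φ.toFun ⟨x, p⟩ -
        ((1 / 2 * cometric g x p p : ℝ) : ℂ)) (0 : (𝔼 →L[ℝ] ℝ) →L[ℝ] ℂ) p := fun p => by
      have := (hF p).hasFDerivAt.sub (hasFDerivAt_cometric g x p)
      rwa [h p, sub_self] at this
    have h4 := is_const_of_fderiv_eq_zero (𝕜 := ℝ) (fun p => (h3 p).differentiableAt)
      (fun p => (h3 p).fderiv) p 0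
    simp only [map_zero, mul_zero, Complex.ofReal_zero, sub_zero] at h4
    rw [← h4]
    ring
  · have h3 : (fun p : 𝔼 →L[ℝ] ℝ => Φ.toFun ⟨x, p⟩) =
      fun p => Φ.toFun ⟨x, (0 : 𝔼 →L[ℝ] ℝ)⟩ + ((1 / 2 * cometric g x p p : ℝ) : ℂ) := funext h
    rw [h3]
    exact ((hasFDerivAt_cometric g x p).const_add _).fderiv

/-! ### Polarization -/

/-- If `J` misses `i`, adding or removing `i` does not affect the condition on `s` but reverses the
sign, so the terms cancel in pairs. -/
theorem sum_neg_one_pow_card_of_not_surjective {r : ℕ} {W : Type*} [AddCommGroup W]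
    {J : Fin r → Fin r} (hJ : ¬ Function.Surjective J) (w : W) :
    ∑ s : Finset (Fin r), (-1 : ℤ) ^ s.card • (if ∀ k, J k ∈ s then w else 0) = 0 := by
  simp only [Function.Surjective, not_forall, not_exists] at hJ
  obtain ⟨i, hi⟩ := hJ
  refine Finset.sum_involution (fun s _ => if i ∈ s then s.erase i else insert i s) ?_ ?_ ?_ ?_
  · intro s _
    by_cases h : i ∈ s
    · have h1 : (∀ k, J k ∈ s.erase i) ↔ ∀ k, J k ∈ s := by simp [hi]
      have h2 : s.card = (s.erase i).card + 1 := (Finset.card_erase_add_one h).symm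
      simp only [h, if_true, h1]
      rw [h2, pow_succ]
      split_ifs <;> simp
    · have h1 : (∀ k, J k ∈ insert i s) ↔ ∀ k, J k ∈ s := by simp [hi]
      simp only [h, if_false, h1, Finset.card_insert_of_notMem h, pow_succ]
      split_ifs <;> simp
  · intro s _ _
    by_cases h : i ∈ s
    · simp only [h, if_true]
      exact fun h' => (Finset.notMem_erase i s) (h'.symm ▸ h)
    · simp only [h, if_false]
      exact fun h' => h (h' ▸ Finset.mem_insert_self i s)
  · intro s _
    exact Finset.mem_univ _
  · intro s _
    by_cases h : i ∈ s
    · simp [h]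
    · simp [h]

/-- The polarization formula for a symmetric multilinear map. -/
theorem polarization {R V W : Type*} [CommRing R] [AddCommGroup V] [Module R V] [AddCommGroup W]
    [Module R W] {r : ℕ} (φ : MultilinearMap R (fun _ : Fin r => V) W)
    (hφ : ∀ (σ : Equiv.Perm (Fin r)) (v : Fin r → V), φ (fun k => v (σ k)) = φ v)
    (v : Fin r → V) :
    ∑ s : Finset (Fin r), (-1 : ℤ) ^ s.card • φ (fun _ => ∑ i ∈ s, v i) =
      (-1 : ℤ) ^ r • (r.factorial • φ v) := by
  have h1 : ∀ s : Finset (Fin r), φ (fun _ => ∑ i ∈ s, v i) =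
      ∑ J : Fin r → Fin r, if ∀ k, J k ∈ s then φ (fun k => v (J k)) else 0 := fun s => by
    rw [MultilinearMap.map_sum_finset, ← Finset.sum_filter]
    refine Finset.sum_congr ?_ fun _ _ => rfl
    ext J
    simp
  simp only [h1, Finset.smul_sum]
  rw [Finset.sum_comm]
  -- Only surjective `J`, that is permutations, survive; for these only `s = univ` contributes, with
  -- value `φ v` by symmetry. There are `r!` of them.
  have h2 : ∀ J : Fin r → Fin r, ∑ s : Finset (Fin r),
      (-1 : ℤ) ^ s.card • (if ∀ k, J k ∈ s then φ (fun k => v (J k)) else 0) =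
        if Function.Bijective J then (-1 : ℤ) ^ r • φ v else 0 := fun J => by
    by_cases hJ : Function.Surjective J
    · have hb : Function.Bijective J := Finite.surjective_iff_bijective.1 hJ
      rw [if_pos hb, Finset.sum_eq_single Finset.univ]
      · simp only [Finset.mem_univ, implies_true, if_true, Finset.card_univ, Fintype.card_fin]
        rw [← hφ (Equiv.ofBijective J hb) v]
        rfl
      · intro s _ hs
        rw [if_neg, smul_zero]
        exact fun h => hs (Finset.eq_univ_iff_forall.2 fun i => by
          obtain ⟨k, rfl⟩ := hJ i
          exact h k)
      · simp
    · rw [sum_neg_one_pow_card_of_not_surjective hJ, if_neg fun hb => hJ hb.2]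
  simp only [h2]
  rw [← Finset.sum_filter, Finset.sum_const, smul_comm]
  congr 2
  rw [← Fintype.card_subtype, Fintype.card_congr (Equiv.ofBijective
    (fun σ : Equiv.Perm (Fin r) => (⟨σ, σ.bijective⟩ : {J : Fin r → Fin r // Function.Bijective J}))
    ⟨fun σ τ h => Equiv.ext fun i => congrFun (Subtype.ext_iff.1 h) i,
      fun J => ⟨Equiv.ofBijective J.1 J.2, rfl⟩⟩).symm, Fintype.card_perm, Fintype.card_fin]

theorem multilinearMap_eq_zero_of_diagonal {V W : Type*} [AddCommGroup V] [Module ℝ V]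
    [AddCommGroup W] [Module ℝ W] {r : ℕ} (φ : MultilinearMap ℝ (fun _ : Fin r => V) W)
    (hφ : ∀ (σ : Equiv.Perm (Fin r)) (v : Fin r → V), φ (fun k => v (σ k)) = φ v)
    (h : ∀ v, φ (fun _ => v) = 0) : φ = 0 := by
  ext v
  have := polarization φ hφ v
  simp only [h, smul_zero, Finset.sum_const_zero] at this
  have h2 : (r.factorial : ℝ) • φ v = 0 := by
    rw [Nat.cast_smul_eq_nsmul]
    rcases neg_one_pow_eq_or ℤ r with hr | hr <;> simpa [hr, eq_comm] using this
  exact (smul_eq_zero.1 h2).resolve_left (by positivity)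

/-- A complex polynomial vanishing on the real line has infinitely many roots. -/
theorem eq_zero_of_sum_pow_mul_eq_zero {N : ℕ} {a : ℕ → ℂ}
    (h : ∀ t : ℝ, ∑ r ∈ Finset.range (N + 1), (t : ℂ) ^ r * a r = 0) {r : ℕ} (hr : r ≤ N) :
    a r = 0 := by
  let p : Polynomial ℂ := ∑ r ∈ Finset.range (N + 1), Polynomial.monomial r (a r)
  have hp : p = 0 := by
    refine Polynomial.eq_zero_of_infinite_isRoot p ?_
    refine (Set.infinite_range_of_injective Complex.ofReal_injective).mono ?_
    rintro _ ⟨t, rfl⟩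
    change p.eval (t : ℂ) = 0
    rw [← h t, Polynomial.eval_finsetSum]
    refine Finset.sum_congr rfl fun i _ => ?_
    rw [Polynomial.eval_monomial, mul_comm]
  have h1 : p.coeff r = a r := by
    simp only [p, Polynomial.finsetSum_coeff, Polynomial.coeff_monomial]
    rw [Finset.sum_ite_eq']
    simp [Nat.lt_succ_of_le hr]
  rw [← h1, hp, Polynomial.coeff_zero]

/-! ### The metric in local coordinates -/

theorem metricMatrix_symm (g : PseudoRiemannianMetric n M) (x₀ : M) (y : 𝔼) (i j : Fin n) :
    metricMatrix g x₀ y i j = metricMatrix g x₀ y j i :=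
  g.symm _ _ _

theorem christoffel_symm (g : PseudoRiemannianMetric n M) (x₀ : M) (l j k : Fin n) (y : 𝔼) :
    christoffel g x₀ l j k y = christoffel g x₀ l k j y := by
  simp only [christoffel, metricMatrix_symm g x₀ _ j k]
  congr 1
  refine Finset.sum_congr rfl fun m _ => ?_
  ring

/-- The coordinate vector `∂/∂xʲ`, as a vector of the model space. -/
def frame (x₀ : M) (j : Fin n) (y : 𝔼) : 𝔼 := coordVector x₀ j y

/-- The coordinate covector `dxʲ`, as a covector of the model space. -/
def coframe (x₀ : M) (j : Fin n) (x : M) : 𝔼 →L[ℝ] ℝ := coordCovector x₀ j x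

theorem coframe_frame {x₀ : M} {y : 𝔼} (hy : y ∈ (extChartAt (𝓡 n) x₀).target)
    (i j : Fin n) :
    coframe x₀ i ((extChartAt (𝓡 n) x₀).symm y) (frame x₀ j y) = if i = j then 1 else 0 := by
  have h := DFunLike.congr_fun (mfderiv_extChartAt_comp_symm hy) (EuclideanSpace.single j 1)
  have h' := congrArg (fun v : 𝔼 => v i) h
  refine Eq.trans h' ?_
  change (EuclideanSpace.single j (1 : ℝ) : 𝔼) i = _
  simp

theorem sum_coframe_smul_frame {x₀ : M} {y : 𝔼} (hy : y ∈ (extChartAt (𝓡 n) x₀).target)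
    (v : 𝔼) :
    ∑ j, coframe x₀ j ((extChartAt (𝓡 n) x₀).symm y) v • frame x₀ j y = v := by
  have h := mfderiv_symm_comp_extChartAt ((extChartAt (𝓡 n) x₀).map_target hy)
  rw [(extChartAt (𝓡 n) x₀).right_inv hy] at h
  have h' := DFunLike.congr_fun h v
  refine Eq.trans ?_ h'
  have key : ∀ (L : 𝔼 →L[ℝ] 𝔼) (w : 𝔼), ∑ j, w j • L (EuclideanSpace.single j 1) = L w := by
    intro L w
    conv_rhs => rw [euclidean_eq_sum w, map_sum]
    simp only [map_smul]
  exact key _ _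

/-- The matrix of the cometric is the inverse of the matrix of the metric. -/
theorem metricMatrix_mul_cometric (g : PseudoRiemannianMetric n M) {x₀ : M} {y : 𝔼}
    (hy : y ∈ (extChartAt (𝓡 n) x₀).target) :
    metricMatrix g x₀ y * Matrix.of (fun j k => cometric g ((extChartAt (𝓡 n) x₀).symm y)
      (coframe x₀ j ((extChartAt (𝓡 n) x₀).symm y))
      (coframe x₀ k ((extChartAt (𝓡 n) x₀).symm y))) = 1 := by
  set x := (extChartAt (𝓡 n) x₀).symm y with hx
  -- Lowering the index of `∂/∂xⁱ` gives `g_{ij} dxʲ`; pairing with `dxᵏ` through the cometric then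
  -- gives `g_{ij} g^{jk} = δᵢᵏ`.
  have h1 : ∀ i, flat g x (frame x₀ i y) =
      ∑ j, metricMatrix g x₀ y i j • coframe x₀ j x := by
    intro i
    refine ContinuousLinearMap.ext fun v => ?_
    have hv := sum_coframe_smul_frame hy v
    conv_lhs => rw [← hv, map_sum]
    rw [_root_.sum_apply]
    refine Finset.sum_congr rfl fun j _ => ?_
    rw [map_smul, smul_eq_mul, mul_comm]
    rfl
  ext i k
  rw [Matrix.mul_apply]
  have h3 : cometric g x (flat g x (frame x₀ i y)) (coframe x₀ k x) = if k = i then 1 else 0 := by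
    rw [cometric_apply, ContinuousLinearEquiv.symm_apply_apply]
    exact coframe_frame hy k i
  rw [h1 i, map_sum, _root_.sum_apply] at h3
  simp only [map_smul] at h3
  rw [Matrix.one_apply]
  simp only [eq_comm (a := i)]
  exact h3

theorem cometric_coframe (g : PseudoRiemannianMetric n M) {x₀ : M} {y : 𝔼}
    (hy : y ∈ (extChartAt (𝓡 n) x₀).target) (j k : Fin n) :
    cometric g ((extChartAt (𝓡 n) x₀).symm y) (coframe x₀ j ((extChartAt (𝓡 n) x₀).symm y))
      (coframe x₀ k ((extChartAt (𝓡 n) x₀).symm y)) = (metricMatrix g x₀ y)⁻¹ j k := by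
  rw [Matrix.inv_eq_right_inv (metricMatrix_mul_cometric g hy)]
  rfl

theorem isUnit_det_metricMatrix (g : PseudoRiemannianMetric n M) {x₀ : M} {y : 𝔼}
    (hy : y ∈ (extChartAt (𝓡 n) x₀).target) : IsUnit (metricMatrix g x₀ y).det :=
  (Matrix.isUnit_iff_isUnit_det _).1 (IsUnit.of_mul_eq_one _ (metricMatrix_mul_cometric g hy))

/-- The coordinate frame is the inverse trivialization applied to constant vectors. In this form its
smoothness, and then that of `g_{ij}`, follows from the bundle structure. -/
theorem contMDiffOn_coordVector (x₀ : M) (i : Fin n) :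
    ContMDiffOn (𝓡 n) (𝓡 n).tangent ∞
      (fun x => (⟨x, (trivializationAt 𝔼 (TangentSpace (𝓡 n)) x₀).symmL ℝ x
        (EuclideanSpace.single i 1)⟩ : TangentBundle (𝓡 n) M))
      (chartAt 𝔼 x₀).source := by
  have h := (trivializationAt 𝔼 (TangentSpace (𝓡 n) (M := M)) x₀).contMDiffOn_symm (IB := 𝓡 n) (n := ∞)
  have h2 : ContMDiff (𝓡 n) ((𝓡 n).prod 𝓘(ℝ, 𝔼)) ∞
      (fun x : M => (x, (EuclideanSpace.single i 1 : 𝔼))) := contMDiff_id.prodMk contMDiff_const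
  refine (h.comp h2.contMDiffOn (s := (chartAt 𝔼 x₀).source) ?_).congr ?_
  · intro x hx
    simpa [Bundle.Trivialization.target_eq] using hx
  · intro x hx
    have hb : x ∈ (trivializationAt 𝔼 (TangentSpace (𝓡 n)) x₀).baseSet := by simpa using hx
    simp only [Function.comp_apply]
    rw [Bundle.Trivialization.symmL_apply _ hb]
    exact ((trivializationAt 𝔼 (TangentSpace (𝓡 n) (M := M)) x₀).mk_symm hb _)

theorem contMDiffOn_metric_coord (g : PseudoRiemannianMetric n M) (x₀ : M) (i j : Fin n) :
    ContMDiffOn (𝓡 n) 𝓘(ℝ, ℝ) ∞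
      (fun x => g.val x ((trivializationAt 𝔼 (TangentSpace (𝓡 n)) x₀).symmL ℝ x
        (EuclideanSpace.single i 1)) ((trivializationAt 𝔼 (TangentSpace (𝓡 n)) x₀).symmL ℝ x
        (EuclideanSpace.single j 1)))
      (chartAt 𝔼 x₀).source := by
  intro x hx
  have : ContMDiffWithinAt (𝓡 n) ((𝓡 n).prod 𝓘(ℝ)) ∞
      (fun m ↦ Bundle.TotalSpace.mk' ℝ (E := Bundle.Trivial M ℝ) m
      (g.val m ((trivializationAt 𝔼 (TangentSpace (𝓡 n)) x₀).symmL ℝ m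
        (EuclideanSpace.single i 1)) ((trivializationAt 𝔼 (TangentSpace (𝓡 n)) x₀).symmL ℝ m
        (EuclideanSpace.single j 1)))) (chartAt 𝔼 x₀).source x := by
    apply ContMDiffWithinAt.clm_bundle_apply₂ (F₁ := 𝔼) (F₂ := 𝔼)
    · exact (g.contMDiff x).contMDiffWithinAt
    · exact contMDiffOn_coordVector x₀ i x hx
    · exact contMDiffOn_coordVector x₀ j x hx
  simp only [Bundle.contMDiffWithinAt_totalSpace] at this
  exact this.2

theorem contDiffOn_metricMatrix (g : PseudoRiemannianMetric n M) (x₀ : M) (i j : Fin n) :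
    ContDiffOn ℝ ∞ (fun y => metricMatrix g x₀ y i j) (extChartAt (𝓡 n) x₀).target := by
  refine (contDiffOn_comp_extChartAt_symm (contMDiffOn_metric_coord g x₀ i j)).congr ?_
  intro y hy
  have hx : (extChartAt (𝓡 n) x₀).symm y ∈ (chartAt 𝔼 x₀).source := by
    simpa using (extChartAt (𝓡 n) x₀).map_target hy
  rw [TangentBundle.symmL_trivializationAt hx, (extChartAt (𝓡 n) x₀).right_inv hy,
    range_modelEuclidean, mfderivWithin_univ]
  rfl

theorem contDiffOn_matrix_det {E : Type*} [NormedAddCommGroup E] [NormedSpace ℝ E] {s : Set E}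
    {m : ℕ} {A : E → Matrix (Fin m) (Fin m) ℝ}
    (hA : ∀ i j, ContDiffOn ℝ ∞ (fun y => A y i j) s) :
    ContDiffOn ℝ ∞ (fun y => (A y).det) s := by
  simp only [Matrix.det_apply]
  exact ContDiffOn.sum fun σ _ => (contDiffOn_prod fun i _ => hA _ _).const_smul _

/-- Cramer's rule: the entries are polynomials in the matrix divided by the determinant. -/
theorem contDiffOn_matrix_inv {E : Type*} [NormedAddCommGroup E] [NormedSpace ℝ E] {s : Set E}
    {m : ℕ} {A : E → Matrix (Fin m) (Fin m) ℝ}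
    (hA : ∀ i j, ContDiffOn ℝ ∞ (fun y => A y i j) s) (hu : ∀ y ∈ s, IsUnit (A y).det)
    (i j : Fin m) :
    ContDiffOn ℝ ∞ (fun y => (A y)⁻¹ i j) s := by
  have h1 : ContDiffOn ℝ ∞ (fun y => ((A y).det)⁻¹ * (A y).adjugate i j) s := by
    refine ((contDiffOn_matrix_det hA).inv fun y hy => (hu y hy).ne_zero).mul ?_
    simp only [Matrix.adjugate_apply]
    refine contDiffOn_matrix_det fun k l => ?_
    by_cases hk : k = j
    · subst hk
      simpa using contDiffOn_const
    · simpa [Matrix.updateRow_ne hk] using hA k l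
  refine h1.congr fun y _ => ?_
  rw [Matrix.inv_def, Ring.inverse_eq_inv', Matrix.smul_apply, smul_eq_mul]

theorem contDiffOn_metricMatrix_inv (g : PseudoRiemannianMetric n M) (x₀ : M) (i j : Fin n) :
    ContDiffOn ℝ ∞ (fun y => (metricMatrix g x₀ y)⁻¹ i j) (extChartAt (𝓡 n) x₀).target :=
  contDiffOn_matrix_inv (contDiffOn_metricMatrix g x₀) (fun _ hy => isUnit_det_metricMatrix g hy) i j

theorem contDiffOn_partialDeriv {F : Type*} [NormedAddCommGroup F] [NormedSpace ℝ F] {s : Set 𝔼}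
    (hs : IsOpen s) {h : 𝔼 → F} (hh : ContDiffOn ℝ ∞ h s) (j : Fin n) :
    ContDiffOn ℝ ∞ (partialDeriv j h) s :=
  (hh.fderiv_of_isOpen hs (by simp)).clm_apply contDiffOn_const

theorem partialDeriv_congr {F : Type*} [NormedAddCommGroup F] [NormedSpace ℝ F] {s : Set 𝔼}
    (hs : IsOpen s) {h h' : 𝔼 → F} (hh : Set.EqOn h h' s) (j : Fin n) :
    Set.EqOn (partialDeriv j h) (partialDeriv j h') s := fun y hy => by
  rw [partialDeriv, partialDeriv,
    (hh.eventuallyEq_of_mem (hs.mem_nhds hy)).fderiv_eq]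

theorem contDiffOn_christoffel (g : PseudoRiemannianMetric n M) (x₀ : M) (l j k : Fin n) :
    ContDiffOn ℝ ∞ (christoffel g x₀ l j k) (extChartAt (𝓡 n) x₀).target := by
  have ho := isOpen_extChartAt_target (I := 𝓡 n) x₀
  refine contDiffOn_const.mul (ContDiffOn.sum fun m _ => ?_)
  refine (contDiffOn_metricMatrix_inv g x₀ l m).mul ?_
  exact ((contDiffOn_partialDeriv ho (contDiffOn_metricMatrix g x₀ m k) j).add
    (contDiffOn_partialDeriv ho (contDiffOn_metricMatrix g x₀ m j) k)).sub
    (contDiffOn_partialDeriv ho (contDiffOn_metricMatrix g x₀ j k) m)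

theorem contDiffOn_christoffel_complex (g : PseudoRiemannianMetric n M) (x₀ : M) (l j k : Fin n) :
    ContDiffOn ℝ ∞ (fun y => (christoffel g x₀ l j k y : ℂ)) (extChartAt (𝓡 n) x₀).target :=
  Complex.ofRealCLM.contDiff.comp_contDiffOn (contDiffOn_christoffel g x₀ l j k)

theorem contDiffOn_covDiff (g : PseudoRiemannianMetric n M) (f : SmoothFun n M) (x₀ : M) (r : ℕ)
    (J : Fin r → Fin n) :
    ContDiffOn ℝ ∞ (covDiff g f x₀ r J) (extChartAt (𝓡 n) x₀).target := by
  induction r with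
  | zero => exact contDiffOn_comp_extChartAt_symm f.contMDiff.contMDiffOn
  | succ r ih =>
    refine (contDiffOn_partialDeriv (isOpen_extChartAt_target x₀) (ih _) _).sub ?_
    exact ContDiffOn.sum fun i _ => ContDiffOn.sum fun l _ =>
      (contDiffOn_christoffel_complex g x₀ _ _ _).mul (ih _)

/-! ### Iterated covariant differentials of powers -/

theorem partialDeriv_add {s : Set 𝔼} (hs : IsOpen s) {a b : 𝔼 → ℂ} (ha : ContDiffOn ℝ ∞ a s)
    (hb : ContDiffOn ℝ ∞ b s) (j : Fin n) {z : 𝔼} (hz : z ∈ s) :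
    partialDeriv j (fun y => a y + b y) z = partialDeriv j a z + partialDeriv j b z := by
  have ha' := ((ha.contDiffAt (hs.mem_nhds hz)).differentiableAt (by simp))
  have hb' := ((hb.contDiffAt (hs.mem_nhds hz)).differentiableAt (by simp))
  simp only [partialDeriv]
  rw [fderiv_fun_add ha' hb']
  rfl

theorem partialDeriv_mul {𝔸 : Type*} [NormedCommRing 𝔸] [NormedAlgebra ℝ 𝔸] {s : Set 𝔼}
    (hs : IsOpen s) {a b : 𝔼 → 𝔸} (ha : ContDiffOn ℝ ∞ a s) (hb : ContDiffOn ℝ ∞ b s) (j : Fin n) {z : 𝔼} (hz : z ∈ s) :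
    partialDeriv j (fun y => a y * b y) z = partialDeriv j a z * b z + a z * partialDeriv j b z := by
  have ha' := ((ha.contDiffAt (hs.mem_nhds hz)).differentiableAt (by simp))
  have hb' := ((hb.contDiffAt (hs.mem_nhds hz)).differentiableAt (by simp))
  simp only [partialDeriv]
  rw [fderiv_fun_mul ha' hb']
  simp only [_root_.add_apply, _root_.smul_apply, smul_eq_mul]
  ring

theorem partialDeriv_const_mul {s : Set 𝔼} (hs : IsOpen s) {a : 𝔼 → ℂ} (ha : ContDiffOn ℝ ∞ a s)
    (c : ℂ) (j : Fin n) {z : 𝔼} (hz : z ∈ s) :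
    partialDeriv j (fun y => c * a y) z = c * partialDeriv j a z := by
  rw [partialDeriv_mul hs contDiffOn_const ha j hz]
  simp [partialDeriv]

theorem partialDeriv_pow {s : Set 𝔼} (hs : IsOpen s) {a : 𝔼 → ℂ} (ha : ContDiffOn ℝ ∞ a s)
    (m : ℕ) (j : Fin n) {z : 𝔼} (hz : z ∈ s) :
    partialDeriv j (fun y => a y ^ (m + 1)) z = (m + 1) * a z ^ m * partialDeriv j a z := by
  have ha' := ((ha.contDiffAt (hs.mem_nhds hz)).differentiableAt (by simp))
  simp only [partialDeriv]
  rw [fderiv_fun_pow _ ha']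
  simp

/-- The expression of a function in the chart at `x₀`. -/
def coordExpr (h : SmoothFun n M) (x₀ : M) (y : 𝔼) : ℂ := h ((extChartAt (𝓡 n) x₀).symm y)

theorem contDiffOn_coordExpr (h : SmoothFun n M) (x₀ : M) :
    ContDiffOn ℝ ∞ (coordExpr h x₀) (extChartAt (𝓡 n) x₀).target :=
  contDiffOn_comp_extChartAt_symm h.contMDiff.contMDiffOn

/-- Each differentiation lowers the power of the function by at most one, and lowers it only by
hitting that power. Derivatives of the other factors and the Christoffel terms keep the higher
power, so they go into the remainder. -/
theorem covDiff_pow (g : PseudoRiemannianMetric n M) (h : SmoothFun n M) (x₀ : M) (N : ℕ) (r : ℕ)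
    (hr : r ≤ N) (J : Fin r → Fin n) :
    ∃ R : 𝔼 → ℂ, ContDiffOn ℝ ∞ R (extChartAt (𝓡 n) x₀).target ∧
      ∀ z ∈ (extChartAt (𝓡 n) x₀).target, covDiff g (h ^ N) x₀ r J z =
        (N.descFactorial r : ℂ) * (coordExpr h x₀ z ^ (N - r) *
          ∏ k, partialDeriv (J k) (coordExpr h x₀) z) +
        coordExpr h x₀ z ^ (N - r + 1) * R z := by
  have hT := isOpen_extChartAt_target (I := 𝓡 n) x₀
  have hu := contDiffOn_coordExpr h x₀
  induction r with
  | zero =>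
    refine ⟨0, contDiffOn_const, fun z _ => ?_⟩
    simp [covDiff, coordExpr]
  | succ r ih =>
    obtain ⟨m, hm⟩ : ∃ m, N - r = m + 1 := ⟨N - r - 1, by omega⟩
    have hm' : N - (r + 1) = m := by omega
    choose R hR hcov using ih (by omega)
    have hQ : ∀ J : Fin r → Fin n, ContDiffOn ℝ ∞
        (fun z => ∏ k, partialDeriv (J k) (coordExpr h x₀) z) (extChartAt (𝓡 n) x₀).target :=
      fun J => contDiffOn_prod fun k _ => contDiffOn_partialDeriv hT hu _
    rw [hm] at hcov
    set u := coordExpr h x₀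
    set c : ℂ := (N.descFactorial r : ℂ)
    set Q : (Fin r → Fin n) → 𝔼 → ℂ := fun J z => ∏ k, partialDeriv (J k) u z
    -- With `m + 1 = N - r`, these are the terms still divisible by `u ^ (m + 1)`: the derivative of
    -- the old product, the derivative of `u ^ (m + 2) * R`, and the Christoffel terms. The factor
    -- `(m + 1) + 1` is the exponent `m + 2`.
    refine ⟨fun z => c * partialDeriv (J 0) (Q (Fin.tail J)) z +
      ((m + 1 : ℕ) + 1) * (partialDeriv (J 0) u z * R (Fin.tail J) z) +
      u z * partialDeriv (J 0) (R (Fin.tail J)) z -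
      ∑ i : Fin r, ∑ l : Fin n, (christoffel g x₀ l (J 0) (Fin.tail J i) z : ℂ) *
        (c * Q (Function.update (Fin.tail J) i l) z +
          u z * R (Function.update (Fin.tail J) i l) z), ?_, fun z hz => ?_⟩
    · refine ContDiffOn.sub (((contDiffOn_const.mul (contDiffOn_partialDeriv hT (hQ _) _)).add
        (contDiffOn_const.mul ((contDiffOn_partialDeriv hT hu _).mul (hR _)))).add
        (hu.mul (contDiffOn_partialDeriv hT (hR _) _))) ?_
      exact ContDiffOn.sum fun i _ => ContDiffOn.sum fun l _ =>
        (contDiffOn_christoffel_complex g x₀ _ _ _).mul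
          ((contDiffOn_const.mul (hQ _)).add (hu.mul (hR _)))
    · rw [covDiff, partialDeriv_congr hT (hcov (Fin.tail J)) (J 0) hz,
        partialDeriv_add hT (contDiffOn_const.mul ((hu.pow _).mul (hQ _)))
          ((hu.pow _).mul (hR _)) _ hz,
        partialDeriv_const_mul hT ((hu.pow _).mul (hQ _)) _ _ hz,
        partialDeriv_mul hT (hu.pow _) (hQ _) _ hz, partialDeriv_mul hT (hu.pow _) (hR _) _ hz,
        partialDeriv_pow hT hu _ _ hz, partialDeriv_pow hT hu _ _ hz]
      have hsum : ∑ i : Fin r, ∑ l : Fin n, (christoffel g x₀ l (J 0) (Fin.tail J i) z : ℂ) *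
            covDiff g (h ^ N) x₀ r (Function.update (Fin.tail J) i l) z =
          u z ^ (m + 1) * ∑ i : Fin r, ∑ l : Fin n,
            (christoffel g x₀ l (J 0) (Fin.tail J i) z : ℂ) *
            (c * Q (Function.update (Fin.tail J) i l) z +
              u z * R (Function.update (Fin.tail J) i l) z) := by
        simp only [Finset.mul_sum]
        refine Finset.sum_congr rfl fun i _ => Finset.sum_congr rfl fun l _ => ?_
        rw [hcov _ z hz]
        ring
      rw [hsum, hm', Nat.descFactorial_succ, hm, Fin.prod_univ_succ]
      have hQ' : ∏ i : Fin r, partialDeriv (J i.succ) u z = Q (Fin.tail J) z := rfl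
      rw [hQ']
      push_cast
      ring

theorem covDiff_pow_of_lt (g : PseudoRiemannianMetric n M) {h : SmoothFun n M} {x : M}
    (hx : h x = 0) {N r : ℕ} (hr : r < N) (J : Fin r → Fin n) :
    covDiff g (h ^ N) x r J (extChartAt (𝓡 n) x x) = 0 := by
  obtain ⟨R, -, hR⟩ := covDiff_pow g h x N r hr.le J
  have hx' : coordExpr h x (extChartAt (𝓡 n) x x) = 0 := by simp [coordExpr, hx]
  rw [hR _ (mem_extChartAt_target x), hx', zero_pow (by omega), zero_pow (by omega)]
  simp

theorem covDiff_pow_self (g : PseudoRiemannianMetric n M) {h : SmoothFun n M} {x : M}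
    (hx : h x = 0) (N : ℕ) (J : Fin N → Fin n) :
    covDiff g (h ^ N) x N J (extChartAt (𝓡 n) x x) =
      N.factorial * ∏ k, partialDeriv (J k) (coordExpr h x) (extChartAt (𝓡 n) x x) := by
  obtain ⟨R, -, hR⟩ := covDiff_pow g h x N N le_rfl J
  have hx' : coordExpr h x (extChartAt (𝓡 n) x x) = 0 := by simp [coordExpr, hx]
  rw [hR _ (mem_extChartAt_target x), hx']
  simp [Nat.descFactorial_self]

theorem SymTensorField.quantized_pow_of_lt (g : PseudoRiemannianMetric n M) (ħ : ℝ) {r N : ℕ}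
    (Φ : SymTensorField n M r) {h : SmoothFun n M} {x : M} (hx : h x = 0) (hr : r < N) :
    Φ.quantized g ħ (h ^ N) x = 0 := by
  simp only [SymTensorField.quantized, symCovDiff, covDiff_pow_of_lt g hx hr]
  simp

/-- Up to a constant this is the value of the tensor on copies of `dh`. The leading covariant
differential is already symmetric, so symmetrizing adds `N!` equal terms. -/
theorem SymTensorField.quantized_pow_self (g : PseudoRiemannianMetric n M) (ħ : ℝ) {N : ℕ}
    (Φ : SymTensorField n M N) {h : SmoothFun n M} {x : M} (hx : h x = 0) :
    Φ.quantized g ħ (h ^ N) x = (-Complex.I * ħ) ^ N * (N.factorial *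
      ∑ J : Fin N → Fin n, (∏ k, partialDeriv (J k) (coordExpr h x) (extChartAt (𝓡 n) x x)) *
        Φ.val x (fun k => coordCovector x (J k) x)) := by
  rw [SymTensorField.quantized]
  congr 1
  rw [Finset.mul_sum]
  refine Finset.sum_congr rfl fun J _ => ?_
  have h1 : ∀ σ : Equiv.Perm (Fin N),
      ∏ k, partialDeriv ((J ∘ σ) k) (coordExpr h x) (extChartAt (𝓡 n) x x) =
      ∏ k, partialDeriv (J k) (coordExpr h x) (extChartAt (𝓡 n) x x) := fun σ =>
    Equiv.prod_comp σ (fun k => partialDeriv (J k) (coordExpr h x) (extChartAt (𝓡 n) x x))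
  have h2 : (N.factorial : ℂ) ≠ 0 := by exact_mod_cast N.factorial_ne_zero
  simp only [symCovDiff, covDiff_pow_self g hx, h1, Finset.sum_const, Finset.card_univ,
    Fintype.card_perm, Fintype.card_fin, nsmul_eq_mul]
  field_simp

theorem SymTensorField.quantized_congr (g : PseudoRiemannianMetric n M) (ħ : ℝ) {r : ℕ}
    {Φ Ψ : SymTensorField n M r} {x : M} (h : Φ.val x = Ψ.val x) (f : SmoothFun n M) :
    Φ.quantized g ħ f x = Ψ.quantized g ħ f x := by
  simp [SymTensorField.quantized, h]

theorem TensorField.quantized_eq_sum (g : PseudoRiemannianMetric n M) (ħ : ℝ) (Φ : TensorField n M)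
    {N : ℕ} (hN : ∀ r, N < r → ∀ x, (Φ.comp r).val x = 0) (f : SmoothFun n M) (x : M) :
    Φ.quantized g ħ f x = ∑ r ∈ Finset.range (N + 1), (Φ.comp r).quantized g ħ f x := by
  refine finsum_eq_sum_of_support_subset _ fun r hr => ?_
  by_contra h
  refine hr ?_
  simp only [Finset.coe_range, Set.mem_Iio, not_lt] at h
  simp [SymTensorField.quantized, hN r h]

/-! ### Smooth functions with given germs and the injectivity of quantization -/

/-- Every smooth function of the coordinates at `x` is the germ of a smooth function. -/
theorem exists_smoothFun_eventuallyEq [T2Space M] (x : M) {u : 𝔼 → ℂ} (hu : ContDiff ℝ ∞ u) :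
    ∃ h : SmoothFun n M, (fun x' => h x') =ᶠ[𝓝 x] fun x' => u (extChartAt (𝓡 n) x x') := by
  let b : SmoothBumpFunction (𝓡 n) x := Classical.choice inferInstance
  refine ⟨⟨fun x' => b x' • u (extChartAt (𝓡 n) x x'), b.contMDiff_smul ?_⟩, ?_⟩
  · exact hu.contMDiff.comp_contMDiffOn contMDiffOn_extChartAt
  · filter_upwards [b.eventuallyEq_one] with x' hx'
    change b x' • u (extChartAt (𝓡 n) x x') = _
    rw [hx']
    simp

theorem coordExpr_eventuallyEq {h : SmoothFun n M} {x : M} {u : 𝔼 → ℂ}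
    (hu : (fun x' => h x') =ᶠ[𝓝 x] fun x' => u (extChartAt (𝓡 n) x x')) :
    coordExpr h x =ᶠ[𝓝 (extChartAt (𝓡 n) x x)] u := by
  have h0 : Filter.Tendsto (extChartAt (𝓡 n) x).symm (𝓝 (extChartAt (𝓡 n) x x)) (𝓝 x) := by
    have := continuousAt_extChartAt_symm (I := 𝓡 n) x
    rwa [ContinuousAt, extChartAt_to_inv] at this
  have h1 := h0.eventually hu
  filter_upwards [h1, extChartAt_target_mem_nhds (I := 𝓡 n) x] with y hy hy'
  rw [coordExpr, hy, PartialEquiv.right_inv _ hy']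

/-- Every covector at `x` is the differential of a smooth function vanishing at `x`. -/
theorem exists_smoothFun_partialDeriv [T2Space M] (x : M) (p : 𝔼 →L[ℝ] ℝ) :
    ∃ h : SmoothFun n M, h x = 0 ∧
      ∀ j, partialDeriv j (coordExpr h x) (extChartAt (𝓡 n) x x) = p (EuclideanSpace.single j 1) := by
  let u : 𝔼 → ℂ := fun y => ((p y - p (extChartAt (𝓡 n) x x) : ℝ) : ℂ)
  have hu : ContDiff ℝ ∞ u :=
    Complex.ofRealCLM.contDiff.comp (p.contDiff.sub contDiff_const)
  obtain ⟨h, hh⟩ := exists_smoothFun_eventuallyEq x hu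
  refine ⟨h, ?_, fun j => ?_⟩
  · have := hh.self_of_nhds
    simpa [u] using this
  · rw [partialDeriv, (coordExpr_eventuallyEq hh).fderiv_eq]
    have h1 : HasFDerivAt u (Complex.ofRealCLM.comp p) (extChartAt (𝓡 n) x x) :=
      Complex.ofRealCLM.hasFDerivAt.comp _ (p.hasFDerivAt.sub_const _)
    rw [h1.fderiv]
    rfl

/-- A tensor field is determined by the operator that it quantizes to. -/
theorem TensorField.val_eq_of_quantized_eq [T2Space M] (g : PseudoRiemannianMetric n M) {ħ : ℝ}
    (hħ : ħ ≠ 0) {Φ Ψ : TensorField n M}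
    (h : ∀ f x, Φ.quantized g ħ f x = Ψ.quantized g ħ f x) (r : ℕ) (x : M) :
    (Φ.comp r).val x = (Ψ.comp r).val x := by
  obtain ⟨N₁, hN₁⟩ := Φ.finite
  obtain ⟨N₂, hN₂⟩ := Ψ.finite
  obtain ⟨N, h₁, h₂⟩ : ∃ N, N₁ ≤ N ∧ N₂ ≤ N := ⟨max N₁ N₂, le_max_left _ _, le_max_right _ _⟩
  replace hN₁ : ∀ r, N < r → ∀ x, (Φ.comp r).val x = 0 := fun r hr => hN₁ r (by omega)
  replace hN₂ : ∀ r, N < r → ∀ x, (Ψ.comp r).val x = 0 := fun r hr => hN₂ r (by omega)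
  -- Descending induction on the degree, written as induction on `k` with `r > N - k`.
  suffices H : ∀ k r, N < r + k → (Φ.comp r).val x = (Ψ.comp r).val x from H (N + 1) r (by omega)
  intro k
  induction k with
  | zero => exact fun r hr => by rw [hN₁ r (by omega), hN₂ r (by omega)]
  | succ k ih =>
    intro r hr
    by_cases hrN : N < r
    · rw [hN₁ r hrN, hN₂ r hrN]
    refine sub_eq_zero.1 (multilinearMap_eq_zero_of_diagonal _ (fun σ v => ?_) fun p => ?_)
    · rw [_root_.sub_apply, _root_.sub_apply, (Φ.comp r).symm, (Ψ.comp r).symm]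
    -- Test on `f ^ r` with `f x = 0` and `df = p`: components below degree `r` give zero, those
    -- above agree by induction, and degree `r` sees the value at `(p, …, p)`.
    obtain ⟨f, hfx, hf⟩ := exists_smoothFun_partialDeriv x p
    have h1 := h (f ^ r) x
    rw [Φ.quantized_eq_sum g ħ hN₁, Ψ.quantized_eq_sum g ħ hN₂] at h1
    have hmem : r ∈ Finset.range (N + 1) := Finset.mem_range.2 (by omega)
    rw [← Finset.add_sum_erase _ _ hmem, ← Finset.add_sum_erase _ _ hmem,
      Finset.sum_congr rfl (g := fun s => (Ψ.comp s).quantized g ħ (f ^ r) x), add_left_inj] at h1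
    · have hc : (-Complex.I * ħ) ^ r ≠ 0 := pow_ne_zero _ (by simp [hħ])
      have hr! : (r.factorial : ℂ) ≠ 0 := by exact_mod_cast r.factorial_ne_zero
      rw [SymTensorField.quantized_pow_self g ħ _ hfx, SymTensorField.quantized_pow_self g ħ _ hfx,
        mul_right_inj' hc, mul_right_inj' hr!] at h1
      simp only [hf] at h1
      rw [_root_.sub_apply, sub_eq_zero]
      have h3 := (Φ.comp r).val_eq_sum p x
      have h4 := (Ψ.comp r).val_eq_sum p x
      push_cast at h3 h4
      exact h3.trans (h1.trans h4.symm)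
    · intro s hs
      rcases lt_or_gt_of_ne (Finset.ne_of_mem_erase hs) with hsr | hsr
      · rw [SymTensorField.quantized_pow_of_lt g ħ _ hfx hsr,
          SymTensorField.quantized_pow_of_lt g ħ _ hfx hsr]
      · exact SymTensorField.quantized_congr g ħ (ih s (by omega)) _

/-! ### The tensor field of the energy -/

/-- A function, as a tensor field of order zero. -/
def scalarField (U : SmoothFun n M) : SymTensorField n M 0 where
  val x := MultilinearMap.constOfIsEmpty ℝ _ (U x)
  symm _ _ _ := rfl
  smooth _ _ := U.contMDiff.contMDiffOn

/-- The potential of a tensor field: its component of order zero. -/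
def SymTensorField.toSmoothFun (Φ : SymTensorField n M 0) : SmoothFun n M :=
  ⟨fun x => Φ.val x Fin.elim0, fun x => by
    have h := (Φ.smooth x Fin.elim0).contMDiffAt (chart_source_mem_nhds 𝔼 x)
    refine h.congr_of_eventuallyEq (Filter.Eventually.of_forall fun x' => ?_)
    exact congrArg (Φ.val x') (Subsingleton.elim _ _)⟩

/-- The symmetric bilinear form `½ g^{jk} p_j q_k` on the cotangent space, with complex values. -/
def kineticForm (g : PseudoRiemannianMetric n M) (x : M) :
    MultilinearMap ℝ (fun _ : Fin 2 => 𝔼 →L[ℝ] ℝ) ℂ where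
  toFun α := ((1 / 2 * cometric g x (α 0) (α 1) : ℝ) : ℂ)
  map_update_add' := by
    intro _ α i p q
    fin_cases i <;> simp [mul_add]
  map_update_smul' := by
    intro _ α i c p
    fin_cases i <;> simp <;> ring

theorem kineticForm_symm (g : PseudoRiemannianMetric n M) (x : M) (σ : Equiv.Perm (Fin 2))
    (α : Fin 2 → 𝔼 →L[ℝ] ℝ) : kineticForm g x (fun k => α (σ k)) = kineticForm g x α := by
  have h : ∀ σ : Equiv.Perm (Fin 2), (σ 0 = 0 ∧ σ 1 = 1) ∨ (σ 0 = 1 ∧ σ 1 = 0) := by decide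
  rcases h σ with ⟨h0, h1⟩ | ⟨h0, h1⟩
  · simp [kineticForm, h0, h1]
  · simp [kineticForm, h0, h1, cometric_symm g x (α 1) (α 0)]

/-- The tensor field `½ g^{jk}` of the kinetic energy. -/
def kineticField (g : PseudoRiemannianMetric n M) : SymTensorField n M 2 where
  val x := kineticForm g x
  symm x σ α := kineticForm_symm g x σ α
  smooth x₀ J := by
    have h1 : ContMDiffOn (𝓡 n) 𝓘(ℝ, ℂ) ∞ (fun x => ((1 / 2 *
        (metricMatrix g x₀ (extChartAt (𝓡 n) x₀ x))⁻¹ (J 0) (J 1) : ℝ) : ℂ))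
        (chartAt 𝔼 x₀).source := by
      have h2 : ContDiffOn ℝ ∞ (fun y => ((1 / 2 * (metricMatrix g x₀ y)⁻¹ (J 0) (J 1) : ℝ) : ℂ))
          (extChartAt (𝓡 n) x₀).target :=
        Complex.ofRealCLM.contDiff.comp_contDiffOn
          (contDiffOn_const.mul (contDiffOn_metricMatrix_inv g x₀ _ _))
      refine h2.contMDiffOn.comp contMDiffOn_extChartAt fun x hx => ?_
      exact (extChartAt (𝓡 n) x₀).map_source (by simpa using hx)
    refine h1.congr fun x hx => ?_
    have hx' : x ∈ (extChartAt (𝓡 n) x₀).source := by simpa using hx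
    have h3 := cometric_coframe g ((extChartAt (𝓡 n) x₀).map_source hx') (J 0) (J 1)
    rw [(extChartAt (𝓡 n) x₀).left_inv hx'] at h3
    rw [← h3]
    rfl

/-- The tensor field `½ g^{jk} + U` of the energy with potential `U`. -/
def energyField (g : PseudoRiemannianMetric n M) (U : SmoothFun n M) : TensorField n M where
  comp
    | 0 => scalarField U
    | 2 => kineticField g
    | r => zeroTensorField.comp r
  finite := ⟨2, fun r hr x => by
    match r, hr with
    | r + 3, _ => rfl⟩

theorem energyField_comp_of_ne (g : PseudoRiemannianMetric n M) (U : SmoothFun n M) {r : ℕ}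
    (h0 : r ≠ 0) (h2 : r ≠ 2) (x : M) : ((energyField g U).comp r).val x = 0 := by
  match r with
  | 1 => rfl
  | r + 3 => rfl

theorem scalarField_quantized (g : PseudoRiemannianMetric n M) (ħ : ℝ) (U f : SmoothFun n M)
    (x : M) : (scalarField U).quantized g ħ f x = U x * f x := by
  simp [SymTensorField.quantized, symCovDiff, covDiff, scalarField]

theorem covDiff_one (g : PseudoRiemannianMetric n M) (f : SmoothFun n M) (x₀ : M)
    (J : Fin 1 → Fin n) :
    covDiff g f x₀ 1 J = partialDeriv (J 0) (fun z => f ((extChartAt (𝓡 n) x₀).symm z)) := by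
  funext y
  simp only [covDiff, Finset.univ_eq_empty, Finset.sum_empty, sub_zero]

theorem covDiff_two (g : PseudoRiemannianMetric n M) (f : SmoothFun n M) (x₀ : M) (j k : Fin n)
    (y : 𝔼) :
    covDiff g f x₀ 2 ![j, k] y =
      partialDeriv j (partialDeriv k (fun z => f ((extChartAt (𝓡 n) x₀).symm z))) y -
        ∑ l, (christoffel g x₀ l j k y : ℂ) *
          partialDeriv l (fun z => f ((extChartAt (𝓡 n) x₀).symm z)) y := by
  rw [covDiff, covDiff_one]
  simp [covDiff_one, Fin.tail]

/-- The constant is `½ (-iħ)²`, and `½ g^{jk}` contracted with the Hessian gives `½ Δ`. Symmetrizing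
the Hessian changes nothing, because it is contracted with a symmetric tensor. -/
theorem kineticField_quantized (g : PseudoRiemannianMetric n M) (ħ : ℝ) (f : SmoothFun n M)
    (x : M) : (kineticField g).quantized g ħ f x = -((ħ : ℂ) ^ 2 / 2) * laplacian g f x := by
  set y := extChartAt (𝓡 n) x x with hy
  set G := (metricMatrix g x y)⁻¹
  have hval : ∀ J : Fin 2 → Fin n, (kineticField g).val x (fun k => coordCovector x (J k) x) =
      1 / 2 * (G (J 0) (J 1) : ℂ) := fun J => by
    have h3 := cometric_coframe g (mem_extChartAt_target (I := 𝓡 n) x) (J 0) (J 1)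
    rw [extChartAt_to_inv] at h3
    change ((1 / 2 * cometric g x (coframe x (J 0) x) (coframe x (J 1) x) : ℝ) : ℂ) = _
    rw [h3]
    push_cast
    rfl
  have hG : ∀ j k, G j k = G k j := fun j k => by
    have h3 := cometric_coframe g (mem_extChartAt_target (I := 𝓡 n) x) j k
    rw [cometric_symm, cometric_coframe g (mem_extChartAt_target (I := 𝓡 n) x) k j] at h3
    exact h3.symm
  set T : Fin n → Fin n → ℂ := fun j k => covDiff g f x 2 ![j, k] y with hT
  -- `laplacian` and `covDiff` take the two derivatives in opposite orders. Transposing the indices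
  -- reconciles them, so commutation of partial derivatives is not needed.
  have hT' : ∀ j k, T k j = partialDeriv k (partialDeriv j
      (fun z => f ((extChartAt (𝓡 n) x).symm z))) y - ∑ l, (christoffel g x l j k y : ℂ) *
      partialDeriv l (fun z => f ((extChartAt (𝓡 n) x).symm z)) y := fun j k => by
    simp only [hT, covDiff_two, christoffel_symm g x _ k j]
  have hsym : ∀ J : Fin 2 → Fin n, symCovDiff g f 2 x J = 1 / 2 * (T (J 0) (J 1) + T (J 1) (J 0)) := by
    intro J
    have hu : (Finset.univ : Finset (Equiv.Perm (Fin 2))) = {1, Equiv.swap 0 1} := by decide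
    have h1 : J ∘ (1 : Equiv.Perm (Fin 2)) = ![J 0, J 1] := by
      ext k; fin_cases k <;> rfl
    have h2 : J ∘ (Equiv.swap 0 1 : Equiv.Perm (Fin 2)) = ![J 1, J 0] := by
      ext k; fin_cases k <;> rfl
    rw [symCovDiff, hu, Finset.sum_pair (by decide), h1, h2]
    norm_num [hT, hy]
  have hlap : laplacian g f x = ∑ j, ∑ k, (G j k : ℂ) * T k j := by
    simp only [hT']
    rfl
  rw [SymTensorField.quantized, hlap]
  simp only [hval, hsym]
  rw [← (finTwoArrowEquiv (Fin n)).symm.sum_comp, Fintype.sum_prod_type]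
  simp only [finTwoArrowEquiv_symm_apply, Matrix.cons_val_zero, Matrix.cons_val_one]
  have hswap : ∑ j, ∑ k, (G j k : ℂ) * T j k = ∑ j, ∑ k, (G j k : ℂ) * T k j := by
    rw [Finset.sum_comm]
    exact Finset.sum_congr rfl fun j _ => Finset.sum_congr rfl fun k _ => by rw [hG]
  have hexp : ∑ j, ∑ k, 1 / 2 * (G j k : ℂ) * (1 / 2 * (T j k + T k j)) =
      1 / 4 * (∑ j, ∑ k, (G j k : ℂ) * T j k) + 1 / 4 * ∑ j, ∑ k, (G j k : ℂ) * T k j := by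
    simp only [Finset.mul_sum, ← Finset.sum_add_distrib]
    exact Finset.sum_congr rfl fun j _ => Finset.sum_congr rfl fun k _ => by ring
  rw [hexp, hswap, mul_pow, neg_sq, Complex.I_sq]
  ring

theorem TensorField.quantized_congr (g : PseudoRiemannianMetric n M) (ħ : ℝ) {Φ Ψ : TensorField n M}
    (h : ∀ r x, (Φ.comp r).val x = (Ψ.comp r).val x) (f : SmoothFun n M) (x : M) :
    Φ.quantized g ħ f x = Ψ.quantized g ħ f x :=
  finsum_congr fun r => SymTensorField.quantized_congr g ħ (h r x) f

theorem TensorField.toFun_congr {Φ Ψ : TensorField n M}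
    (h : ∀ r x, (Φ.comp r).val x = (Ψ.comp r).val x) (q : CotangentBundle n M) :
    Φ.toFun q = Ψ.toFun q :=
  finsum_congr fun r => by rw [h]

theorem energyField_quantized (g : PseudoRiemannianMetric n M) (ħ : ℝ) (U f : SmoothFun n M)
    (x : M) : (energyField g U).quantized g ħ f x =
      -((ħ : ℂ) ^ 2 / 2) * laplacian g f x + U x * f x := by
  rw [TensorField.quantized_eq_sum g ħ _ (N := 2) (fun r hr x =>
    energyField_comp_of_ne g U (by omega) (by omega) x)]
  have h0 : ((energyField g U).comp 0).quantized g ħ f x = U x * f x :=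
    scalarField_quantized g ħ U f x
  have h1 : ((energyField g U).comp 1).quantized g ħ f x = 0 := by
    simp [SymTensorField.quantized, energyField_comp_of_ne g U (r := 1)]
  have h2 : ((energyField g U).comp 2).quantized g ħ f x = _ := kineticField_quantized g ħ f x
  rw [Finset.sum_range_succ, Finset.sum_range_succ, Finset.sum_range_one, h0, h1, h2]
  ring

theorem energyField_toFun (g : PseudoRiemannianMetric n M) (U : SmoothFun n M) (x : M)
    (p : 𝔼 →L[ℝ] ℝ) :
    (energyField g U).toFun ⟨x, p⟩ = U x + ((1 / 2 * cometric g x p p : ℝ) : ℂ) := by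
  rw [TensorField.toFun_eq_sum _ (N := 2) (fun r hr x =>
    energyField_comp_of_ne g U (by omega) (by omega) x)]
  have h1 := energyField_comp_of_ne g U (r := 1) (by omega) (by omega) x
  rw [Finset.sum_range_succ, Finset.sum_range_succ, Finset.sum_range_one]
  simp only [h1]
  change U x + 0 + ((1 / 2 * cometric g x p p : ℝ) : ℂ) = _
  rw [add_zero]

/-- A tensor field whose Hamiltonian is the energy is the tensor field of the energy. -/
theorem TensorField.val_eq_energyField (g : PseudoRiemannianMetric n M) {Φ : TensorField n M}
    (h : ∀ (x : M) (p : 𝔼 →L[ℝ] ℝ),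
      Φ.toFun ⟨x, p⟩ = Φ.toFun ⟨x, (0 : 𝔼 →L[ℝ] ℝ)⟩ + ((1 / 2 * cometric g x p p : ℝ) : ℂ))
    (r : ℕ) (x : M) :
    (Φ.comp r).val x = ((energyField g (Φ.comp 0).toSmoothFun).comp r).val x := by
  obtain ⟨N₀, hN₀⟩ := Φ.finite
  -- A common bound for the degrees of both fields that also includes the given `r`.
  set N := max N₀ (max r 2)
  set Ψ := energyField g (Φ.comp 0).toSmoothFun with hΨdef
  have hN : ∀ r, N < r → ∀ x, (Φ.comp r).val x = 0 := fun r hr => hN₀ r (by omega)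
  have hΨ : ∀ r, N < r → ∀ x, (Ψ.comp r).val x = 0 := fun r hr x =>
    energyField_comp_of_ne g _ (by omega) (by omega) x
  have h00 : Φ.toFun ⟨x, (0 : 𝔼 →L[ℝ] ℝ)⟩ = (Φ.comp 0).toSmoothFun x := by
    rw [Φ.toFun_eq_sum hN, Finset.sum_eq_single 0]
    · exact congrArg ((Φ.comp 0).val x) (Subsingleton.elim _ _)
    · intro s _ hs
      have : Nonempty (Fin s) := ⟨⟨0, by omega⟩⟩
      exact ((Φ.comp s).val x).map_zero
    · simp
  have hF : ∀ p : 𝔼 →L[ℝ] ℝ, Φ.toFun ⟨x, p⟩ = Ψ.toFun ⟨x, p⟩ := fun p => by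
    rw [h, h00, energyField_toFun]
  refine sub_eq_zero.1 (multilinearMap_eq_zero_of_diagonal _ (fun σ v => ?_) fun p => ?_)
  · rw [_root_.sub_apply, _root_.sub_apply, (Φ.comp r).symm, (Ψ.comp r).symm]
  -- Replacing `p` by `t • p` multiplies degree `s` by `t ^ s`, so the equality of the two
  -- Hamiltonians separates into degrees.
  · refine eq_zero_of_sum_pow_mul_eq_zero (N := N)
      (a := fun r => ((Φ.comp r).val x - (Ψ.comp r).val x) (fun _ => p)) (fun t => ?_) (by omega)
    have h1 := hF (t • p)
    rw [Φ.toFun_eq_sum hN, Ψ.toFun_eq_sum hΨ, ← sub_eq_zero, ← Finset.sum_sub_distrib] at h1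
    rw [← h1]
    refine Finset.sum_congr rfl fun s _ => ?_
    have h2 : ∀ (φ : MultilinearMap ℝ (fun _ : Fin s => 𝔼 →L[ℝ] ℝ) ℂ)
        (p : 𝔼 →L[ℝ] ℝ), φ (fun _ => t • p) = (t : ℂ) ^ s * φ (fun _ => p) := fun φ p => by
      rw [φ.map_smul_univ (fun _ => t) (fun _ => p)]
      simp
    have h3 := h2 ((Φ.comp s).val x) p
    have h4 := h2 ((Ψ.comp s).val x) p
    rw [_root_.sub_apply, mul_sub]
    exact (congrArg₂ (· - ·) h3 h4).symm

/-! ### The equivalence for operators that have a dequantized -/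

/-- The infinitesimal canonical transformation of an operator that has a dequantized is a second
order differential equation if and only if the operator is a Schrödinger operator. -/
theorem isSecondOrderEquation_associatedField_iff [T2Space M] (g : PseudoRiemannianMetric n M)
    {ħ : ℝ} (hħ : ħ ≠ 0) {P : SmoothFun n M → SmoothFun n M}
    (hP : ∃ Φ : TensorField n M, ∀ f x, P f x = Φ.quantized g ħ f x) :
    IsSecondOrderEquation g (associatedField g ħ P) ↔
      ∃ U : SmoothFun n M, ∀ (f : SmoothFun n M) (x : M),
        P f x = -((ħ : ℂ) ^ 2 / 2) * laplacian g f x + U x * f x := by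
  have hΦ : ∀ f x, P f x = (dequantized g ħ P).quantized g ħ f x := by
    rw [dequantized, dif_pos hP]
    exact hP.choose_spec
  refine (isSecondOrderEquation_hamiltonianField_iff g (dequantized g ħ P)).trans ⟨fun h => ?_, ?_⟩
  · refine ⟨((dequantized g ħ P).comp 0).toSmoothFun, fun f x => ?_⟩
    rw [hΦ, TensorField.quantized_congr g ħ (TensorField.val_eq_energyField g h),
      energyField_quantized]
  -- By injectivity, the chosen dequantized must be the energy field.
  · rintro ⟨U, hU⟩ x p
    have h := TensorField.val_eq_of_quantized_eq g hħ (Φ := dequantized g ħ P)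
      (Ψ := energyField g U) fun f x => by rw [← hΦ, hU, energyField_quantized]
    rw [TensorField.toFun_congr h, TensorField.toFun_congr h, energyField_toFun,
      energyField_toFun]
    simp

/-! ### Hadamard's lemma -/

/-- Differentiation under the integral sign; the dominating constant is a bound for the derivative
on a closed ball times `[0, 1]`, which is compact. -/
theorem hasFDerivAt_integral_of_contDiff {F : 𝔼 × ℝ → ℂ} (hF : ContDiff ℝ ∞ F) (z₀ : 𝔼) :
    HasFDerivAt (fun z => ∫ t in (0 : ℝ)..1, F (z, t))
      (∫ t in (0 : ℝ)..1, (fderiv ℝ F (z₀, t)).comp (ContinuousLinearMap.inl ℝ 𝔼 ℝ)) z₀ := by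
  have hF' : Continuous fun q : 𝔼 × ℝ => (fderiv ℝ F q).comp (ContinuousLinearMap.inl ℝ 𝔼 ℝ) :=
    (hF.continuous_fderiv (by simp)).clm_comp continuous_const
  have hK : IsCompact (Metric.closedBall z₀ 1 ×ˢ Set.Icc (0 : ℝ) 1) :=
    (isCompact_closedBall z₀ 1).prod isCompact_Icc
  obtain ⟨C, hC⟩ := hK.exists_bound_of_continuousOn hF'.continuousOn
  refine intervalIntegral.hasFDerivAt_integral_of_dominated_of_fderiv_le
    (F := fun z t => F (z, t))
    (F' := fun z t => (fderiv ℝ F (z, t)).comp (ContinuousLinearMap.inl ℝ 𝔼 ℝ))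
    (bound := fun _ => C) (Metric.closedBall_mem_nhds z₀ one_pos) ?_ ?_ ?_ ?_ ?_ ?_
  · refine Filter.Eventually.of_forall fun z => ?_
    exact (hF.continuous.comp (by fun_prop : Continuous fun t : ℝ => (z, t))).aestronglyMeasurable
  · exact (hF.continuous.comp (by fun_prop : Continuous fun t : ℝ => (z₀, t))).intervalIntegrable _ _
  · exact (hF'.comp (by fun_prop : Continuous fun t : ℝ => (z₀, t))).aestronglyMeasurable
  · refine Filter.Eventually.of_forall fun t ht z hz => hC (z, t) ⟨hz, ?_⟩
    rw [Set.uIoc_of_le zero_le_one] at ht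
    exact Set.Ioc_subset_Icc_self ht
  · exact intervalIntegrable_const
  · refine Filter.Eventually.of_forall fun t _ z _ => ?_
    have h1 : HasFDerivAt F (fderiv ℝ F (z, t)) (z, t) :=
      (hF.differentiable (by simp) (z, t)).hasFDerivAt
    exact h1.comp z (hasFDerivAt_prodMk_left z t)

/-- Every directional derivative is again an integral of the same kind, so induction on the
differentiability class applies to all integrands at once. -/
theorem contDiff_integral_of_contDiff {F : 𝔼 × ℝ → ℂ} (hF : ContDiff ℝ ∞ F) :
    ContDiff ℝ ∞ (fun z => ∫ t in (0 : ℝ)..1, F (z, t)) := by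
  refine contDiff_infty.2 fun k => ?_
  induction k generalizing F with
  | zero =>
    refine contDiff_zero.2 (continuous_iff_continuousAt.2 fun z => ?_)
    exact (hasFDerivAt_integral_of_contDiff hF z).continuousAt
  | succ k ih =>
    refine (contDiff_succ_iff_fderiv_apply (n := (k : WithTop ℕ∞))).2 ⟨fun z =>
      (hasFDerivAt_integral_of_contDiff hF z).differentiableAt, by simp, fun v => ?_⟩
    have h1 : ContDiff ℝ ∞ (fun q : 𝔼 × ℝ => fderiv ℝ F q (v, 0)) :=
      (hF.fderiv_right (by simp)).clm_apply contDiff_const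
    have h2 : (fun z => fderiv ℝ (fun z => ∫ t in (0 : ℝ)..1, F (z, t)) z v) =
        fun z => ∫ t in (0 : ℝ)..1, fderiv ℝ F (z, t) (v, 0) := funext fun z => ?_
    · rw [h2]
      exact ih h1
    rw [(hasFDerivAt_integral_of_contDiff hF z).fderiv, ContinuousLinearMap.intervalIntegral_apply]
    · simp
    · refine Continuous.intervalIntegrable ?_ _ _
      exact ((hF.continuous_fderiv (by simp)).comp
        (by fun_prop : Continuous fun t : ℝ => (z, t))).clm_comp continuous_const

/-- Hadamard's lemma: a smooth function that vanishes at `y₀` is a combination of the coordinates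
at `y₀`, the coefficients at `y₀` being the partial derivatives. -/
theorem hadamard_lemma {u : 𝔼 → ℂ} (hu : ContDiff ℝ ∞ u) (y₀ : 𝔼) (h0 : u y₀ = 0) :
    ∃ w : Fin n → 𝔼 → ℂ, (∀ j, ContDiff ℝ ∞ (w j)) ∧ (∀ j, w j y₀ = partialDeriv j u y₀) ∧
      ∀ z, u z = ∑ j, ((z j - y₀ j : ℝ) : ℂ) * w j z := by
  have hw : ∀ j : Fin n, ContDiff ℝ ∞ (fun q : 𝔼 × ℝ => partialDeriv j u (y₀ + q.2 • (q.1 - y₀))) := by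
    intro j
    have h1 : ContDiff ℝ ∞ (fderiv ℝ u) := hu.fderiv_right (by simp)
    have h2 : ContDiff ℝ ∞ fun q : 𝔼 × ℝ => y₀ + q.2 • (q.1 - y₀) := by fun_prop
    exact (h1.comp h2).clm_apply contDiff_const
  -- The coefficients come from integrating `d/dt u(y₀ + t (z - y₀))` over `[0, 1]`.
  refine ⟨fun j z => ∫ t in (0 : ℝ)..1, partialDeriv j u (y₀ + t • (z - y₀)),
    fun j => contDiff_integral_of_contDiff (hw j), fun j => by simp, fun z => ?_⟩
  have hd : ∀ t ∈ Set.uIcc (0 : ℝ) 1, HasDerivAt (fun t : ℝ => u (y₀ + t • (z - y₀)))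
      (∑ j, ((z j - y₀ j : ℝ) : ℂ) * partialDeriv j u (y₀ + t • (z - y₀))) t := by
    intro t _
    have h1 : HasDerivAt (fun t : ℝ => y₀ + t • (z - y₀)) (z - y₀) t := by
      simpa using ((hasDerivAt_id t).smul_const (z - y₀)).const_add y₀
    have h2 := (hu.differentiable (by simp) (y₀ + t • (z - y₀))).hasFDerivAt.comp_hasDerivAt t h1
    convert! h2 using 1
    simp only [partialDeriv]
    generalize fderiv ℝ u (y₀ + t • (z - y₀)) = L
    conv_rhs => rw [euclidean_eq_sum (z - y₀), map_sum]
    simp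
  have hcont : ∀ j : Fin n, Continuous fun t : ℝ => partialDeriv j u (y₀ + t • (z - y₀)) := fun j =>
    (hw j).continuous.comp (by fun_prop : Continuous fun t : ℝ => (z, t))
  have h3 := intervalIntegral.integral_eq_sub_of_hasDerivAt hd
    (Continuous.intervalIntegrable (continuous_finsetSum _ fun j _ =>
      continuous_const.mul (hcont j)) _ _)
  simp only [one_smul, zero_smul, add_zero, add_sub_cancel, h0, sub_zero] at h3
  rw [← h3, intervalIntegral.integral_finsetSum]
  · exact Finset.sum_congr rfl fun j _ => intervalIntegral.integral_const_mul _ _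
  · intro j _
    exact (continuous_const.mul (hcont j)).intervalIntegrable _ _

/-! ### The ideal of a point and its powers -/

theorem mem_vanishingIdeal {x : M} {f : SmoothFun n M} : f ∈ vanishingIdeal x ↔ f x = 0 := Iff.rfl

/-- A function that vanishes near `x` lies in all the powers of the ideal of `x`. -/
theorem mem_vanishingIdeal_pow_of_eventuallyEq [T2Space M] {x : M} {f : SmoothFun n M}
    (hf : ∀ᶠ x' in 𝓝 x, f x' = 0) (k : ℕ) : f ∈ vanishingIdeal x ^ k := by
  obtain ⟨b, hb, hbx⟩ : ∃ b : SmoothFun n M, b * f = 0 ∧ b x = 1 := by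
    obtain ⟨ρ, -, hρ⟩ := (SmoothBumpFunction.nhds_basis_tsupport (I := 𝓡 n) x).mem_iff.1 hf
    refine ⟨⟨fun x' => (ρ x' : ℂ), Complex.ofRealCLM.contDiff.comp_contMDiff ρ.contMDiff⟩, ?_, ?_⟩
    · ext x'
      change (ρ x' : ℂ) * f x' = 0
      by_cases hx' : ρ x' = 0
      · simp [hx']
      · rw [show f x' = 0 from hρ (subset_tsupport _ hx'), mul_zero]
    · change (ρ x : ℂ) = 1
      rw [ρ.eq_one, Complex.ofReal_one]
  -- Since `b * f = 0`, multiplying by `1 - b`, which vanishes at `x`, leaves `f` unchanged.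
  have h1 : f = (1 - b) ^ k * f := by
    induction k with
    | zero => simp
    | succ k ih =>
      rw [pow_succ, mul_assoc, sub_mul, hb, one_mul, sub_zero]
      exact ih
  rw [h1]
  refine Ideal.mul_mem_right _ _ (Ideal.pow_mem_pow ?_ k)
  rw [mem_vanishingIdeal]
  simp [hbx]

theorem exists_centredCoord [T2Space M] (x : M) (j : Fin n) :
    ∃ ξ : SmoothFun n M, (fun x' => ξ x') =ᶠ[𝓝 x]
      fun x' => ((extChartAt (𝓡 n) x x' j - extChartAt (𝓡 n) x x j : ℝ) : ℂ) := by
  have h : ContDiff ℝ ∞ fun y : 𝔼 => y j - extChartAt (𝓡 n) x x j := by fun_prop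
  exact exists_smoothFun_eventuallyEq x (u := fun y => ((y j - extChartAt (𝓡 n) x x j : ℝ) : ℂ))
    (Complex.ofRealCLM.contDiff.comp h)

/-- The `j`-th coordinate of the chart at `x`, centred at `x` and cut off. -/
def centredCoord [T2Space M] (x : M) (j : Fin n) : SmoothFun n M := (exists_centredCoord x j).choose

theorem centredCoord_eventuallyEq [T2Space M] (x : M) (j : Fin n) :
    (fun x' => centredCoord x j x') =ᶠ[𝓝 x]
      fun x' => ((extChartAt (𝓡 n) x x' j - extChartAt (𝓡 n) x x j : ℝ) : ℂ) :=
  (exists_centredCoord x j).choose_spec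

theorem centredCoord_mem [T2Space M] (x : M) (j : Fin n) : centredCoord x j ∈ vanishingIdeal x := by
  have h := (centredCoord_eventuallyEq x j).self_of_nhds
  exact h.trans (by simp)

/-- Every smooth function coincides near `x` with a smooth function of the coordinates. -/
theorem exists_contDiff_eventuallyEq (x : M) (h : SmoothFun n M) :
    ∃ u : 𝔼 → ℂ, ContDiff ℝ ∞ u ∧
      (fun x' => h x') =ᶠ[𝓝 x] fun x' => u (extChartAt (𝓡 n) x x') := by
  have hT := extChartAt_target_mem_nhds (I := 𝓡 n) x
  obtain ⟨ε, hε, hball⟩ := Metric.nhds_basis_closedBall.mem_iff.1 hT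
  -- The outer radius keeps the support inside the target of the chart, so extension by zero is
  -- smooth.
  let φ : ContDiffBump (extChartAt (𝓡 n) x x) := ⟨ε / 2, ε, by positivity, by linarith⟩
  refine ⟨fun y => φ y • coordExpr h x y, contDiff_iff_contDiffAt.2 fun y => ?_, ?_⟩
  · by_cases hy : y ∈ (extChartAt (𝓡 n) x).target
    · exact φ.contDiff.contDiffAt.smul ((contDiffOn_coordExpr h x).contDiffAt
        ((isOpen_extChartAt_target x).mem_nhds hy))
    · have hy' : y ∉ tsupport φ := by
        rw [φ.tsupport_eq]
        exact fun h' => hy (hball h')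
      refine (contDiffAt_const (c := (0 : ℂ))).congr_of_eventuallyEq ?_
      filter_upwards [(isClosed_tsupport φ).isOpen_compl.mem_nhds hy'] with z hz
      rw [image_eq_zero_of_notMem_tsupport hz, zero_smul]
  · filter_upwards [(continuousAt_extChartAt (I := 𝓡 n) x).eventually φ.eventuallyEq_one,
      extChartAt_source_mem_nhds (I := 𝓡 n) x] with x' h1 h2
    rw [h1, coordExpr, PartialEquiv.left_inv _ h2]
    simp

theorem smoothFun_sum_apply {ι : Type*} (s : Finset ι) (f : ι → SmoothFun n M) (x : M) :
    (∑ i ∈ s, f i) x = ∑ i ∈ s, f i x := by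
  classical
  induction s using Finset.induction_on with
  | empty => simp
  | insert a s ha ih => simp [Finset.sum_insert ha, ih]

/-- Modulo the square of its ideal, a function vanishing at `x` is a linear combination of the
coordinates. -/
theorem sub_sum_centredCoord_mem [T2Space M] {x : M} {h : SmoothFun n M}
    (hx : h ∈ vanishingIdeal x) :
    h - ∑ j, constFun (partialDeriv j (coordExpr h x) (extChartAt (𝓡 n) x x)) * centredCoord x j ∈
      vanishingIdeal x ^ 2 := by
  obtain ⟨u, hu, hhu⟩ := exists_contDiff_eventuallyEq x h
  have h0 : u (extChartAt (𝓡 n) x x) = 0 := hhu.self_of_nhds.symm.trans hx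
  obtain ⟨w, hw, hw0, hsum⟩ := hadamard_lemma hu _ h0
  choose k hk using fun j => exists_smoothFun_eventuallyEq x (hw j)
  have hd : ∀ j, partialDeriv j (coordExpr h x) (extChartAt (𝓡 n) x x) = k j x := fun j => by
    rw [partialDeriv, (coordExpr_eventuallyEq hhu).fderiv_eq]
    exact (hw0 j).symm.trans (hk j).self_of_nhds.symm
  have h1 : h - ∑ j, k j * centredCoord x j ∈ vanishingIdeal x ^ 2 := by
    refine mem_vanishingIdeal_pow_of_eventuallyEq ?_ 2
    have h2 : ∀ᶠ x' in 𝓝 x, ∀ j, k j x' = w j (extChartAt (𝓡 n) x x') :=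
      Filter.eventually_all.2 hk
    have h3 : ∀ᶠ x' in 𝓝 x, ∀ j, centredCoord x j x' =
        ((extChartAt (𝓡 n) x x' j - extChartAt (𝓡 n) x x j : ℝ) : ℂ) :=
      Filter.eventually_all.2 (centredCoord_eventuallyEq x)
    filter_upwards [h2, h3, hhu] with x' h2 h3 h4
    change h x' - (∑ j, k j * centredCoord x j) x' = 0
    rw [smoothFun_sum_apply, h4, hsum, sub_eq_zero]
    refine Finset.sum_congr rfl fun j _ => ?_
    change _ = k j x' * centredCoord x j x'
    rw [h2, h3, mul_comm]
  -- Freezing the Hadamard coefficients at `x` costs `(k j - k j x)` times a coordinate, a product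
  -- of two elements of the ideal.
  have h5 : h - ∑ j, constFun (partialDeriv j (coordExpr h x) (extChartAt (𝓡 n) x x)) *
      centredCoord x j = (h - ∑ j, k j * centredCoord x j) +
        ∑ j, (k j - constFun (k j x)) * centredCoord x j := by
    simp only [hd, sub_mul, Finset.sum_sub_distrib]
    ring
  rw [h5]
  refine Ideal.add_mem _ h1 (Ideal.sum_mem _ fun j _ => ?_)
  rw [pow_two]
  refine Ideal.mul_mem_mul ?_ (centredCoord_mem x j)
  change k j x - k j x = 0
  exact sub_self _

/-- Telescoping: `a₀ A - b₀ B = (a₀ - b₀) A + b₀ (A - B)`, where `A` and `B` are the products of the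
remaining factors. -/
theorem prod_sub_prod_mem_pow {A : Type*} [CommRing A] {I : Ideal A} {r : ℕ} {a b : Fin r → A}
    (ha : ∀ k, a k ∈ I) (hb : ∀ k, b k ∈ I) (hab : ∀ k, a k - b k ∈ I ^ 2) :
    ∏ k, a k - ∏ k, b k ∈ I ^ (r + 1) := by
  induction r with
  | zero => simp
  | succ r ih =>
    rw [Fin.prod_univ_succ, Fin.prod_univ_succ]
    have hA : ∏ k : Fin r, a k.succ ∈ I ^ r := by
      have := Ideal.prod_mem_prod (s := Finset.univ) (I := fun _ : Fin r => I)
        (x := fun k => a k.succ) fun k _ => ha _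
      simpa using this
    have h1 : (a 0 - b 0) * ∏ k : Fin r, a k.succ ∈ I ^ (r + 1 + 1) := by
      rw [show r + 1 + 1 = 2 + r by ring, pow_add]
      exact Ideal.mul_mem_mul (hab 0) hA
    have h2 : b 0 * (∏ k : Fin r, a k.succ - ∏ k : Fin r, b k.succ) ∈ I ^ (r + 1 + 1) := by
      rw [pow_succ']
      exact Ideal.mul_mem_mul (hb 0) (ih (fun k => ha _) (fun k => hb _) fun k => hab _)
    convert! Ideal.add_mem _ h1 h2 using 1
    ring

theorem constFun_mul (c d : ℂ) : (constFun c * constFun d : SmoothFun n M) = constFun (c * d) := rfl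

theorem constFun_prod {ι : Type*} (s : Finset ι) (c : ι → ℂ) :
    (∏ i ∈ s, constFun (c i) : SmoothFun n M) = constFun (∏ i ∈ s, c i) := by
  classical
  induction s using Finset.induction_on with
  | empty => rfl
  | insert a s ha ih => rw [Finset.prod_insert ha, Finset.prod_insert ha, ih, constFun_mul]

/-! ### Differential operators on products of functions vanishing at a point -/

theorem IsDiffOpOfOrder.map_zero {r : ℕ} {P : SmoothFun n M → SmoothFun n M}
    (hP : IsDiffOpOfOrder r P) : P 0 = 0 := by
  have := hP.map_add 0 0
  rwa [add_zero, left_eq_add] at this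

theorem IsDiffOpOfOrder.map_sum {r : ℕ} {P : SmoothFun n M → SmoothFun n M}
    (hP : IsDiffOpOfOrder r P) {ι : Type*} (s : Finset ι) (f : ι → SmoothFun n M) :
    P (∑ i ∈ s, f i) = ∑ i ∈ s, P (f i) := by
  classical
  induction s using Finset.induction_on with
  | empty => simp [hP.map_zero]
  | insert a s ha ih => rw [Finset.sum_insert ha, Finset.sum_insert ha, hP.map_add, ih]

/-- A differential operator of order `r`, at a point `x`, is determined on the products of `r`
functions vanishing at `x` by its values on the monomials of degree `r` in the coordinates. -/
theorem IsDiffOpOfOrder.apply_prod [T2Space M] {r : ℕ} {P : SmoothFun n M → SmoothFun n M}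
    (hP : IsDiffOpOfOrder r P) {x : M} {h : Fin r → SmoothFun n M}
    (hh : ∀ k, h k ∈ vanishingIdeal x) :
    P (∏ k, h k) x = ∑ J : Fin r → Fin n,
      (∏ k, partialDeriv (J k) (coordExpr (h k) x) (extChartAt (𝓡 n) x x)) *
        P (∏ k, centredCoord x (J k)) x := by
  set l : Fin r → SmoothFun n M := fun k => ∑ j,
    constFun (partialDeriv j (coordExpr (h k) x) (extChartAt (𝓡 n) x x)) * centredCoord x j with hl
  have hlx : ∀ k, l k ∈ vanishingIdeal x := fun k =>
    Ideal.sum_mem _ fun j _ => Ideal.mul_mem_left _ _ (centredCoord_mem x j)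
  -- Each factor is replaced by its linear part; the error lies in `𝔪ₓ ^ (r + 1)`, which `P` does
  -- not see at `x`.
  have h1 : ∏ k, h k - ∏ k, l k ∈ vanishingIdeal x ^ (r + 1) :=
    prod_sub_prod_mem_pow hh hlx fun k => sub_sum_centredCoord_mem (hh k)
  have h2 := hP.map_pow x _ h1
  have h3 : P (∏ k, h k) x = P (∏ k, l k) x := by
    have h4 := hP.map_add (∏ k, h k - ∏ k, l k) (∏ k, l k)
    rw [sub_add_cancel] at h4
    rw [h4]
    change P _ x + P _ x = _
    rw [mem_vanishingIdeal.1 h2, zero_add]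
  rw [h3, hl, Finset.prod_univ_sum]
  simp only [Finset.prod_mul_distrib, constFun_prod, Fintype.piFinset_univ, hP.map_sum,
    hP.map_const_mul, smoothFun_sum_apply]
  rfl

/-! ### Changes of coordinates -/

/-- The domain, in the chart at `a`, of the change of coordinates to the chart at `b`. -/
def overlap (a b : M) : Set 𝔼 :=
  (extChartAt (𝓡 n) a).target ∩ (extChartAt (𝓡 n) a).symm ⁻¹' (extChartAt (𝓡 n) b).source

/-- The change of coordinates from the chart at `a` to the chart at `b`. -/
def transition (a b : M) (y : 𝔼) : 𝔼 := extChartAt (𝓡 n) b ((extChartAt (𝓡 n) a).symm y)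

/-- The Jacobian matrix of the change of coordinates. -/
def jacobian (a b : M) (m k : Fin n) (y : 𝔼) : ℝ := partialDeriv k (fun z => transition a b z m) y

theorem isOpen_overlap (a b : M) : IsOpen (overlap (n := n) a b) :=
  (continuousOn_extChartAt_symm a).isOpen_inter_preimage (isOpen_extChartAt_target a)
    (isOpen_extChartAt_source b)

theorem contDiffOn_transition (a b : M) :
    ContDiffOn ℝ ∞ (transition a b) (overlap (n := n) a b) := by
  rw [← contMDiffOn_iff_contDiffOn]
  refine (contMDiffOn_extChartAt (I := 𝓡 n) (n := ∞) (x := b)).comp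
    ((contMDiffOn_extChartAt_symm a).mono Set.inter_subset_left) fun y hy => ?_
  simpa using hy.2

theorem contDiffOn_transition_apply (a b : M) (m : Fin n) :
    ContDiffOn ℝ ∞ (fun y => transition a b y m) (overlap (n := n) a b) :=
  (EuclideanSpace.proj m : 𝔼 →L[ℝ] ℝ).contDiff.comp_contDiffOn (contDiffOn_transition a b)

theorem contDiffOn_jacobian (a b : M) (m k : Fin n) :
    ContDiffOn ℝ ∞ (jacobian a b m k) (overlap (n := n) a b) :=
  contDiffOn_partialDeriv (isOpen_overlap a b) (contDiffOn_transition_apply a b m) k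

theorem transition_mem_target {a b : M} {y : 𝔼} (hy : y ∈ overlap a b) :
    transition a b y ∈ (extChartAt (𝓡 n) b).target :=
  (extChartAt (𝓡 n) b).map_source hy.2

theorem symm_transition {a b : M} {y : 𝔼} (hy : y ∈ overlap a b) :
    (extChartAt (𝓡 n) b).symm (transition a b y) = (extChartAt (𝓡 n) a).symm y :=
  (extChartAt (𝓡 n) b).left_inv hy.2

theorem differentiableAt_transition {a b : M} {y : 𝔼} (hy : y ∈ overlap a b) :
    DifferentiableAt ℝ (transition (n := n) a b) y :=
  ((contDiffOn_transition a b).contDiffAt ((isOpen_overlap a b).mem_nhds hy)).differentiableAt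
    (by simp)

theorem fderiv_transition_single {a b : M} {y : 𝔼} (hy : y ∈ overlap a b) (k : Fin n) :
    fderiv ℝ (transition a b) y (EuclideanSpace.single k 1) =
      ∑ m, jacobian a b m k y • EuclideanSpace.single m (1 : ℝ) := by
  rw [euclidean_eq_sum (fderiv ℝ (transition a b) y (EuclideanSpace.single k 1))]
  refine Finset.sum_congr rfl fun m _ => ?_
  congr 1
  have h := ((EuclideanSpace.proj m : 𝔼 →L[ℝ] ℝ).hasFDerivAt.comp y
    (differentiableAt_transition hy).hasFDerivAt).fderiv
  exact (DFunLike.congr_fun h (EuclideanSpace.single k 1)).symm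

theorem partialDeriv_comp_transition {F : Type*} [NormedAddCommGroup F] [NormedSpace ℝ F]
    {a b : M} {y : 𝔼} (hy : y ∈ overlap a b) {h : 𝔼 → F}
    (hh : ContDiffOn ℝ ∞ h (extChartAt (𝓡 n) b).target) (k : Fin n) :
    partialDeriv k (fun z => h (transition a b z)) y =
      ∑ q, jacobian a b q k y • partialDeriv q h (transition a b y) := by
  have h1 : DifferentiableAt ℝ h (transition a b y) :=
    (hh.contDiffAt ((isOpen_extChartAt_target b).mem_nhds (transition_mem_target hy))).differentiableAt
      (by simp)
  have h2 := (h1.hasFDerivAt.comp y (differentiableAt_transition hy).hasFDerivAt).fderiv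
  have h3 := DFunLike.congr_fun h2 (EuclideanSpace.single k 1)
  refine Eq.trans h3 ?_
  rw [ContinuousLinearMap.comp_apply, fderiv_transition_single hy, map_sum]
  simp only [map_smul]
  rfl

theorem frame_eq_sum {a b : M} {y : 𝔼} (hy : y ∈ overlap a b) (i : Fin n) :
    frame a i y = ∑ m, jacobian a b m i y • frame b m (transition a b y) := by
  have h1 : (extChartAt (𝓡 n) a).symm =ᶠ[𝓝 y]
      (extChartAt (𝓡 n) b).symm ∘ transition (n := n) a b := by
    filter_upwards [(isOpen_overlap a b).mem_nhds hy] with z hz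
    exact (symm_transition hz).symm
  have h2 := h1.mfderiv_eq (I := 𝓘(ℝ, 𝔼)) (I' := 𝓡 n)
  rw [mfderiv_comp y (mdifferentiableAt_extChartAt_symm (transition_mem_target hy))
    (differentiableAt_transition hy).mdifferentiableAt, mfderiv_eq_fderiv] at h2
  have h3 := DFunLike.congr_fun h2 (EuclideanSpace.single i 1)
  have key : ∀ (L : 𝔼 →L[ℝ] 𝔼), L (fderiv ℝ (transition a b) y (EuclideanSpace.single i 1)) =
      ∑ m, jacobian a b m i y • L (EuclideanSpace.single m (1 : ℝ)) := fun L => by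
    rw [fderiv_transition_single hy, map_sum]
    simp only [map_smul]
  exact Eq.trans h3 (key _)

/-! ### Transformation of the metric and of the Christoffel symbols -/

theorem metricMatrix_change (g : PseudoRiemannianMetric n M) {a b : M} {y : 𝔼}
    (hy : y ∈ overlap a b) (i j : Fin n) :
    metricMatrix g a y i j = ∑ m, ∑ l, jacobian a b m i y * jacobian a b l j y *
      metricMatrix g b (transition a b y) m l := by
  have h : ∀ (c : M) (z : 𝔼) (i j : Fin n), metricMatrix g c z i j =
      metricForm g ((extChartAt (𝓡 n) c).symm z) (frame c i z) (frame c j z) := fun _ _ _ _ => rfl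
  simp only [h, symm_transition hy, frame_eq_sum hy]
  simp only [map_sum, _root_.sum_apply, map_smul, _root_.smul_apply, smul_eq_mul]
  simp only [Finset.mul_sum]
  rw [Finset.sum_comm]
  refine Finset.sum_congr rfl fun m _ => Finset.sum_congr rfl fun l _ => ?_
  ring

theorem jacobian_symm {a b : M} {y : 𝔼} (hy : y ∈ overlap a b) (m j k : Fin n) :
    partialDeriv j (jacobian a b m k) y = partialDeriv k (jacobian a b m j) y := by
  set h : 𝔼 → ℝ := fun z => transition a b z m
  have hc : ContDiffAt ℝ ∞ h y :=
    (contDiffOn_transition_apply a b m).contDiffAt ((isOpen_overlap a b).mem_nhds hy)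
  have hs : IsSymmSndFDerivAt ℝ h y := hc.isSymmSndFDerivAt (by simp; exact WithTop.coe_le_coe.2 (le_top : (2 : ℕ∞) ≤ ⊤))
  have hd : DifferentiableAt ℝ (fderiv ℝ h) y :=
    (hc.fderiv_right (m := 1) (by norm_cast)).differentiableAt (by simp)
  have key : ∀ j k : Fin n, partialDeriv j (jacobian a b m k) y =
      fderiv ℝ (fderiv ℝ h) y (EuclideanSpace.single j 1) (EuclideanSpace.single k 1) := by
    intro j k
    have h1 := (hd.hasFDerivAt.clm_apply
      (hasFDerivAt_const (EuclideanSpace.single k (1 : ℝ) : 𝔼) y)).fderiv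
    have h2 := DFunLike.congr_fun h1 (EuclideanSpace.single j 1)
    refine Eq.trans h2 ?_
    simp
  rw [key, key]
  exact hs _ _

/-- The algebra behind the transformation law: `A` stands for the Jacobian, `H` for the second
derivatives of the change of coordinates, `dG` and `dG'` for the derivatives of the metric in the
two charts. Of the six terms containing `H`, four cancel by symmetry and two coincide. -/
theorem christoffel_first_kind_change {A : Fin n → Fin n → ℝ} {H : Fin n → Fin n → Fin n → ℝ}
    {G : Fin n → Fin n → ℝ} {dG dG' : Fin n → Fin n → Fin n → ℝ}
    (hG : ∀ m l, G m l = G l m) (hH : ∀ m j k, H m j k = H m k j)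
    (hd : ∀ k i j, dG' k i j = ∑ m, ∑ l, (H m k i * A l j * G m l + A m i * H l k j * G m l +
      A m i * A l j * ∑ q, A q k * dG q m l)) (i j k : Fin n) :
    dG' j i k + dG' k i j - dG' i j k = ∑ s, A s i * (2 * (∑ l, G s l * H l j k) +
      ∑ p, ∑ q, A p j * A q k * (dG p s q + dG q s p - dG s p q)) := by
  set B : (Fin n → ℝ) → (Fin n → ℝ) → ℝ := fun u v => ∑ m, ∑ l, u m * v l * G m l with hB
  set D : Fin n → Fin n → Fin n → ℝ :=
    fun k i j => ∑ m, ∑ l, A m i * A l j * ∑ q, A q k * dG q m l with hD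
  have hBsymm : ∀ u v, B u v = B v u := fun u v => by
    simp only [hB]
    rw [Finset.sum_comm]
    refine Finset.sum_congr rfl fun m _ => Finset.sum_congr rfl fun l _ => ?_
    rw [hG l m]
    ring
  have hd' : ∀ k i j, dG' k i j = B (fun m => H m k i) (fun l => A l j) +
      B (fun m => A m i) (fun l => H l k j) + D k i j := fun k i j => by
    simp only [hd, hB, hD, Finset.sum_add_distrib]
  have hR : ∑ s, A s i * (2 * (∑ l, G s l * H l j k) +
      ∑ p, ∑ q, A p j * A q k * (dG p s q + dG q s p - dG s p q)) =
      2 * B (fun m => A m i) (fun l => H l j k) + (D j i k + D k i j - D i j k) := by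
    have e1 : ∀ s, A s i * (2 * (∑ l, G s l * H l j k) +
        ∑ p, ∑ q, A p j * A q k * (dG p s q + dG q s p - dG s p q)) =
        2 * (∑ l, A s i * H l j k * G s l) +
        ((∑ l, A s i * A l k * ∑ q, A q j * dG q s l) + (∑ l, A s i * A l j * ∑ q, A q k * dG q s l)
          - ∑ m, ∑ l, A m j * A l k * (A s i * dG s m l)) := fun s => by
      rw [mul_add]
      congr 1
      · simp only [Finset.mul_sum]
        exact Finset.sum_congr rfl fun l _ => by ring
      · simp only [Finset.mul_sum, mul_sub, mul_add, Finset.sum_add_distrib, Finset.sum_sub_distrib]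
        congr 1
        · congr 1
          · rw [Finset.sum_comm]
            exact Finset.sum_congr rfl fun _ _ => Finset.sum_congr rfl fun _ _ => by ring
          · exact Finset.sum_congr rfl fun _ _ => Finset.sum_congr rfl fun _ _ => by ring
        · exact Finset.sum_congr rfl fun _ _ => Finset.sum_congr rfl fun _ _ => by ring
    rw [Finset.sum_congr rfl fun s _ => e1 s]
    simp only [Finset.sum_add_distrib, Finset.sum_sub_distrib, ← Finset.mul_sum, hB, hD]
    congr 2
    rw [Finset.sum_comm]
    refine Finset.sum_congr rfl fun m _ => ?_
    rw [Finset.sum_comm]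
    exact Finset.sum_congr rfl fun l _ => by rw [Finset.mul_sum]
  rw [hR, hd', hd', hd', hBsymm (fun m => H m j i), hBsymm (fun m => H m k i),
    hBsymm (fun m => H m i j), funext fun m => hH m j i, funext fun m => hH m k i,
    funext fun m => hH m k j]
  ring

theorem partialDeriv_sum {F ι : Type*} [NormedAddCommGroup F] [NormedSpace ℝ F] {s : Set 𝔼}
    (hs : IsOpen s) (t : Finset ι) {a : ι → 𝔼 → F} (ha : ∀ i, ContDiffOn ℝ ∞ (a i) s) (j : Fin n)
    {z : 𝔼} (hz : z ∈ s) :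
    partialDeriv j (fun y => ∑ i ∈ t, a i y) z = ∑ i ∈ t, partialDeriv j (a i) z := by
  simp only [partialDeriv]
  rw [fderiv_fun_sum fun i _ => ((ha i).contDiffAt (hs.mem_nhds hz)).differentiableAt (by simp),
    _root_.sum_apply]

theorem partialDeriv_prod {ι : Type*} [Fintype ι] [DecidableEq ι] {s : Set 𝔼} (hs : IsOpen s)
    {a : ι → 𝔼 → ℂ} (ha : ∀ i, ContDiffOn ℝ ∞ (a i) s) (j : Fin n) {z : 𝔼} (hz : z ∈ s) :
    partialDeriv j (fun y => ∏ i, a i y) z =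
      ∑ i, partialDeriv j (a i) z * ∏ k ∈ Finset.univ.erase i, a k z := by
  simp only [partialDeriv]
  rw [fderiv_finsetProd fun i _ => ((ha i).contDiffAt (hs.mem_nhds hz)).differentiableAt (by simp),
    _root_.sum_apply]
  refine Finset.sum_congr rfl fun i _ => ?_
  rw [_root_.smul_apply, smul_eq_mul, mul_comm]

theorem contDiffOn_comp_transition {F : Type*} [NormedAddCommGroup F] [NormedSpace ℝ F]
    {a b : M} {h : 𝔼 → F} (hh : ContDiffOn ℝ ∞ h (extChartAt (𝓡 n) b).target) :
    ContDiffOn ℝ ∞ (fun y => h (transition a b y)) (overlap a b) :=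
  hh.comp (contDiffOn_transition a b) fun _ hy => transition_mem_target hy

theorem partialDeriv_metricMatrix_change (g : PseudoRiemannianMetric n M) {a b : M} {y : 𝔼}
    (hy : y ∈ overlap a b) (k i j : Fin n) :
    partialDeriv k (fun z => metricMatrix g a z i j) y = ∑ m, ∑ l,
      (partialDeriv k (jacobian a b m i) y * jacobian a b l j y *
          metricMatrix g b (transition a b y) m l +
        jacobian a b m i y * partialDeriv k (jacobian a b l j) y *
          metricMatrix g b (transition a b y) m l +
        jacobian a b m i y * jacobian a b l j y * ∑ q, jacobian a b q k y *
          partialDeriv q (fun z => metricMatrix g b z m l) (transition a b y)) := by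
  have ho := isOpen_overlap (n := n) a b
  have hj := contDiffOn_jacobian (n := n) a b
  have hm := fun m l => contDiffOn_comp_transition (a := a) (contDiffOn_metricMatrix g b m l)
  rw [partialDeriv_congr ho (fun z hz => metricMatrix_change g hz i j) k hy,
    partialDeriv_sum ho _ (fun m => ContDiffOn.sum fun l _ => ((hj m i).mul (hj l j)).mul (hm m l))
      k hy]
  refine Finset.sum_congr rfl fun m _ => ?_
  rw [partialDeriv_sum ho _ (fun l => ((hj m i).mul (hj l j)).mul (hm m l)) k hy]
  refine Finset.sum_congr rfl fun l _ => ?_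
  rw [partialDeriv_mul ho ((hj m i).mul (hj l j)) (hm m l) k hy,
    partialDeriv_mul ho (hj m i) (hj l j) k hy,
    partialDeriv_comp_transition hy (contDiffOn_metricMatrix g b m l) k]
  simp only [smul_eq_mul]
  ring

/-- Inversion of `g_a = Aᵀ g_b A`; the Jacobian `A` is invertible because `det g_a` is a unit. -/
theorem jacobian_mul_inv_metricMatrix (g : PseudoRiemannianMetric n M) {a b : M} {y : 𝔼}
    (hy : y ∈ overlap a b) :
    Matrix.of (fun m k => jacobian a b m k y) * (metricMatrix g a y)⁻¹ *
      (Matrix.of fun m k => jacobian a b m k y).transpose =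
        (metricMatrix g b (transition a b y))⁻¹ := by
  set A : Matrix (Fin n) (Fin n) ℝ := Matrix.of fun m k => jacobian a b m k y
  set G := metricMatrix g b (transition a b y)
  have h : metricMatrix g a y = A.transpose * G * A := by
    ext i j
    rw [metricMatrix_change g hy, Matrix.mul_apply]
    simp only [Matrix.mul_apply, Finset.sum_mul]
    rw [Finset.sum_comm]
    exact Finset.sum_congr rfl fun l _ => Finset.sum_congr rfl fun m _ => by
      simp only [A, G, Matrix.transpose_apply, Matrix.of_apply]; ring
  have hu := isUnit_det_metricMatrix g hy.1
  rw [h, Matrix.det_mul] at hu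
  have hA : IsUnit A.det := isUnit_of_mul_isUnit_right hu
  have hA' : IsUnit A.transpose.det := by rwa [Matrix.det_transpose]
  rw [h, Matrix.mul_inv_rev, Matrix.mul_inv_rev, ← Matrix.mul_assoc, Matrix.mul_nonsing_inv _ hA,
    Matrix.one_mul, Matrix.mul_assoc, Matrix.nonsing_inv_mul _ hA', Matrix.mul_one]

/-- The law of transformation of the Christoffel symbols. -/
theorem christoffel_change (g : PseudoRiemannianMetric n M) {a b : M} {y : 𝔼}
    (hy : y ∈ overlap a b) (m j k : Fin n) :
    ∑ l, jacobian a b m l y * christoffel g a l j k y =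
      partialDeriv j (jacobian a b m k) y + ∑ p, ∑ q, jacobian a b p j y * jacobian a b q k y *
        christoffel g b m p q (transition a b y) := by
  set A : Matrix (Fin n) (Fin n) ℝ := Matrix.of fun m k => jacobian a b m k y with hA
  set G := metricMatrix g b (transition a b y) with hG
  set H : Fin n → ℝ := fun m => partialDeriv j (jacobian a b m k) y with hH
  set dG : Fin n → Fin n → Fin n → ℝ := fun k i j =>
    partialDeriv k (fun z => metricMatrix g b z i j) (transition a b y) with hdG
  set X : Fin n → ℝ := fun s => 2 * (∑ l, G s l * H l) +
      ∑ p, ∑ q, A p j * A q k * (dG p s q + dG q s p - dG s p q) with hX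
  have h1 : ∀ i, partialDeriv j (fun z => metricMatrix g a z i k) y +
      partialDeriv k (fun z => metricMatrix g a z i j) y -
      partialDeriv i (fun z => metricMatrix g a z j k) y = A.transpose.mulVec X i := fun i =>
    christoffel_first_kind_change (A := fun m k => jacobian a b m k y)
      (H := fun m j k => partialDeriv j (jacobian a b m k) y) (G := G) (dG := dG)
      (dG' := fun k i j => partialDeriv k (fun z => metricMatrix g a z i j) y)
      (metricMatrix_symm g b _) (fun m j k => jacobian_symm hy m j k)
      (fun k i j => partialDeriv_metricMatrix_change g hy k i j) i j k
  have h2 : ∀ l, christoffel g a l j k y =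
      1 / 2 * (metricMatrix g a y)⁻¹.mulVec (A.transpose.mulVec X) l := fun l => by
    rw [christoffel]
    simp only [h1]
    rfl
  -- Raising the index in the chart at `a` and applying the Jacobian `A` amounts to `A g_a⁻¹ Aᵀ`,
  -- which is `g_b⁻¹`.
  have h3 : ∑ l, jacobian a b m l y * christoffel g a l j k y = 1 / 2 * (G⁻¹).mulVec X m := by
    rw [hG, ← jacobian_mul_inv_metricMatrix g hy, ← Matrix.mulVec_mulVec, ← Matrix.mulVec_mulVec]
    simp only [h2]
    rw [Matrix.mulVec, dotProduct, Finset.mul_sum]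
    exact Finset.sum_congr rfl fun l _ => mul_left_comm _ _ _
  have h4 : X = (2 : ℝ) • G.mulVec H +
      ∑ p, ∑ q, (A p j * A q k) • fun s => dG p s q + dG q s p - dG s p q := by
    ext s
    simp only [hX, Pi.add_apply, Pi.smul_apply, Finset.sum_apply, smul_eq_mul]
    rfl
  have h5 : (G⁻¹).mulVec X = (2 : ℝ) • H + ∑ p, ∑ q, (A p j * A q k) •
      (G⁻¹).mulVec fun s => dG p s q + dG q s p - dG s p q := by
    simp only [← Matrix.mulVecLin_apply, h4, map_add, map_smul, map_sum]
    simp only [Matrix.mulVecLin_apply]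
    rw [Matrix.mulVec_mulVec, Matrix.nonsing_inv_mul _
      (isUnit_det_metricMatrix g (transition_mem_target hy)), Matrix.one_mulVec]
  rw [h3, h5]
  simp only [Pi.add_apply, Pi.smul_apply, Finset.sum_apply, smul_eq_mul, mul_add, Finset.mul_sum]
  congr 1
  · ring
  · refine Finset.sum_congr rfl fun p _ => Finset.sum_congr rfl fun q _ => ?_
    rw [christoffel, mul_left_comm]
    rfl

/-! ### Tensoriality of the iterated covariant differentials -/

theorem sum_sum_update {r : ℕ} {α F : Type*} [Fintype α] [DecidableEq α] [AddCommMonoid F] (i : Fin r)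
    (T : (Fin r → α) → α → F) :
    ∑ K, ∑ l, T K l = ∑ K, ∑ l, T (Function.update K i l) (K i) := by
  rw [← Fintype.sum_prod_type', ← Fintype.sum_prod_type']
  -- Exchanging `l` with the `i`-th entry of `K` is an involution.
  refine Fintype.sum_bijective (fun q : (Fin r → α) × α => (Function.update q.1 i q.2, q.1 i))
    (Function.Involutive.bijective fun q => ?_) _ _ fun q => ?_
  · simp
  · simp

/-- Induction on `r`. The derivatives of the Jacobian factors are not tensorial, but they cancel
against the inhomogeneous term in the transformation law of the Christoffel symbols. -/
theorem covDiff_change (g : PseudoRiemannianMetric n M) (f : SmoothFun n M) {a b : M} (r : ℕ)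
    (J : Fin r → Fin n) {y : 𝔼} (hy : y ∈ overlap a b) :
    covDiff g f a r J y = ∑ K : Fin r → Fin n, (∏ k, (jacobian a b (K k) (J k) y : ℂ)) *
      covDiff g f b r K (transition a b y) := by
  induction r generalizing y with
  | zero =>
    rw [Fintype.sum_unique, Finset.univ_eq_empty, Finset.prod_empty, one_mul]
    exact congrArg f (symm_transition hy).symm
  | succ r ih =>
    have ho := isOpen_overlap (n := n) a b
    have hjac : ∀ m k, ContDiffOn ℝ ∞ (fun z => (jacobian a b m k z : ℂ)) (overlap (n := n) a b) :=
      fun m k => Complex.ofRealCLM.contDiff.comp_contDiffOn (contDiffOn_jacobian a b m k)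
    have hS := fun K => contDiffOn_comp_transition (a := a) (contDiffOn_covDiff g f b r K)
    have hdjac : ∀ m j k, partialDeriv j (fun z => (jacobian a b m k z : ℂ)) y =
        ((partialDeriv j (jacobian a b m k) y : ℝ) : ℂ) := fun m j k => by
      have h1 := ((contDiffOn_jacobian a b m k).contDiffAt (ho.mem_nhds hy)).differentiableAt
        (by simp)
      exact DFunLike.congr_fun (Complex.ofRealCLM.hasFDerivAt.comp y h1.hasFDerivAt).fderiv _
    set j := J 0
    set J' := Fin.tail J
    set A : Fin n → Fin n → ℂ := fun m k => (jacobian a b m k y : ℂ) with hA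
    set S : (Fin r → Fin n) → ℂ := fun K => covDiff g f b r K (transition a b y) with hSdef
    set dS : Fin n → (Fin r → Fin n) → ℂ :=
      fun q K => partialDeriv q (covDiff g f b r K) (transition a b y) with hdS
    -- The product of the Jacobian factors with the `i`-th one omitted; it does not depend on `K i`.
    set E : Fin r → (Fin r → Fin n) → ℂ := fun i K => ∏ k ∈ Finset.univ.erase i, A (K k) (J' k)
    have hd : partialDeriv j (covDiff g f a r J') y =
        ∑ K : Fin r → Fin n, ((∑ i, ((partialDeriv j (jacobian a b (K i) (J' i)) y : ℝ) : ℂ) * E i K) * S K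
          + (∏ k, A (K k) (J' k)) * ∑ q, A q j * dS q K) := by
      rw [partialDeriv_congr ho (fun z hz => ih J' hz) j hy, partialDeriv_sum ho _
        (fun K => (contDiffOn_prod fun k _ => hjac _ _).mul (hS K)) j hy]
      refine Finset.sum_congr rfl fun K _ => ?_
      rw [partialDeriv_mul ho (contDiffOn_prod fun k _ => hjac _ _) (hS K) j hy,
        partialDeriv_prod ho (fun k => hjac (K k) (J' k)) j hy,
        partialDeriv_comp_transition hy (contDiffOn_covDiff g f b r K) j]
      simp only [hdjac, Complex.real_smul]
      rfl
    have hprod : ∀ i K, ∏ k, A (K k) (J' k) = A (K i) (J' i) * E i K := fun i K =>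
      (Finset.mul_prod_erase _ _ (Finset.mem_univ i)).symm
    have hE : ∀ i K q, E i (Function.update K i q) = E i K := fun i K q =>
      Finset.prod_congr rfl fun k hk => by rw [Function.update_of_ne (Finset.ne_of_mem_erase hk)]
    have hup : ∀ i l, covDiff g f a r (Function.update J' i l) y =
        ∑ K : Fin r → Fin n, A (K i) l * E i K * S K := fun i l => by
      rw [ih _ hy]
      refine Finset.sum_congr rfl fun K _ => ?_
      congr 1
      rw [← Finset.mul_prod_erase _ _ (Finset.mem_univ i), Function.update_self]
      congr 1
      exact Finset.prod_congr rfl fun k hk => by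
        rw [Function.update_of_ne (Finset.ne_of_mem_erase hk)]
    have hΓ : ∀ m k, ∑ l, A m l * (christoffel g a l j k y : ℂ) =
        ((partialDeriv j (jacobian a b m k) y : ℝ) : ℂ) + ∑ p, ∑ q, A p j * A q k *
          (christoffel g b m p q (transition a b y) : ℂ) := fun m k => by
      have := congrArg (fun t : ℝ => (t : ℂ)) (christoffel_change g hy m j k)
      simpa only [Complex.ofReal_sum, Complex.ofReal_mul, Complex.ofReal_add] using this
    have h1 : ∀ i, ∑ l, (christoffel g a l j (J' i) y : ℂ) *
        covDiff g f a r (Function.update J' i l) y =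
        ∑ K : Fin r → Fin n, (((partialDeriv j (jacobian a b (K i) (J' i)) y : ℝ) : ℂ) * E i K * S K +
          ∑ p, ∑ q, A p j * A q (J' i) *
            (christoffel g b (K i) p q (transition a b y) : ℂ) * E i K * S K) := fun i => by
      simp only [hup, Finset.mul_sum]
      rw [Finset.sum_comm]
      refine Finset.sum_congr rfl fun K _ => ?_
      have := congrArg (fun t => t * E i K * S K) (hΓ (K i) (J' i))
      simp only [Finset.sum_mul, add_mul] at this
      rw [← this]
      exact Finset.sum_congr rfl fun l _ => by ring
    -- The Christoffel terms in the chart at `b`, with the summed index `l` exchanged with `K i` so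
    -- as to match `h1`.
    have h2 : ∀ i p, ∑ K : Fin r → Fin n, (∏ k, A (K k) (J' k)) *
        ∑ l, (christoffel g b l p (K i) (transition a b y) : ℂ) * S (Function.update K i l) =
        ∑ K : Fin r → Fin n, ∑ q, A q (J' i) *
          (christoffel g b (K i) p q (transition a b y) : ℂ) * E i K * S K := fun i p => by
      simp only [Finset.mul_sum]
      rw [sum_sum_update i]
      refine Finset.sum_congr rfl fun K _ => Finset.sum_congr rfl fun q _ => ?_
      rw [hprod i, Function.update_self, hE, Function.update_idem, Function.update_eq_self]
      ring
    have h0 : covDiff g f a (r + 1) J y = partialDeriv j (covDiff g f a r J') y -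
        ∑ i, ∑ l, (christoffel g a l j (J' i) y : ℂ) *
          covDiff g f a r (Function.update J' i l) y := rfl
    rw [h0, hd, Finset.sum_congr rfl fun i _ => h1 i]
    rw [← (Fin.consEquiv fun _ => Fin n).sum_comp, Fintype.sum_prod_type]
    have h3 : ∀ (p : Fin n) (K : Fin r → Fin n),
        (∏ k, (jacobian a b (Fin.consEquiv (fun _ => Fin n) (p, K) k) (J k) y : ℂ)) *
          covDiff g f b (r + 1) (Fin.consEquiv (fun _ => Fin n) (p, K)) (transition a b y) =
        A p j * (∏ k, A (K k) (J' k)) * dS p K - A p j * ∑ i, (∏ k, A (K k) (J' k)) *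
          ∑ l, (christoffel g b l p (K i) (transition a b y) : ℂ) * S (Function.update K i l) := by
      intro p K
      rw [Fin.prod_univ_succ, covDiff, ← Finset.mul_sum, ← mul_assoc, ← mul_sub]
      rfl
    have h4 : ∀ p, ∑ K : Fin r → Fin n, ∑ i, (∏ k, A (K k) (J' k)) *
          ∑ l, (christoffel g b l p (K i) (transition a b y) : ℂ) * S (Function.update K i l) =
        ∑ i, ∑ K : Fin r → Fin n, ∑ q, A q (J' i) *
          (christoffel g b (K i) p q (transition a b y) : ℂ) * E i K * S K := fun p => by
      rw [Finset.sum_comm]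
      exact Finset.sum_congr rfl fun i _ => h2 i p
    have h5 : ∑ K : Fin r → Fin n,
          (∑ i, ((partialDeriv j (jacobian a b (K i) (J' i)) y : ℝ) : ℂ) * E i K) * S K =
        ∑ i, ∑ K : Fin r → Fin n,
          ((partialDeriv j (jacobian a b (K i) (J' i)) y : ℝ) : ℂ) * E i K * S K := by
      simp only [Finset.sum_mul]
      exact Finset.sum_comm
    have h6 : ∑ K : Fin r → Fin n, (∏ k, A (K k) (J' k)) * ∑ q, A q j * dS q K =
        ∑ p, ∑ K : Fin r → Fin n, A p j * (∏ k, A (K k) (J' k)) * dS p K := by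
      simp only [Finset.mul_sum]
      rw [Finset.sum_comm]
      exact Finset.sum_congr rfl fun p _ => Finset.sum_congr rfl fun K _ => by ring
    have h7 : ∑ i, ∑ K : Fin r → Fin n, ∑ p, ∑ q, A p j * A q (J' i) *
          (christoffel g b (K i) p q (transition a b y) : ℂ) * E i K * S K =
        ∑ p, A p j * ∑ i, ∑ K : Fin r → Fin n, ∑ q, A q (J' i) *
          (christoffel g b (K i) p q (transition a b y) : ℂ) * E i K * S K := by
      simp only [Finset.mul_sum]
      rw [Finset.sum_congr rfl fun i _ => Finset.sum_comm, Finset.sum_comm]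
      exact Finset.sum_congr rfl fun p _ => Finset.sum_congr rfl fun i _ =>
        Finset.sum_congr rfl fun K _ => Finset.sum_congr rfl fun q _ => by ring
    rw [Finset.sum_congr rfl fun p _ => Finset.sum_congr rfl fun K _ => h3 p K]
    simp only [Finset.sum_sub_distrib, Finset.sum_add_distrib]
    rw [h5, h6, h7, Finset.sum_congr rfl fun p _ => (Finset.mul_sum _ _ _).symm,
      Finset.sum_congr rfl fun p _ => congrArg (A p j * ·) (h4 p)]
    ring

/-! ### Quantized tensor fields as operators -/

theorem frame_self (x : M) (j : Fin n) :
    frame x j (extChartAt (𝓡 n) x x) = EuclideanSpace.single j 1 := by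
  have h := coframe_frame (mem_extChartAt_target (I := 𝓡 n) x) (x₀ := x) (j := j)
  ext i
  have h1 := h i
  rw [extChartAt_to_inv] at h1
  have h2 := DFunLike.congr_fun (coordCovector_self x i) (frame x j (extChartAt (𝓡 n) x x))
  refine h2.symm.trans (h1.trans ?_)
  simp [eq_comm]

theorem mem_overlap_self {x₀ x : M} (hx : x ∈ (extChartAt (𝓡 n) x₀).source) :
    extChartAt (𝓡 n) x x ∈ overlap (n := n) x x₀ :=
  ⟨mem_extChartAt_target x, by rwa [Set.mem_preimage, extChartAt_to_inv]⟩

theorem transition_self (x₀ x : M) :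
    transition (n := n) x x₀ (extChartAt (𝓡 n) x x) = extChartAt (𝓡 n) x₀ x := by
  rw [transition, extChartAt_to_inv]

theorem coframe_single {x₀ x : M} (hx : x ∈ (extChartAt (𝓡 n) x₀).source) (m k : Fin n) :
    coframe x₀ m x (EuclideanSpace.single k 1) = jacobian x x₀ m k (extChartAt (𝓡 n) x x) := by
  have h := fun q => coframe_frame ((extChartAt (𝓡 n) x₀).map_source hx) m q
  rw [(extChartAt (𝓡 n) x₀).left_inv hx] at h
  rw [← frame_self x k, frame_eq_sum (mem_overlap_self hx), map_sum, transition_self]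
  simp only [map_smul, h, smul_eq_mul, mul_ite, mul_one, mul_zero, Finset.sum_ite_eq,
    Finset.mem_univ, if_true]

theorem coframe_eq_sum {x₀ x : M} (hx : x ∈ (extChartAt (𝓡 n) x₀).source) (m : Fin n) :
    coframe x₀ m x = ∑ k, jacobian x x₀ m k (extChartAt (𝓡 n) x x) • coframe x k x := by
  have h : ∀ k : Fin n, coframe x k x = EuclideanSpace.proj k := fun k => coordCovector_self x k
  simp only [h, ← coframe_single hx]
  exact covector_eq_sum _

/-- The quantized of a tensor field at `x`, computed in the chart at another point. -/
theorem SymTensorField.quantized_eq_of_mem (g : PseudoRiemannianMetric n M) (ħ : ℝ) {r : ℕ}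
    (Φ : SymTensorField n M r) (f : SmoothFun n M) {x₀ x : M}
    (hx : x ∈ (extChartAt (𝓡 n) x₀).source) :
    Φ.quantized g ħ f x = (-Complex.I * ħ) ^ r *
      ∑ K : Fin r → Fin n, Φ.val x (fun k => coordCovector x₀ (K k) x) *
        ((r.factorial : ℂ)⁻¹ * ∑ σ : Equiv.Perm (Fin r),
          covDiff g f x₀ r (K ∘ σ) (extChartAt (𝓡 n) x₀ x)) := by
  set A : Fin n → Fin n → ℝ := fun m k => jacobian x x₀ m k (extChartAt (𝓡 n) x x) with hA
  set S : (Fin r → Fin n) → ℂ := fun K => covDiff g f x₀ r K (extChartAt (𝓡 n) x₀ x) with hS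
  have h1 : ∀ (J : Fin r → Fin n) (σ : Equiv.Perm (Fin r)),
      covDiff g f x r (J ∘ σ) (extChartAt (𝓡 n) x x) =
        ∑ K : Fin r → Fin n, (∏ k, (A (K k) (J k) : ℂ)) * S (K ∘ σ) := fun J σ => by
    -- Reindexing `K` by the same permutation as `J` leaves the product of Jacobian entries
    -- unchanged, so symmetrization commutes with the change of chart.
    rw [covDiff_change g f r _ (mem_overlap_self hx), transition_self,
      ← (Equiv.arrowCongr σ.symm (Equiv.refl (Fin n))).sum_comp]
    refine Finset.sum_congr rfl fun K _ => ?_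
    congr 1
    exact Equiv.prod_comp σ fun k => (A (K k) (J k) : ℂ)
  have h2 : ∀ K : Fin r → Fin n, Φ.val x (fun k => coordCovector x₀ (K k) x) =
      ∑ J : Fin r → Fin n, (∏ k, (A (K k) (J k) : ℂ)) *
        Φ.val x (fun k => coordCovector x (J k) x) := fun K => by
    have key : ∀ φ : MultilinearMap ℝ (fun _ : Fin r => 𝔼 →L[ℝ] ℝ) ℂ,
        φ (fun k => coframe x₀ (K k) x) = ∑ J : Fin r → Fin n, (∏ k, (A (K k) (J k) : ℂ)) *
          φ (fun k => coframe x (J k) x) := fun φ => by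
      simp only [coframe_eq_sum hx]
      rw [MultilinearMap.map_sum]
      refine Finset.sum_congr rfl fun J _ => ?_
      rw [MultilinearMap.map_smul_univ, Complex.real_smul, Complex.ofReal_prod]
    exact key (Φ.val x)
  rw [SymTensorField.quantized]
  congr 1
  have h3 : ∀ J, symCovDiff g f r x J = ∑ K : Fin r → Fin n, (∏ k, (A (K k) (J k) : ℂ)) *
      ((r.factorial : ℂ)⁻¹ * ∑ σ : Equiv.Perm (Fin r), S (K ∘ σ)) := fun J => by
    simp only [symCovDiff, h1]
    rw [Finset.sum_comm, Finset.mul_sum]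
    refine Finset.sum_congr rfl fun K _ => ?_
    rw [← Finset.mul_sum, mul_left_comm]
  rw [Finset.sum_congr rfl fun J _ => congrArg _ ((h3 J).trans rfl),
    Finset.sum_congr rfl fun J _ => Finset.mul_sum _ _ _, Finset.sum_comm]
  refine Finset.sum_congr rfl fun K _ => ?_
  rw [h2, Finset.sum_mul]
  exact Finset.sum_congr rfl fun J _ => by ring

/-- The definition uses the chart at the moving point `x`; near `x₀` the fixed chart at `x₀` gives
the same value, through components that are smooth. -/
theorem SymTensorField.contMDiff_quantized (g : PseudoRiemannianMetric n M) (ħ : ℝ) {r : ℕ}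
    (Φ : SymTensorField n M r) (f : SmoothFun n M) :
    ContMDiff (𝓡 n) 𝓘(ℝ, ℂ) ∞ (Φ.quantized g ħ f) := by
  intro x₀
  have hS : (chartAt 𝔼 x₀).source ∈ 𝓝 x₀ := chart_source_mem_nhds 𝔼 x₀
  refine ContMDiffAt.congr_of_eventuallyEq ?_ (Filter.eventually_of_mem hS fun x hx =>
    Φ.quantized_eq_of_mem g ħ f (x₀ := x₀) (by simpa using hx))
  refine contMDiffAt_const.mul (contMDiffAt_finsetSum fun K _ => ?_)
  refine ((Φ.smooth x₀ K).contMDiffAt hS).mul (contMDiffAt_const.mul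
    (contMDiffAt_finsetSum fun σ _ => ?_))
  have h := (contDiffOn_covDiff g f x₀ r (K ∘ σ)).contMDiffOn.comp
    (contMDiffOn_extChartAt (I := 𝓡 n) (n := ∞) (x := x₀))
    fun x hx => (extChartAt (𝓡 n) x₀).map_source (by simpa using hx)
  exact h.contMDiffAt hS

theorem covDiff_add (g : PseudoRiemannianMetric n M) (f h : SmoothFun n M) (x₀ : M) (r : ℕ)
    (J : Fin r → Fin n) {y : 𝔼} (hy : y ∈ (extChartAt (𝓡 n) x₀).target) :
    covDiff g (f + h) x₀ r J y = covDiff g f x₀ r J y + covDiff g h x₀ r J y := by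
  induction r generalizing y with
  | zero => rfl
  | succ r ih =>
    have ho := isOpen_extChartAt_target (I := 𝓡 n) x₀
    simp only [covDiff]
    rw [partialDeriv_congr ho (fun z hz => ih _ hz) _ hy,
      partialDeriv_add ho (contDiffOn_covDiff g f x₀ r _) (contDiffOn_covDiff g h x₀ r _) _ hy]
    simp only [ih _ hy, mul_add, Finset.sum_add_distrib]
    ring

theorem covDiff_const_mul (g : PseudoRiemannianMetric n M) (c : ℂ) (f : SmoothFun n M) (x₀ : M)
    (r : ℕ) (J : Fin r → Fin n) {y : 𝔼} (hy : y ∈ (extChartAt (𝓡 n) x₀).target) :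
    covDiff g ((constFun c : SmoothFun n M) * f) x₀ r J y = c * covDiff g f x₀ r J y := by
  induction r generalizing y with
  | zero => rfl
  | succ r ih =>
    have ho := isOpen_extChartAt_target (I := 𝓡 n) x₀
    simp only [covDiff]
    rw [partialDeriv_congr ho (fun z hz => ih _ hz) _ hy,
      partialDeriv_const_mul ho (contDiffOn_covDiff g f x₀ r _) c _ hy]
    simp only [ih _ hy, mul_sub, Finset.mul_sum, mul_left_comm c]

theorem SymTensorField.quantized_add (g : PseudoRiemannianMetric n M) (ħ : ℝ) {r : ℕ}
    (Φ : SymTensorField n M r) (f h : SmoothFun n M) (x : M) :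
    Φ.quantized g ħ (f + h) x = Φ.quantized g ħ f x + Φ.quantized g ħ h x := by
  simp only [SymTensorField.quantized, symCovDiff, covDiff_add g f h x r _ (mem_extChartAt_target x),
    Finset.sum_add_distrib, mul_add]

theorem SymTensorField.quantized_const_mul (g : PseudoRiemannianMetric n M) (ħ : ℝ) {r : ℕ}
    (Φ : SymTensorField n M r) (c : ℂ) (f : SmoothFun n M) (x : M) :
    Φ.quantized g ħ ((constFun c : SmoothFun n M) * f) x = c * Φ.quantized g ħ f x := by
  simp only [SymTensorField.quantized, symCovDiff,
    covDiff_const_mul g c f x r _ (mem_extChartAt_target x), ← Finset.mul_sum, mul_left_comm _ c]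

/-! ### The principal symbol of a differential operator -/

theorem exists_smoothFun_eventuallyEq_of_contMDiffOn [T2Space M] {u : M → ℂ} {s : Set M}
    (hs : IsOpen s) (hu : ContMDiffOn (𝓡 n) 𝓘(ℝ, ℂ) ∞ u s) {x : M} (hx : x ∈ s) :
    ∃ h : SmoothFun n M, (fun x' => h x') =ᶠ[𝓝 x] u := by
  obtain ⟨ρ, -, hρ⟩ :=
    (SmoothBumpFunction.nhds_basis_tsupport (I := 𝓡 n) x).mem_iff.1 (hs.mem_nhds hx)
  refine ⟨⟨fun x' => ρ x' • u x', contMDiff_of_tsupport fun x' hx' => ?_⟩, ?_⟩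
  · have h1 : x' ∈ s := hρ (tsupport_smul_subset_left _ _ hx')
    exact ρ.contMDiff.contMDiffAt.smul (hu.contMDiffAt (hs.mem_nhds h1))
  · filter_upwards [ρ.eventuallyEq_one] with x' hx'
    change ρ x' • u x' = _
    rw [hx']
    simp

theorem partialDeriv_coordExpr_eq_jacobian {h : SmoothFun n M} {x₀ x : M} {m : Fin n} {c : ℂ}
    (hx : x ∈ (extChartAt (𝓡 n) x₀).source)
    (hh : (fun x' => h x') =ᶠ[𝓝 x] fun x' => (extChartAt (𝓡 n) x₀ x' m : ℂ) - c) (j : Fin n) :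
    partialDeriv j (coordExpr h x) (extChartAt (𝓡 n) x x) =
      (jacobian x x₀ m j (extChartAt (𝓡 n) x x) : ℂ) := by
  have h0 : Filter.Tendsto (extChartAt (𝓡 n) x).symm (𝓝 (extChartAt (𝓡 n) x x)) (𝓝 x) := by
    have := continuousAt_extChartAt_symm (I := 𝓡 n) x
    rwa [ContinuousAt, extChartAt_to_inv] at this
  have h1 : coordExpr h x =ᶠ[𝓝 (extChartAt (𝓡 n) x x)]
      fun y => (transition x x₀ y m : ℂ) - c := h0.eventually hh
  have h2 := ((contDiffOn_transition_apply x x₀ m).contDiffAt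
    ((isOpen_overlap x x₀).mem_nhds (mem_overlap_self hx))).differentiableAt (by simp)
  have h3 := ((Complex.ofRealCLM.hasFDerivAt.comp _ h2.hasFDerivAt).sub_const c).fderiv
  rw [partialDeriv, h1.fderiv_eq]
  exact DFunLike.congr_fun h3 _

/-- The principal symbol at `x` of a differential operator of order `r`, up to a factor. -/
def symbolForm [T2Space M] (P : SmoothFun n M → SmoothFun n M) (r : ℕ) (x : M) :
    MultilinearMap ℝ (fun _ : Fin r => 𝔼 →L[ℝ] ℝ) ℂ :=
  ∑ J : Fin r → Fin n, P (∏ k, centredCoord x (J k)) x •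
    (MultilinearMap.mkPiAlgebra ℝ (Fin r) ℂ).compLinearMap fun k =>
      Complex.ofRealCLM.toLinearMap ∘ₗ
        (ContinuousLinearMap.apply ℝ ℝ (EuclideanSpace.single (J k) (1 : ℝ) : 𝔼)).toLinearMap

theorem symbolForm_apply [T2Space M] (P : SmoothFun n M → SmoothFun n M) (r : ℕ) (x : M)
    (α : Fin r → 𝔼 →L[ℝ] ℝ) :
    symbolForm P r x α = ∑ J : Fin r → Fin n,
      (∏ k, (α k (EuclideanSpace.single (J k) 1) : ℂ)) * P (∏ k, centredCoord x (J k)) x := by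
  simp [symbolForm, mul_comm]

theorem symbolForm_symm [T2Space M] (P : SmoothFun n M → SmoothFun n M) (r : ℕ) (x : M)
    (σ : Equiv.Perm (Fin r)) (α : Fin r → 𝔼 →L[ℝ] ℝ) :
    symbolForm P r x (fun k => α (σ k)) = symbolForm P r x α := by
  rw [symbolForm_apply, symbolForm_apply,
    ← (Equiv.arrowCongr σ.symm (Equiv.refl (Fin n))).sum_comp]
  refine Finset.sum_congr rfl fun J _ => ?_
  congr 1
  · exact Equiv.prod_comp σ fun k => (α k (EuclideanSpace.single (J k) 1) : ℂ)
  · congr 2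
    exact Equiv.prod_comp σ fun k => centredCoord x (J k)

theorem symbolForm_proj [T2Space M] (P : SmoothFun n M → SmoothFun n M) (r : ℕ) (x : M)
    (J : Fin r → Fin n) :
    symbolForm P r x (fun k => EuclideanSpace.proj (J k)) = P (∏ k, centredCoord x (J k)) x := by
  rw [symbolForm_apply, Finset.sum_eq_single J]
  · simp
  · intro K _ hK
    obtain ⟨k, hk⟩ := Function.ne_iff.1 hK
    rw [Finset.prod_eq_zero (Finset.mem_univ k) (by simp [hk.symm]), zero_mul]
  · simp

/-- The cut-off coordinates in `symbolForm` are chosen separately for each `x`, so smoothness is not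
visible there. Near `x₁`, fixed functions `h k` equal to coordinates of the chart at `x₀` can be
used instead: the value is `P (∏ (h k - h k x))` at `x`. Expanding the product gives a finite sum of
smooth coefficients times `P` of fixed functions. -/
theorem contMDiffOn_symbolForm_coframe [T2Space M] {r : ℕ} {P : SmoothFun n M → SmoothFun n M}
    (hP : IsDiffOpOfOrder r P) (x₀ : M) (K : Fin r → Fin n) :
    ContMDiffOn (𝓡 n) 𝓘(ℝ, ℂ) ∞ (fun x => symbolForm P r x (fun k => coframe x₀ (K k) x))
      (chartAt 𝔼 x₀).source := by
  intro x₁ hx₁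
  have hu : ∀ m : Fin n, ContMDiffOn (𝓡 n) 𝓘(ℝ, ℂ) ∞ (fun x => (extChartAt (𝓡 n) x₀ x m : ℂ))
      (chartAt 𝔼 x₀).source := fun m =>
    (Complex.ofRealCLM.contDiff.comp (EuclideanSpace.proj m : 𝔼 →L[ℝ] ℝ).contDiff).contMDiff.comp_contMDiffOn
      contMDiffOn_extChartAt
  choose h hh using fun k =>
    exists_smoothFun_eventuallyEq_of_contMDiffOn (chartAt 𝔼 x₀).open_source (hu (K k)) hx₁
  refine ContMDiffAt.contMDiffWithinAt ?_
  have h1 : (fun x => symbolForm P r x (fun k => coframe x₀ (K k) x)) =ᶠ[𝓝 x₁] fun x =>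
      ∑ t ∈ (Finset.univ : Finset (Fin r)).powerset,
        (∏ k ∈ Finset.univ \ t, -h k x) * P (∏ k ∈ t, h k) x := by
    filter_upwards [Filter.eventually_all.2 fun k => eventually_eventually_nhds.2 (hh k),
      (chartAt 𝔼 x₀).open_source.mem_nhds hx₁] with x hx hx₀
    have hxs : x ∈ (extChartAt (𝓡 n) x₀).source := by simpa using hx₀
    have h2 : ∀ k, h k - constFun (h k x) ∈ vanishingIdeal x := fun k => sub_self (h k x)
    have h3 := hP.apply_prod h2
    have h4 : ∀ k j, partialDeriv j (coordExpr (h k - constFun (h k x)) x) (extChartAt (𝓡 n) x x) =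
        (coframe x₀ (K k) x (EuclideanSpace.single j 1) : ℂ) := fun k j => by
      rw [coframe_single hxs]
      refine partialDeriv_coordExpr_eq_jacobian hxs (c := h k x) ?_ j
      filter_upwards [hx k] with x' hx'
      change h k x' - h k x = _
      rw [hx']
    simp only [h4] at h3
    rw [symbolForm_apply, ← h3]
    have h5 : ∏ k, (h k - constFun (h k x)) = ∑ t ∈ (Finset.univ : Finset (Fin r)).powerset,
        constFun (∏ k ∈ Finset.univ \ t, -h k x) * ∏ k ∈ t, h k := by
      have h6 : ∀ k, h k - constFun (h k x) = h k + constFun (-h k x) := fun k => by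
        ext x'
        exact sub_eq_add_neg _ _
      simp only [h6]
      rw [Finset.prod_add]
      refine Finset.sum_congr rfl fun t _ => ?_
      rw [constFun_prod, mul_comm]
    rw [h5, hP.map_sum, smoothFun_sum_apply]
    refine Finset.sum_congr rfl fun t _ => ?_
    rw [hP.map_const_mul]
    rfl
  refine ContMDiffAt.congr_of_eventuallyEq (contMDiffAt_finsetSum fun t _ => ?_) h1
  refine ContMDiffAt.mul ?_ (P _).contMDiff.contMDiffAt
  exact contMDiffAt_finsetProd fun k _ => (h k).contMDiff.contMDiffAt.neg

/-- The tensor field of order `r` whose quantized has the same principal symbol as a differential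
operator of order `r`. -/
def IsDiffOpOfOrder.symbol [T2Space M] {r : ℕ} {P : SmoothFun n M → SmoothFun n M}
    (hP : IsDiffOpOfOrder r P) (ħ : ℝ) : SymTensorField n M r where
  -- The factor removed here is the one that `SymTensorField.quantized_pow_self` produces.
  val x := (((-Complex.I * ħ) ^ r * r.factorial : ℂ)⁻¹ • symbolForm P r x :
    MultilinearMap ℝ (fun _ : Fin r => 𝔼 →L[ℝ] ℝ) ℂ)
  symm x σ α :=
    congrArg (((-Complex.I * ħ) ^ r * r.factorial : ℂ)⁻¹ * ·) (symbolForm_symm P r x σ α)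
  smooth x₀ J := contMDiffOn_const.mul (contMDiffOn_symbolForm_coframe hP x₀ J)

theorem IsDiffOpOfOrder.symbol_coordCovector [T2Space M] {r : ℕ}
    {P : SmoothFun n M → SmoothFun n M} (hP : IsDiffOpOfOrder r P) (ħ : ℝ) (x : M)
    (J : Fin r → Fin n) :
    (hP.symbol ħ).val x (fun k => coordCovector x (J k) x) =
      ((-Complex.I * ħ) ^ r * r.factorial : ℂ)⁻¹ * P (∏ k, centredCoord x (J k)) x := by
  have h : symbolForm P r x (fun k => coframe x (J k) x) = P (∏ k, centredCoord x (J k)) x := by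
    rw [← symbolForm_proj]
    exact congrArg _ (funext fun k => coordCovector_self x (J k))
  exact congrArg (((-Complex.I * ħ) ^ r * r.factorial : ℂ)⁻¹ * ·) h

theorem IsDiffOpOfOrder.symbol_quantized_pow [T2Space M] {r : ℕ}
    {P : SmoothFun n M → SmoothFun n M} (hP : IsDiffOpOfOrder r P) (g : PseudoRiemannianMetric n M)
    {ħ : ℝ} (hħ : ħ ≠ 0) {h : SmoothFun n M} {x : M} (hx : h x = 0) :
    (hP.symbol ħ).quantized g ħ (h ^ r) x = P (h ^ r) x := by
  have h1 := hP.apply_prod (h := fun _ => h) (x := x) fun _ => hx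
  rw [Finset.prod_const, Finset.card_univ, Fintype.card_fin] at h1
  have h2 : ((-Complex.I * ħ) ^ r * r.factorial : ℂ) ≠ 0 := by
    have : (r.factorial : ℂ) ≠ 0 := by exact_mod_cast r.factorial_ne_zero
    have : (ħ : ℂ) ≠ 0 := by exact_mod_cast hħ
    simp [*]
  rw [h1, SymTensorField.quantized_pow_self g ħ _ hx, ← mul_assoc, Finset.mul_sum]
  refine Finset.sum_congr rfl fun J _ => ?_
  rw [hP.symbol_coordCovector, mul_left_comm, mul_inv_cancel_left₀ h2]

/-- One factor `b` is split off at a time, and the induction is applied to the additive map `a ↦ T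
(a * b)`. -/
theorem eq_zero_of_mem_ideal_pow {A W : Type*} [CommRing A] [AddCommGroup W] {I : Ideal A} {r : ℕ}
    (T : A →+ W) (hT : ∀ h : Fin (r + 1) → A, (∀ k, h k ∈ I) → T (∏ k, h k) = 0) {f : A}
    (hf : f ∈ I ^ (r + 1)) : T f = 0 := by
  induction r generalizing T f with
  | zero => simpa using hT (fun _ => f) fun _ => by simpa using hf
  | succ r ih =>
    rw [pow_succ] at hf
    refine Submodule.mul_induction_on hf (fun a ha b hb => ?_) fun a b ha hb => by
      rw [map_add, ha, hb, add_zero]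
    refine ih (T.comp (AddMonoidHom.mulRight b)) (fun h hh => ?_) ha
    have := hT (Fin.snoc (α := fun _ => A) h b) fun k => by
      refine Fin.lastCases ?_ (fun k => ?_) k
      · simpa using hb
      · simpa using hh k
    simpa [Fin.prod_univ_castSucc] using this

/-- Polarization writes `r!` times a product as a signed sum of `r`-th powers of elements of the
ideal; `r!` is invertible on `W`. -/
theorem map_prod_eq_zero_of_map_pow {A W : Type*} [CommRing A] [AddCommGroup W] [Module ℝ W]
    {I : Ideal A} {r : ℕ} (T : A →+ W) (hT : ∀ h ∈ I, T (h ^ r) = 0) {h : Fin r → A}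
    (hh : ∀ k, h k ∈ I) : T (∏ k, h k) = 0 := by
  have h1 := polarization (T.toIntLinearMap.compMultilinearMap (MultilinearMap.mkPiAlgebra ℤ (Fin r) A))
    (fun σ v => congrArg T (Equiv.prod_comp σ v)) h
  have h2 : ∀ s : Finset (Fin r), T.toIntLinearMap.compMultilinearMap
      (MultilinearMap.mkPiAlgebra ℤ (Fin r) A) (fun _ => ∑ i ∈ s, h i) = 0 := fun s => by
    simpa using hT _ (Ideal.sum_mem _ fun i _ => hh i)
  simp only [h2, smul_zero, Finset.sum_const_zero] at h1
  have h3 : (r.factorial : ℝ) • T (∏ k, h k) = 0 := by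
    rw [Nat.cast_smul_eq_nsmul]
    rcases neg_one_pow_eq_or ℤ r with hr | hr <;> simpa [hr, eq_comm] using h1
  exact (smul_eq_zero.1 h3).resolve_left (by positivity)

/-! ### Existence of the dequantized -/

/-- Induction on the order by removing the principal symbol. The bound on the degrees of `Φ`
guarantees that the slot receiving the symbol is empty. -/
theorem IsDiffOpOfOrder.exists_quantized_eq [T2Space M] (g : PseudoRiemannianMetric n M) {ħ : ℝ}
    (hħ : ħ ≠ 0) {r : ℕ} {P : SmoothFun n M → SmoothFun n M} (hP : IsDiffOpOfOrder r P) :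
    ∃ Φ : TensorField n M, (∀ s, r < s → ∀ x, (Φ.comp s).val x = 0) ∧
      ∀ f x, P f x = Φ.quantized g ħ f x := by
  induction r generalizing P with
  | zero =>
    have hN : ∀ s, 0 < s → ∀ x,
        (Function.update (zeroTensorField (n := n) (M := M)).comp 0 (scalarField (P 1)) s).val x = 0 :=
      fun s hs x => by
        rw [Function.update_of_ne hs.ne']
        rfl
    refine ⟨⟨Function.update zeroTensorField.comp 0 (scalarField (P 1)), 0, hN⟩, hN, fun f x => ?_⟩
    rw [TensorField.quantized_eq_sum g ħ _ hN, Finset.sum_range_one]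
    simp only [Function.update_self]
    rw [scalarField_quantized]
    -- An operator of order zero is multiplication by `P 1`, since it does not see `f - f x` at `x`.
    have h1 : f - constFun (f x) * 1 ∈ vanishingIdeal x ^ (0 + 1) := by
      rw [zero_add, pow_one, mem_vanishingIdeal, mul_one]
      exact sub_self (f x)
    have h2 := hP.map_add (f - constFun (f x) * 1) (constFun (f x) * 1)
    rw [sub_add_cancel, hP.map_const_mul] at h2
    rw [h2]
    change P _ x + f x * P 1 x = _
    rw [mem_vanishingIdeal.1 (hP.map_pow x _ h1), zero_add, mul_comm]
  | succ r ih =>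
    set Ψ := hP.symbol ħ
    let Q : SmoothFun n M → SmoothFun n M :=
      fun f => P f - ⟨Ψ.quantized g ħ f, Ψ.contMDiff_quantized g ħ f⟩
    have hQ : ∀ f x, Q f x = P f x - Ψ.quantized g ħ f x := fun _ _ => rfl
    have hadd : ∀ f h x, Q (f + h) x = Q f x + Q h x := fun f h x => by
      rw [hQ, hQ, hQ, Ψ.quantized_add, hP.map_add]
      change P f x + P h x - _ = _
      ring
    -- The symbol was chosen so that `Q (h ^ (r + 1))` vanishes at `x` for `h ∈ 𝔪ₓ`. Polarization
    -- extends this to products of `r + 1` such functions, and additivity to all of `𝔪ₓ ^ (r + 1)`.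
    have hQ' : IsDiffOpOfOrder r Q := by
      refine ⟨fun f h => ContMDiffMap.ext fun x => hadd f h x, fun c f => ContMDiffMap.ext fun x => ?_,
        fun x f hf => ?_⟩
      · rw [hQ, Ψ.quantized_const_mul, hP.map_const_mul]
        exact (mul_sub c (P f x) (Ψ.quantized g ħ f x)).symm
      · refine eq_zero_of_mem_ideal_pow (AddMonoidHom.mk' (fun f => Q f x) fun f h => hadd f h x)
          (fun h hh => map_prod_eq_zero_of_map_pow _ (fun h hh => ?_) hh) hf
        exact sub_eq_zero.2 (hP.symbol_quantized_pow g hħ hh).symm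
    obtain ⟨Φ, hΦ, hΦQ⟩ := ih hQ'
    have hN : ∀ s, r + 1 < s → ∀ x, (Function.update Φ.comp (r + 1) Ψ s).val x = 0 := fun s hs x => by
      rw [Function.update_of_ne hs.ne']
      exact hΦ s (by omega) x
    refine ⟨⟨Function.update Φ.comp (r + 1) Ψ, r + 1, hN⟩, hN, fun f x => ?_⟩
    rw [TensorField.quantized_eq_sum g ħ _ hN, Finset.sum_range_succ]
    simp only [Function.update_self]
    rw [← sub_eq_iff_eq_add, ← hQ, hΦQ, TensorField.quantized_eq_sum g ħ Φ hΦ]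
    refine Finset.sum_congr rfl fun s hs => ?_
    simp only [Function.update_of_ne (Finset.mem_range.1 hs).ne]


end

end Dequantization

end

theorem mainTheorem1 {n : ℕ} {M : Type*} [TopologicalSpace M] [T2Space M]
    [SecondCountableTopology M] [ChartedSpace (EuclideanSpace ℝ (Fin n)) M]
    [IsManifold (𝓡 n) ∞ M] (g : Dequantization.PseudoRiemannianMetric n M)
    (ħ : ℝ) (hħ : 0 < ħ)
    (P : Dequantization.SmoothFun n M → Dequantization.SmoothFun n M)
    (hP : Dequantization.IsLinearDiffOp P) :
    Dequantization.IsSecondOrderEquation g (Dequantization.associatedField g ħ P) ↔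
      ∃ U : Dequantization.SmoothFun n M, ∀ (f : Dequantization.SmoothFun n M) (x : M),
        P f x = -((ħ : ℂ) ^ 2 / 2) * Dequantization.laplacian g f x + U x * f x :=
  Dequantization.isSecondOrderEquation_associatedField_iff g hħ.ne' <|
    have ⟨_, hr⟩ := hP
    have ⟨Φ, _, hΦ⟩ := hr.exists_quantized_eq g hħ.ne'
    ⟨Φ, hΦ⟩
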